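/- **Setting.** Let $k$ be a field of characteristic $0$. A pseudo-tensor $k$-category $\mathcal C$ consists of objects, of $k$-vector spaces of operations $P_I(\{y_i\}_{i\in I},x)$ for finite nonempty sets $I$, and of $k$-polylinear composition maps along surjections $J\twoheadrightarrow I$, which are associative and have units $1_x\in P_1(\{x\},x)$; write $P_n$ for $I=\{1,\dots,n\}$. All operads below are indexed by $n\ge 1$. Let $\mathcal Lie$ be the Lie operad over $k$: $\mathcal Lie(n)$ is the space of Lie polynomials in $n$ variables that are linear in each variable. A Lie algebra in $\mathcal C$ is an object $B$ with maps $\mathcal Lie(n)\to P_n(\{B\},B)$ respecting units, symmetric groups and compositions; a cosimplicial Lie algebra $B^\bullet$ in $\mathcal C$ is a cosimplicial object whose terms are Lie algebras and whose structure maps are morphisms of Lie algebras. **The complex.** $MB^\bullet$ is the complex with $(MB)^n=B^n$ for $n\ge 0$ and differential $\sum_{i=0}^{n+1}(-1)^i\delta^i:B^n\to B^{n+1}$ (the $\delta^i$ being the cofaces). The complex $P_n(\{MB\},MB)$ has degree-$r$ part $$\prod_{a_1,\dots,a_n,b\ge 0,\ b=a_1+\dots+a_n+r}P_n(\{B^{a_1},\dots,B^{a_n}\},B^b),$$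 and differential $f\mapsto d\circ f-(-1)^{|f|}\sum_i f\circ_i d$, where $f\circ_i d$ carries the Koszul sign $(-1)^{a_1+\dots+a_{i-1}}$; composition and the action of $\Sigma_n$ carry the usual Koszul signs. **The operad.** Let $Z([m])$ be the complex of unnormalized simplicial chains of $\Delta^m$ over $k$, with $p$-simplices in degree $-p$; it is a cosimplicial complex $Z$. Let $\mathcal Z(n)=\mathrm{Hom}_\Delta(Z,Z^{\otimes n})$ be the complex whose degree-$r$ part consists of the families of linear maps $Z([m])\to Z([m])^{\otimes n}$ of degree $r$, natural in $[m]$, with differential $\varphi\mapsto d\circ\varphi-(-1)^{|\varphi|}\varphi\circ d$; it is an operad in complexes by permutation of tensor factors and composition $$\gamma(\varphi;\varphi_1,\dots,\varphi_n)=(-1)^{|\varphi|\sum_i|\varphi_i|}(\varphi_1\otimes\dots\otimes\varphi_n)\circ\varphi .$$ For $\varphi\in\mathcal Z(n)$ of degree $0$, let $\varepsilon(\varphi)\in k$ be the image under the augmentation $Z([0])^{\otimes n}\to k$ of the value of $\varphi$ at the vertex of $\Delta^0$. Let $\mathcal Y(n)=\mathcal Z(n)\otimes\mathcal Lie(n)$,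 and let $\tau_{\le 0}\mathcal Y$ be its truncation (the components of negative degree and the cocycles of degree $0$), with the augmentation $\tau_{\le0}\mathcal Y\to\mathcal Lie$ that sends $\varphi\otimes\psi$ to $\varepsilon(\varphi)\psi$ and is $0$ in negative degrees. **Theorem.** Let $\mathcal C$ be any pseudo-tensor $k$-category and $B^\bullet$ any cosimplicial Lie algebra in $\mathcal C$. Then $MB^\bullet$ is a homotopy Lie algebra in the category of complexes in $\mathcal C$, that is, an algebra over a homotopy Lie operad. Concretely: 1. $\tau_{\le 0}\mathcal Y\to\mathcal Lie$ is a homotopy Lie operad: $\tau_{\le 0}\mathcal Y$ is an operad in complexes of $k$-vector spaces, the augmentation is a map of such operads, and $\tau_{\le 0}\mathcal Y(n)\to\mathcal Lie(n)$ is a quasi-isomorphism for every $n\ge 1$. 2. The maps $F_n:\tau_{\le 0}\mathcal Y(n)\to P_n(\{MB\},MB)$, $n\ge 1$, defined as follows, are maps of complexes and respect units, the actions of the symmetric groups, and compositions. If $\varphi\in\mathcal Z(n)$ has degree $r$, $\psi\in\mathcal Lie(n)$ and $b=a_1+\dots+a_n+r$, write $\varphi(\mathrm{id}_{[b]})=\sum_s\alpha_s\,s_1\otimes\dots\otimes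 s_n$ with $\alpha_s\in k$, the sum being over families $s=(s_1,\dots,s_n)$ of simplices of $\Delta^b$. Then the component of $F_n(\varphi\otimes\psi)$ in $P_n(\{B^{a_1},\dots,B^{a_n}\},B^b)$ is $$(-1)^{r(r+1)/2}\sum_{s_i:[a_i]\to[b]}\alpha_s\;\psi_b\circ(B(s_1),\dots,B(s_n)),$$ where $\psi_b\in P_n(\{B^b\},B^b)$ is the action of $\psi$ on the Lie algebra $B^b$ and $B(s_i):B^{a_i}\to B^b$ is the map induced by $s_i$. -/

import Mathlib

universe u v w w'

open CategoryTheory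
open scoped TensorProduct

/-! ## Index sets -/

instance sigmaNonempty {I : Type} {K : I → Type} [Nonempty I] [∀ i, Nonempty (K i)] :
    Nonempty (Σ i, K i) :=
  nonempty_sigma.2 ⟨Classical.arbitrary I, inferInstance⟩

/-- Disjoint unions of a linearly ordered family of linearly ordered sets are ordered
lexicographically (block after block). -/
instance sigmaLexOrder {I : Type} {K : I → Type} [LinearOrder I] [∀ i, LinearOrder (K i)] :
    LinearOrder (Σ i, K i) :=
  inferInstanceAs (LinearOrder (Σₗ i, K i))

/-! ## Pseudo-tensor categories -/

/-- A pseudo-tensor `k`-category.  For every finite nonempty set `I`, every family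
`y : I → Obj` and every object `x` there is a `k`-vector space of operations `P I y x`.

A surjection `π : J → I` of finite nonempty sets is the same as a decomposition of `J` into
nonempty fibres `K i` (`i ∈ I`).  The `k`-polylinear composition along `π` is given by `comp`
for `J` the disjoint union `Σ i, K i`, together with the transport of operations along
bijections of index sets (`relabel`).  The laws say that transport is functorial and compatible
with composition, that composition is associative, and that it has units. -/
structure PseudoTensorCategory (k : Type u) [Field k] where
  Obj : Type w
  P : (I : Type) → [Finite I] → [Nonempty I] → (I → Obj) → Obj → Type v
  [addCommGroup : ∀ (I : Type) [Finite I] [Nonempty I] (y : I → Obj) (x : Obj),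
    AddCommGroup (P I y x)]
  [module : ∀ (I : Type) [Finite I] [Nonempty I] (y : I → Obj) (x : Obj), Module k (P I y x)]
  unit : (x : Obj) → P Unit (fun _ => x) x
  relabel : {I J : Type} → [Finite I] → [Nonempty I] → [Finite J] → [Nonempty J] →
    (e : I ≃ J) → {y : J → Obj} → {x : Obj} → P I (fun i => y (e i)) x →ₗ[k] P J y x
  comp : {I : Type} → {K : I → Type} → [Finite I] → [Nonempty I] → [∀ i, Finite (K i)] →
    [∀ i, Nonempty (K i)] → {z : (Σ i, K i) → Obj} → {y : I → Obj} → {x : Obj} →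
    P I y x →ₗ[k] MultilinearMap k (fun i => P (K i) (fun j => z ⟨i, j⟩) (y i))
      (P (Σ i, K i) z x)
  relabel_refl : ∀ {I : Type} [Finite I] [Nonempty I] {y : I → Obj} {x : Obj} (f : P I y x),
    relabel (Equiv.refl I) (y := y) f = f
  relabel_trans : ∀ {I J L : Type} [Finite I] [Nonempty I] [Finite J] [Nonempty J] [Finite L]
    [Nonempty L] (e : I ≃ J) (e' : J ≃ L) {y : L → Obj} {x : Obj}
    (f : P I (fun i => y (e' (e i))) x),
    relabel (e.trans e') (y := y) f = relabel e' (relabel e (y := fun j => y (e' j)) f)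
  relabel_comp : ∀ {I I' : Type} {K : I' → Type} [Finite I] [Nonempty I] [Finite I'] [Nonempty I']
    [∀ i, Finite (K i)] [∀ i, Nonempty (K i)] (e : I ≃ I') {z : (Σ i, K i) → Obj}
    {y : I' → Obj} {x : Obj} (f : P I (fun i => y (e i)) x)
    (g : ∀ i, P (K i) (fun j => z ⟨i, j⟩) (y i)),
    comp (z := z) (relabel e f) g =
      relabel (Equiv.sigmaCongrLeft (β := K) e)
        (comp (K := fun i => K (e i)) (z := fun p => z ⟨e p.1, p.2⟩) f (fun i => g (e i)))
  comp_relabel : ∀ {I : Type} {K K' : I → Type} [Finite I] [Nonempty I]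
    [∀ i, Finite (K i)] [∀ i, Nonempty (K i)] [∀ i, Finite (K' i)] [∀ i, Nonempty (K' i)]
    (e : ∀ i, K i ≃ K' i) {z : (Σ i, K' i) → Obj} {y : I → Obj} {x : Obj} (f : P I y x)
    (g : ∀ i, P (K i) (fun j => z ⟨i, e i j⟩) (y i)),
    comp (z := z) f (fun i => relabel (e i) (y := fun j => z ⟨i, j⟩) (g i)) =
      relabel (Equiv.sigmaCongrRight e) (comp (z := fun p => z ⟨p.1, e p.1 p.2⟩) f g)
  comp_assoc : ∀ {I : Type} {K : I → Type} {L : (i : I) → K i → Type} [Finite I] [Nonempty I]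
    [∀ i, Finite (K i)] [∀ i, Nonempty (K i)] [∀ i j, Finite (L i j)] [∀ i j, Nonempty (L i j)]
    {t : (Σ i, Σ j, L i j) → Obj} {z : (Σ i, K i) → Obj} {y : I → Obj} {x : Obj}
    (f : P I y x) (g : ∀ i, P (K i) (fun j => z ⟨i, j⟩) (y i))
    (h : ∀ i j, P (L i j) (fun l => t ⟨i, j, l⟩) (z ⟨i, j⟩)),
    relabel (Equiv.sigmaAssoc L)
      (comp (K := fun p : Σ i, K i => L p.1 p.2) (z := fun p => t ⟨p.1.1, p.1.2, p.2⟩)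
        (comp (z := z) f g) (fun p => h p.1 p.2)) =
      comp (z := t) f
        (fun i => comp (z := fun q => t ⟨i, q⟩) (y := fun j => z ⟨i, j⟩) (g i) (h i))
  unit_comp : ∀ {J : Type} [Finite J] [Nonempty J] {y : J → Obj} {x : Obj} (f : P J y x),
    relabel (Equiv.uniqueSigma (fun _ : Unit => J)) (y := y)
      (comp (K := fun _ : Unit => J) (z := fun p => y p.2) (unit x) (fun _ => f)) = f
  comp_unit : ∀ {I : Type} [Finite I] [Nonempty I] {y : I → Obj} {x : Obj} (f : P I y x),
    relabel (Equiv.sigmaPUnit I) (y := y)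
      (comp (K := fun _ : I => Unit) (z := fun p => y p.1) f (fun i => unit (y i))) = f

namespace PseudoTensorCategory

attribute [instance] PseudoTensorCategory.addCommGroup PseudoTensorCategory.module

variable {k : Type u} [Field k] (C : PseudoTensorCategory.{u, v, w} k)

/-- Composing an operation with a unary operation on its output. -/
def postcomp {I : Type} [Finite I] [Nonempty I] {y : I → C.Obj} {x x' : C.Obj}
    (g : C.P Unit (fun _ => x) x') (f : C.P I y x) : C.P I y x' :=
  C.relabel (Equiv.uniqueSigma (fun _ : Unit => I)) (y := y)
    (C.comp (K := fun _ : Unit => I) (z := fun p => y p.2) g (fun _ => f))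

/-- Composing an operation with unary operations on its inputs. -/
def precomp {I : Type} [Finite I] [Nonempty I] {y y' : I → C.Obj} {x : C.Obj}
    (f : C.P I y x) (h : ∀ i, C.P Unit (fun _ => y' i) (y i)) : C.P I y' x :=
  C.relabel (Equiv.sigmaPUnit I) (y := y')
    (C.comp (K := fun _ : I => Unit) (z := fun p => y' p.1) f h)

end PseudoTensorCategory

namespace PseudoTensorCategory

variable {k : Type u} [Field k] (C : PseudoTensorCategory.{u, v, w} k)

theorem relabel_unit_eq {K : Type} [Finite K] [Nonempty K] (e e' : K ≃ Unit) {y x : C.Obj}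
    (f : C.P K (fun _ => y) x) :
    C.relabel e (y := fun _ => y) f = C.relabel e' (y := fun _ => y) f := by
  rw [Subsingleton.elim e e']

/-- The `k`-linear category underlying a pseudo-tensor category: morphisms are the unary
operations. -/
instance : Category.{v} C.Obj where
  Hom x y := C.P Unit (fun _ => x) y
  id x := C.unit x
  comp f g := C.postcomp g f
  id_comp f := by
    refine Eq.trans ?_ (C.comp_unit f)
    exact C.relabel_unit_eq _ _ _
  comp_id f := C.unit_comp f
  assoc {x y z t} f g h := by
    have := C.comp_assoc (I := Unit) (K := fun _ => Unit) (L := fun _ _ => Unit)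
      (t := fun _ => x) (z := fun _ => y) (y := fun _ => z) h (fun _ => g) (fun _ _ => f)
    have h1 := C.relabel_comp (I := Σ _ : Unit, Unit) (I' := Unit) (K := fun _ => Unit)
      (Equiv.uniqueSigma (fun _ : Unit => Unit)) (z := fun _ => x) (y := fun _ => y)
      (C.comp (K := fun _ : Unit => Unit) (z := fun _ => y) h (fun _ => g)) (fun _ => f)
    have h2 := C.comp_relabel (I := Unit) (K := fun _ => Σ _ : Unit, Unit) (K' := fun _ => Unit)
      (fun _ => Equiv.uniqueSigma (fun _ : Unit => Unit)) (z := fun _ => x) (y := fun _ => z) h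
      (fun _ => C.comp (K := fun _ : Unit => Unit) (z := fun _ => x) g (fun _ => f))
    simp only [postcomp]
    erw [h1, h2, ← this]
    erw [← C.relabel_trans, ← C.relabel_trans, ← C.relabel_trans]
    exact C.relabel_unit_eq _ _ _

theorem postcomp_add {I : Type} [Finite I] [Nonempty I] {y : I → C.Obj} {x x' : C.Obj}
    (g : C.P Unit (fun _ => x) x') (f f' : C.P I y x) :
    C.postcomp g (f + f') = C.postcomp g f + C.postcomp g f' := by
  have := (C.comp (K := fun _ : Unit => I) (z := fun p => y p.2) (y := fun _ => x)
    g).map_update_add (fun _ => f) () f f'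
  have hu : ∀ c : C.P I y x, Function.update (fun _ : Unit => f) () c = fun _ => c :=
    fun c => funext fun _ => rfl
  simp only [hu] at this
  simp only [postcomp, this]
  exact map_add _ _ _

theorem add_postcomp {x y z : C.Obj} (g g' : C.P Unit (fun _ => y) z)
    (f : C.P Unit (fun _ => x) y) :
    C.postcomp (g + g') f = C.postcomp g f + C.postcomp g' f := by
  simp [postcomp]

instance : Preadditive C.Obj where
  homGroup x y := C.addCommGroup Unit (fun _ => x) y
  add_comp _ _ _ f f' g := C.postcomp_add g f f'
  comp_add _ _ _ f g g' := C.add_postcomp g g' f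

end PseudoTensorCategory

/-! ## The Lie operad -/

section LieOperad

variable (k : Type u) [Field k]

/-- `LieMonomial k S x`: `x` is a bracket monomial in the letters `e_i`, `i ∈ S`, in which each
of these letters occurs exactly once. -/
inductive LieMonomial {X : Type} : Set X → FreeLieAlgebra k X → Prop where
  | of (i : X) : LieMonomial {i} (FreeLieAlgebra.of k i)
  | bracket {S T : Set X} {x y : FreeLieAlgebra k X} : Disjoint S T → LieMonomial S x →
      LieMonomial T y → LieMonomial (S ∪ T) ⁅x, y⁆

/-- Lie polynomials containing each letter `e_i`, `i ∈ S`, exactly once, and no other letter. -/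
noncomputable def lieSpan {X : Type} (S : Set X) : Submodule k (FreeLieAlgebra k X) :=
  Submodule.span k {x | LieMonomial k S x}

/-- `Lie(I)`: the space of Lie polynomials in the variables `e_i`, `i ∈ I`, containing each
variable exactly once. -/
abbrev LieOp (I : Type) : Type u := lieSpan k (Set.univ : Set I)

variable {k}

theorem bracket_mem_lieSpan {X : Type} {S T : Set X} (hST : Disjoint S T)
    {x y : FreeLieAlgebra k X} (hx : x ∈ lieSpan k S) (hy : y ∈ lieSpan k T) :
    ⁅x, y⁆ ∈ lieSpan k (S ∪ T) := by
  induction hx, hy using Submodule.span_induction₂ with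
  | mem_mem x y hx hy => exact Submodule.subset_span (LieMonomial.bracket hST hx hy)
  | zero_left y hy => simp
  | zero_right x hx => simp
  | add_left x y z _ _ _ h1 h2 => rw [add_lie]; exact add_mem h1 h2
  | add_right x y z _ _ _ h1 h2 => rw [lie_add]; exact add_mem h1 h2
  | smul_left r x y _ _ h => rw [smul_lie]; exact Submodule.smul_mem _ _ h
  | smul_right r x y _ _ h => rw [lie_smul]; exact Submodule.smul_mem _ _ h

theorem lift_mem_lieSpan {X Y : Type} (h : X → FreeLieAlgebra k Y) (T : X → Set Y)
    (hT : Pairwise fun i j => Disjoint (T i) (T j)) (hh : ∀ i, h i ∈ lieSpan k (T i))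
    {S : Set X} {x : FreeLieAlgebra k X} (hx : x ∈ lieSpan k S) :
    FreeLieAlgebra.lift k h x ∈ lieSpan k (⋃ i ∈ S, T i) := by
  induction hx using Submodule.span_induction with
  | mem x hx =>
    induction hx with
    | of i => simpa using hh i
    | bracket hd _ _ h1 h2 =>
      rw [LieHom.map_lie, Set.biUnion_union]
      refine bracket_mem_lieSpan ?_ h1 h2
      simp only [Set.disjoint_iUnion_left, Set.disjoint_iUnion_right]
      intro i hi j hj
      exact hT (fun e => Set.disjoint_left.1 hd hj (by rw [e]; exact hi))
  | zero => simp
  | add x y _ _ h1 h2 => rw [map_add]; exact add_mem h1 h2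
  | smul r x _ h1 => rw [map_smul]; exact Submodule.smul_mem _ _ h1

theorem lift_congr_lieSpan {X Y : Type} (h h' : X → FreeLieAlgebra k Y) {S : Set X}
    (hh : ∀ i ∈ S, h i = h' i) {x : FreeLieAlgebra k X} (hx : x ∈ lieSpan k S) :
    FreeLieAlgebra.lift k h x = FreeLieAlgebra.lift k h' x := by
  induction hx using Submodule.span_induction with
  | mem x hx =>
    induction hx with
    | of i => simpa using hh i
    | bracket hd _ _ h1 h2 =>
      rw [LieHom.map_lie, LieHom.map_lie, h1 fun i hi => hh i (Or.inl hi),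
        h2 fun i hi => hh i (Or.inr hi)]
  | zero => simp
  | add x y _ _ h1 h2 => rw [map_add, map_add, h1, h2]
  | smul r x _ h1 => rw [map_smul, map_smul, h1]

/-- The value of a multilinear Lie polynomial is linear in each variable. -/
theorem lift_update_lieSpan {X Y : Type} [DecidableEq X] (h : X → FreeLieAlgebra k Y) (i : X)
    (r : k) (a b : FreeLieAlgebra k Y) {S : Set X} (hi : i ∈ S)
    {x : FreeLieAlgebra k X} (hx : x ∈ lieSpan k S) :
    FreeLieAlgebra.lift k (Function.update h i (r • a + b)) x =
      r • FreeLieAlgebra.lift k (Function.update h i a) x +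
        FreeLieAlgebra.lift k (Function.update h i b) x := by
  have key : ∀ (T : Set X) (y : FreeLieAlgebra k X) (c d : FreeLieAlgebra k Y),
      LieMonomial k T y → i ∉ T →
      FreeLieAlgebra.lift k (Function.update h i c) y =
        FreeLieAlgebra.lift k (Function.update h i d) y := by
    intro T y c d hy hT
    refine lift_congr_lieSpan _ _ (S := T) ?_ (Submodule.subset_span hy)
    intro j hj
    have : j ≠ i := fun e => hT (e ▸ hj)
    simp [this]
  induction hx using Submodule.span_induction with
  | mem x hx =>
    induction hx with
    | of j =>
      obtain rfl : i = j := hi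
      simp
    | @bracket S T x y hd hx hy h1 h2 =>
      simp only [LieHom.map_lie]
      rcases hi with hi | hi
      · have hT : i ∉ T := fun h => Set.disjoint_left.1 hd hi h
        rw [h1 hi, key T y (r • a + b) b hy hT, key T y a b hy hT, add_lie, smul_lie]
      · have hS : i ∉ S := fun h => Set.disjoint_left.1 hd h hi
        rw [h2 hi, key S x (r • a + b) b hx hS, key S x a b hx hS, lie_add, lie_smul]
  | zero => simp
  | add x y _ _ h1 h2 => simp only [map_add, h1, h2, smul_add]; abel
  | smul s x _ h1 => simp only [map_smul, h1, smul_add, smul_comm s r]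

/-- Substitution of Lie polynomials `g i` in the variables `e_(i,j)`, `j ∈ K i`, for the
variables `e_i`. -/
noncomputable def lieSubst {I : Type} {K : I → Type} (g : ∀ i, FreeLieAlgebra k (K i)) :
    FreeLieAlgebra k I →ₗ⁅k⁆ FreeLieAlgebra k (Σ i, K i) :=
  FreeLieAlgebra.lift k fun i =>
    FreeLieAlgebra.lift k (fun j => FreeLieAlgebra.of k (⟨i, j⟩ : Σ i, K i)) (g i)

theorem lieSubst_mem {I : Type} {K : I → Type} (f : LieOp k I) (g : ∀ i, LieOp k (K i)) :
    lieSubst (fun i => (g i : FreeLieAlgebra k (K i))) f ∈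
      lieSpan k (Set.univ : Set (Σ i, K i)) := by
  have := lift_mem_lieSpan
    (fun i => FreeLieAlgebra.lift k (fun j => FreeLieAlgebra.of k (⟨i, j⟩ : Σ i, K i))
      (g i : FreeLieAlgebra k (K i)))
    (fun i => ⋃ j ∈ (Set.univ : Set (K i)), {(⟨i, j⟩ : Σ i, K i)}) ?_ ?_ f.2
  · rw [show (Set.univ : Set (Σ i, K i)) = ⋃ i ∈ (Set.univ : Set I),
        ⋃ j ∈ (Set.univ : Set (K i)), {(⟨i, j⟩ : Σ i, K i)} from ?_]
    · exact this
    ext ⟨i, j⟩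
    simp
  · intro i i' hne
    simp only [Set.disjoint_left]
    rintro ⟨a, b⟩ h h'
    simp only [Set.mem_univ, Set.iUnion_true, Set.mem_iUnion, Set.mem_singleton_iff] at h h'
    obtain ⟨j, hj⟩ := h
    obtain ⟨j', hj'⟩ := h'
    exact hne ((congrArg Sigma.fst hj).symm.trans (congrArg Sigma.fst hj'))
  · intro i
    refine lift_mem_lieSpan _ (fun j => {(⟨i, j⟩ : Σ i, K i)}) ?_ ?_ (g i).2
    · intro j j' hne
      simpa [Set.disjoint_singleton] using hne
    · intro j
      exact Submodule.subset_span (LieMonomial.of _)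

/-- The identity operation of the Lie operad: the variable itself. -/
noncomputable def lieUnit : LieOp k Unit :=
  ⟨FreeLieAlgebra.of k (), Submodule.subset_span (by
    have h := LieMonomial.of (k := k) ()
    rwa [show ({()} : Set Unit) = Set.univ from Set.eq_univ_of_forall fun _ => rfl] at h)⟩

/-- Renaming of the variables. -/
noncomputable def lieRelabel {I J : Type} (e : I ≃ J) : LieOp k I →ₗ[k] LieOp k J :=
  (FreeLieAlgebra.lift k (fun i => FreeLieAlgebra.of k (e i)) :
    FreeLieAlgebra k I →ₗ[k] FreeLieAlgebra k J).restrict (fun x hx => by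
      have := lift_mem_lieSpan (fun i => FreeLieAlgebra.of k (e i)) (fun i => {e i})
        (fun i j h => by simpa using h) (fun i => Submodule.subset_span (LieMonomial.of _)) hx
      have h2 : (⋃ i ∈ (Set.univ : Set I), ({e i} : Set J)) = Set.univ := by
        ext j
        simp
      rw [h2] at this
      exact this)

theorem lieSubst_update {I : Type} {K : I → Type} [DecidableEq I] (f : LieOp k I)
    (g : ∀ i, LieOp k (K i)) (i : I) (r : k) (a b : LieOp k (K i)) :
    lieSubst (fun i' => (Function.update g i (r • a + b) i' : FreeLieAlgebra k (K i'))) f =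
      r • lieSubst (fun i' => (Function.update g i a i' : FreeLieAlgebra k (K i')))
        (f : FreeLieAlgebra k I) +
        lieSubst (fun i' => (Function.update g i b i' : FreeLieAlgebra k (K i')))
          (f : FreeLieAlgebra k I) := by
  have key : ∀ c : LieOp k (K i),
      lieSubst (fun i' => (Function.update g i c i' : FreeLieAlgebra k (K i'))) =
        FreeLieAlgebra.lift k (Function.update
          (fun i' => FreeLieAlgebra.lift k (fun j => FreeLieAlgebra.of k (⟨i', j⟩ : Σ i, K i))
            (g i' : FreeLieAlgebra k (K i'))) i
          (FreeLieAlgebra.lift k (fun j => FreeLieAlgebra.of k (⟨i, j⟩ : Σ i, K i))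
            (c : FreeLieAlgebra k (K i)))) := by
    intro c
    unfold lieSubst
    congr 1
    funext i'
    by_cases h : i' = i
    · subst h; simp
    · simp [h]
  rw [key, key, key, Submodule.coe_add, Submodule.coe_smul, map_add, map_smul]
  exact lift_update_lieSpan _ i r _ _ (Set.mem_univ i) f.2

/-- The composition of the Lie operad: substitution of Lie polynomials. -/
noncomputable def lieComp {I : Type} {K : I → Type} :
    LieOp k I →ₗ[k] MultilinearMap k (fun i => LieOp k (K i)) (LieOp k (Σ i, K i)) where
  toFun f :=
    { toFun := fun g => ⟨lieSubst (fun i => (g i : FreeLieAlgebra k (K i))) f, lieSubst_mem f g⟩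
      map_update_add' := fun g i a b => by
        apply Subtype.ext
        simpa using lieSubst_update f g i 1 a b
      map_update_smul' := fun g i r a => by
        apply Subtype.ext
        have h0 : lieSubst (fun i' => (Function.update g i 0 i' : FreeLieAlgebra k (K i')))
            (f : FreeLieAlgebra k I) = 0 := by
          simpa using lieSubst_update f g i 1 0 0
        simpa [h0] using lieSubst_update f g i r a 0 }
  map_add' f f' := by
    ext g
    exact map_add (lieSubst fun i => (g i : FreeLieAlgebra k (K i))) _ _
  map_smul' r f := by
    ext g
    exact map_smul (lieSubst fun i => (g i : FreeLieAlgebra k (K i))) r _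

end LieOperad

/-! ## Differential graded operads -/

/-- The sign `(-1)^n`, as an element of `k`. -/
def ksign (k : Type u) [Field k] (n : ℤ) : k := ((n.negOnePow : ℤ) : k)

/-- The Koszul sign of the permutation `e` of homogeneous factors of degrees `a i`: the product of
`(-1)^(a i * a i')` over all pairs `i < i'` whose order is reversed by `e`. -/
def koszulSign (k : Type u) [Field k] {I J : Type} [Fintype I] [LinearOrder I] [LinearOrder J]
    (e : I ≃ J) (a : I → ℤ) : k :=
  ∏ i, ∏ i', if i < i' ∧ e i' < e i then ksign k (a i * a i') else 1

/-- The data of an operad in the tensor category of complexes of `k`-modules (without the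
`0`-ary part), with operations indexed by finite nonempty sets `I`.  To write down Koszul signs
the sets `I` are given with a linear order, but all bijections, not only the monotone ones, act.

The complex `L(I)` has `deg I n` as its component of degree `n`, and differential `d I`; all
these components are subspaces of one ambient space `obj I`, of which only the subspaces `deg I n`
matter.  For `f` of degree `p` and `g i` of degree `q i`, the operadic composition is
`comp p q f g`.  The laws are stated in `DGOperadData.IsDGOperad`. -/
structure DGOperadData (k : Type u) [Field k] where
  obj : (I : Type) → [Fintype I] → [LinearOrder I] → [Nonempty I] → Type v
  [addCommGroup : ∀ (I : Type) [Fintype I] [LinearOrder I] [Nonempty I], AddCommGroup (obj I)]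
  [module : ∀ (I : Type) [Fintype I] [LinearOrder I] [Nonempty I], Module k (obj I)]
  deg : (I : Type) → [Fintype I] → [LinearOrder I] → [Nonempty I] → ℤ → Submodule k (obj I)
  d : (I : Type) → [Fintype I] → [LinearOrder I] → [Nonempty I] → obj I →ₗ[k] obj I
  unit : obj Unit
  relabel : {I J : Type} → [Fintype I] → [LinearOrder I] → [Nonempty I] → [Fintype J] →
    [LinearOrder J] → [Nonempty J] → (e : I ≃ J) → obj I →ₗ[k] obj J
  comp : {I : Type} → {K : I → Type} → [Fintype I] → [LinearOrder I] → [Nonempty I] →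
    [∀ i, Fintype (K i)] → [∀ i, LinearOrder (K i)] → [∀ i, Nonempty (K i)] →
    (p : ℤ) → (q : I → ℤ) →
    obj I →ₗ[k] MultilinearMap k (fun i => obj (K i)) (obj (Σ i, K i))

namespace DGOperadData

attribute [instance] DGOperadData.addCommGroup DGOperadData.module

variable {k : Type u} [Field k]

/-- The laws of an operad in complexes: every `L(I)` is a complex, transport along bijections and
composition are maps of complexes, transport is functorial, and composition is equivariant,
associative and unital, with the signs given by the Koszul rule. -/
structure IsDGOperad (L : DGOperadData.{u, v} k) : Prop where
  d_mem : ∀ {I : Type} [Fintype I] [LinearOrder I] [Nonempty I] (n : ℤ),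
    ∀ x ∈ L.deg I n, L.d I x ∈ L.deg I (n + 1)
  d_d : ∀ {I : Type} [Fintype I] [LinearOrder I] [Nonempty I] (n : ℤ),
    ∀ x ∈ L.deg I n, L.d I (L.d I x) = 0
  unit_mem : L.unit ∈ L.deg Unit 0
  d_unit : L.d Unit L.unit = 0
  relabel_mem : ∀ {I J : Type} [Fintype I] [LinearOrder I] [Nonempty I] [Fintype J]
    [LinearOrder J] [Nonempty J] (e : I ≃ J) (n : ℤ),
    ∀ x ∈ L.deg I n, L.relabel e x ∈ L.deg J n
  d_relabel : ∀ {I J : Type} [Fintype I] [LinearOrder I] [Nonempty I] [Fintype J]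
    [LinearOrder J] [Nonempty J] (e : I ≃ J) (n : ℤ),
    ∀ x ∈ L.deg I n, L.d J (L.relabel e x) = L.relabel e (L.d I x)
  relabel_refl : ∀ {I : Type} [Fintype I] [LinearOrder I] [Nonempty I] (n : ℤ),
    ∀ x ∈ L.deg I n, L.relabel (Equiv.refl I) x = x
  relabel_trans : ∀ {I J H : Type} [Fintype I] [LinearOrder I] [Nonempty I] [Fintype J]
    [LinearOrder J] [Nonempty J] [Fintype H] [LinearOrder H] [Nonempty H]
    (e : I ≃ J) (e' : J ≃ H) (n : ℤ),
    ∀ x ∈ L.deg I n, L.relabel (e.trans e') x = L.relabel e' (L.relabel e x)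
  comp_mem : ∀ {I : Type} {K : I → Type} [Fintype I] [LinearOrder I] [Nonempty I]
    [∀ i, Fintype (K i)] [∀ i, LinearOrder (K i)] [∀ i, Nonempty (K i)] (p : ℤ) (q : I → ℤ)
    (f : L.obj I) (g : ∀ i, L.obj (K i)), f ∈ L.deg I p → (∀ i, g i ∈ L.deg (K i) (q i)) →
    L.comp p q f g ∈ L.deg (Σ i, K i) (p + ∑ i, q i)
  d_comp : ∀ {I : Type} {K : I → Type} [Fintype I] [LinearOrder I] [Nonempty I]
    [∀ i, Fintype (K i)] [∀ i, LinearOrder (K i)] [∀ i, Nonempty (K i)] (p : ℤ) (q : I → ℤ)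
    (f : L.obj I) (g : ∀ i, L.obj (K i)), f ∈ L.deg I p → (∀ i, g i ∈ L.deg (K i) (q i)) →
    L.d (Σ i, K i) (L.comp p q f g) =
      L.comp (p + 1) q (L.d I f) g +
        ∑ i, ksign k (p + ∑ i' with i' < i, q i') •
          L.comp p (Function.update q i (q i + 1)) f (Function.update g i (L.d (K i) (g i)))
  relabel_comp : ∀ {I I' : Type} {K : I' → Type} [Fintype I] [LinearOrder I] [Nonempty I]
    [Fintype I'] [LinearOrder I'] [Nonempty I'] [∀ i, Fintype (K i)] [∀ i, LinearOrder (K i)]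
    [∀ i, Nonempty (K i)] (e : I ≃ I') (p : ℤ) (q : I' → ℤ)
    (f : L.obj I) (g : ∀ i, L.obj (K i)), f ∈ L.deg I p → (∀ i, g i ∈ L.deg (K i) (q i)) →
    L.comp p q (L.relabel e f) g =
      koszulSign k e (fun i => q (e i)) •
        L.relabel (Equiv.sigmaCongrLeft (β := K) e)
          (L.comp (K := fun i => K (e i)) p (fun i => q (e i)) f (fun i => g (e i)))
  comp_relabel : ∀ {I : Type} {K K' : I → Type} [Fintype I] [LinearOrder I] [Nonempty I]
    [∀ i, Fintype (K i)] [∀ i, LinearOrder (K i)] [∀ i, Nonempty (K i)]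
    [∀ i, Fintype (K' i)] [∀ i, LinearOrder (K' i)] [∀ i, Nonempty (K' i)]
    (e : ∀ i, K i ≃ K' i) (p : ℤ) (q : I → ℤ)
    (f : L.obj I) (g : ∀ i, L.obj (K i)), f ∈ L.deg I p → (∀ i, g i ∈ L.deg (K i) (q i)) →
    L.comp p q f (fun i => L.relabel (e i) (g i)) =
      L.relabel (Equiv.sigmaCongrRight e) (L.comp p q f g)
  comp_assoc : ∀ {I : Type} {K : I → Type} {H : (i : I) → K i → Type} [Fintype I]
    [LinearOrder I] [Nonempty I] [∀ i, Fintype (K i)] [∀ i, LinearOrder (K i)]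
    [∀ i, Nonempty (K i)] [∀ i j, Fintype (H i j)] [∀ i j, LinearOrder (H i j)]
    [∀ i j, Nonempty (H i j)] (p : ℤ) (q : I → ℤ) (r : ∀ i, K i → ℤ)
    (f : L.obj I) (g : ∀ i, L.obj (K i)) (h : ∀ i j, L.obj (H i j)), f ∈ L.deg I p →
    (∀ i, g i ∈ L.deg (K i) (q i)) → (∀ i j, h i j ∈ L.deg (H i j) (r i j)) →
    L.relabel (Equiv.sigmaAssoc H)
      (L.comp (K := fun s : Σ i, K i => H s.1 s.2) (p + ∑ i, q i) (fun s => r s.1 s.2)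
        (L.comp p q f g) (fun s => h s.1 s.2)) =
      ksign k (∑ i, ∑ i' with i' < i, q i * ∑ j, r i' j) •
        L.comp p (fun i => q i + ∑ j, r i j) f (fun i => L.comp (q i) (r i) (g i) (h i))
  unit_comp : ∀ {J : Type} [Fintype J] [LinearOrder J] [Nonempty J] (n : ℤ),
    ∀ f ∈ L.deg J n, L.relabel (Equiv.uniqueSigma (fun _ : Unit => J))
      (L.comp (K := fun _ : Unit => J) 0 (fun _ => n) L.unit (fun _ => f)) = f
  comp_unit : ∀ {I : Type} [Fintype I] [LinearOrder I] [Nonempty I] (n : ℤ),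
    ∀ f ∈ L.deg I n, L.relabel (Equiv.sigmaPUnit I)
      (L.comp (K := fun _ : I => Unit) n (fun _ => 0) f (fun _ => L.unit)) = f

/-- A family of linear maps `F I : L(I) → M(I)`. -/
abbrev Family (L : DGOperadData.{u, v} k) (M : DGOperadData.{u, w} k) :=
  ∀ (I : Type) [Fintype I] [LinearOrder I] [Nonempty I], L.obj I →ₗ[k] M.obj I

/-- Maps of operads in complexes: the maps `L(I) → M(I)` are maps of complexes and respect the
units, the transport along bijections and the compositions. -/
structure IsOperadMap {L : DGOperadData.{u, v} k} {M : DGOperadData.{u, w} k}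
    (F : Family L M) : Prop where
  map_mem : ∀ {I : Type} [Fintype I] [LinearOrder I] [Nonempty I] (n : ℤ),
    ∀ x ∈ L.deg I n, F I x ∈ M.deg I n
  map_d : ∀ {I : Type} [Fintype I] [LinearOrder I] [Nonempty I] (n : ℤ),
    ∀ x ∈ L.deg I n, F I (L.d I x) = M.d I (F I x)
  map_unit : F Unit L.unit = M.unit
  map_relabel : ∀ {I J : Type} [Fintype I] [LinearOrder I] [Nonempty I] [Fintype J]
    [LinearOrder J] [Nonempty J] (e : I ≃ J) (n : ℤ),
    ∀ x ∈ L.deg I n, F J (L.relabel e x) = M.relabel e (F I x)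
  map_comp : ∀ {I : Type} {K : I → Type} [Fintype I] [LinearOrder I] [Nonempty I]
    [∀ i, Fintype (K i)] [∀ i, LinearOrder (K i)] [∀ i, Nonempty (K i)] (p : ℤ) (q : I → ℤ)
    (f : L.obj I) (g : ∀ i, L.obj (K i)), f ∈ L.deg I p → (∀ i, g i ∈ L.deg (K i) (q i)) →
    F (Σ i, K i) (L.comp p q f g) = M.comp p q (F I f) (fun i => F (K i) (g i))

/-- `F I : L(I) → M(I)` induces a bijection `H^n(L(I)) → H^n(M(I))` for every `n`. -/
structure IsQuasiIso {L : DGOperadData.{u, v} k} {M : DGOperadData.{u, w} k}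
    (F : Family L M) (I : Type) [Fintype I] [LinearOrder I] [Nonempty I] : Prop where
  injective : ∀ (n : ℤ), ∀ x ∈ L.deg I n, L.d I x = 0 →
    (∃ y ∈ M.deg I (n - 1), M.d I y = F I x) → ∃ y ∈ L.deg I (n - 1), L.d I y = x
  surjective : ∀ (n : ℤ), ∀ z ∈ M.deg I n, M.d I z = 0 →
    ∃ x ∈ L.deg I n, L.d I x = 0 ∧ ∃ y ∈ M.deg I (n - 1), F I x - z = M.d I y

/-- The truncation `τ_{≤ 0} L`: the components of negative degree, and the cocycles of degree
`0`. -/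
def truncLEZero (L : DGOperadData.{u, v} k) : DGOperadData.{u, v} k where
  obj I := L.obj I
  deg I _ _ _ n := if n < 0 then L.deg I n else if n = 0 then L.deg I 0 ⊓ LinearMap.ker (L.d I) else ⊥
  d I := L.d I
  unit := L.unit
  relabel e := L.relabel e
  comp p q := L.comp p q

end DGOperadData

/-- The Lie operad, viewed as an operad in complexes concentrated in degree `0`. -/
noncomputable def lieOperad (k : Type u) [Field k] : DGOperadData.{u, u} k where
  obj I := LieOp k I
  deg _ _ _ _ n := if n = 0 then ⊤ else ⊥
  d _ := 0
  unit := lieUnit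
  relabel e := lieRelabel e
  comp _ _ := lieComp

/-- A homotopy Lie operad: an operad in complexes with a map of operads to the Lie operad all of
whose components are quasi-isomorphisms. -/
structure IsHomotopyLieOperad {k : Type u} [Field k] (L : DGOperadData.{u, v} k)
    (ε : DGOperadData.Family L (lieOperad k)) : Prop where
  isDGOperad : L.IsDGOperad
  isOperadMap : DGOperadData.IsOperadMap ε
  isQuasiIso : ∀ (I : Type) [Fintype I] [LinearOrder I] [Nonempty I],
    DGOperadData.IsQuasiIso ε I

/-! ## The Eilenberg-Zilber operad -/

section EilenbergZilber

variable (k : Type u) [Field k]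

/-- The simplices of all dimensions of the standard simplex `Δ^n`: morphisms `[m] → [n]`. -/
abbrev Simplices (n : SimplexCategory) : Type := Σ m : ℕ, (SimplexCategory.mk m ⟶ n)

/-- `Z([n])`: the (unnormalized) chains on the standard simplex `Δ^n`, the free `k`-module on the
simplices of `Δ^n`.  An `m`-simplex has cohomological degree `-m`. -/
abbrev ZChain (n : SimplexCategory) : Type u := Simplices n →₀ k

/-- The cosimplicial structure of `Z`. -/
noncomputable def zMap {n n' : SimplexCategory} (f : n ⟶ n') : ZChain k n →ₗ[k] ZChain k n' :=
  Finsupp.lmapDomain k k fun s => ⟨s.1, s.2 ≫ f⟩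

/-- The component of `Z([n])` of cohomological degree `p`. -/
noncomputable def zDeg (n : SimplexCategory) (p : ℤ) : Submodule k (ZChain k n) :=
  Finsupp.supported k k {s | -(s.1 : ℤ) = p}

/-- The boundary of a simplex: the alternating sum of its faces. -/
noncomputable def simplexBoundary {n : SimplexCategory} : Simplices n → ZChain k n
  | ⟨0, _⟩ => 0
  | ⟨m + 1, s⟩ => ∑ i : Fin (m + 2),
      Finsupp.single (⟨m, SimplexCategory.δ i ≫ s⟩ : Simplices n) ((-1 : k) ^ (i : ℕ))

/-- The differential of `Z([n])`. -/
noncomputable def zD (n : SimplexCategory) : ZChain k n →ₗ[k] ZChain k n :=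
  Finsupp.linearCombination k (simplexBoundary k)

/-- Multiplication by `(-1)^(r * p)` on the component of degree `p`. -/
noncomputable def zSign (n : SimplexCategory) (r : ℤ) : ZChain k n →ₗ[k] ZChain k n :=
  Finsupp.linearCombination k fun s => Finsupp.single s (ksign k (r * (s.1 : ℤ)))

/-- The augmentation `Z([n]) → k`. -/
noncomputable def zAug (n : SimplexCategory) : ZChain k n →ₗ[k] k :=
  Finsupp.linearCombination k fun s => if s.1 = 0 then (1 : k) else 0

/-- The tensor power `Z([n])^{⊗ I}`. -/
abbrev ZTensor (I : Type) (n : SimplexCategory) : Type u := ⨂[k] _ : I, ZChain k n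

noncomputable instance zTensorAddCommGroup (I : Type) (n : SimplexCategory) :
    AddCommGroup (ZTensor k I n) :=
  PiTensorProduct.instAddCommGroup

/-- The cosimplicial structure of `Z^{⊗ I}`. -/
noncomputable def ztMap (I : Type) {n n' : SimplexCategory} (f : n ⟶ n') :
    ZTensor k I n →ₗ[k] ZTensor k I n' :=
  PiTensorProduct.map fun _ => zMap k f

/-- The component of `Z([n])^{⊗ I}` of degree `p`. -/
noncomputable def ztDeg (I : Type) [Fintype I] (n : SimplexCategory) (p : ℤ) :
    Submodule k (ZTensor k I n) :=
  Submodule.span k {t | ∃ (a : I → ℤ) (z : I → ZChain k n),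
    (∀ i, z i ∈ zDeg k n (a i)) ∧ ∑ i, a i = p ∧ t = PiTensorProduct.tprod k z}

/-- The differential of the tensor power `Z([n])^{⊗ I}`: the sum over `i` of the differential in
the factor `i`, with the sign `(-1)^p` for every factor of degree `p` before it. -/
noncomputable def ztD (I : Type) [Fintype I] [LinearOrder I] (n : SimplexCategory) :
    ZTensor k I n →ₗ[k] ZTensor k I n :=
  ∑ i : I, PiTensorProduct.map fun j =>
    if j < i then zSign k n 1 else if j = i then zD k n else LinearMap.id

/-- Multiplication by `(-1)^p` on the component of `Z([n])^{⊗ I}` of degree `p`. -/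
noncomputable def ztSign (I : Type) (n : SimplexCategory) : ZTensor k I n →ₗ[k] ZTensor k I n :=
  PiTensorProduct.map fun _ => zSign k n 1

/-- The basis of `Z([n])^{⊗ I}` given by families of simplices of `Δ^n`. -/
noncomputable def ztBasis (I : Type) [Finite I] (n : SimplexCategory) :
    Module.Basis (I → Simplices n) k (ZTensor k I n) :=
  Basis.piTensorProduct fun _ => Finsupp.basisSingleOne

/-- The permutation of tensor factors `Z([n])^{⊗ I} → Z([n])^{⊗ J}` with its Koszul sign. -/
noncomputable def ztPerm {I J : Type} [Fintype I] [LinearOrder I] [Fintype J] [LinearOrder J]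
    (e : I ≃ J) (n : SimplexCategory) : ZTensor k I n →ₗ[k] ZTensor k J n :=
  (ztBasis k I n).constr k fun s =>
    koszulSign k e (fun i => -((s i).1 : ℤ)) • ztBasis k J n (fun j => s (e.symm j))

/-- The identification of iterated tensor powers
`⨂_i Z([n])^{⊗ K i} → Z([n])^{⊗ (Σ i, K i)}`. -/
noncomputable def ztFlatten {I : Type} {K : I → Type} [Finite I] [∀ i, Finite (K i)]
    (n : SimplexCategory) :
    (⨂[k] i, ZTensor k (K i) n) →ₗ[k] ZTensor k (Σ i, K i) n :=
  (Basis.piTensorProduct fun i => ztBasis k (K i) n).constr k fun s =>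
    ztBasis k (Σ i, K i) n (fun p => s p.1 p.2)

theorem ztFlatten_tprod {I : Type} {K : I → Type} [Finite I] [∀ i, Finite (K i)]
    (n : SimplexCategory) (z : ∀ i, K i → ZChain k n) :
    ztFlatten k n (PiTensorProduct.tprod k fun i => PiTensorProduct.tprod k (z i)) =
      PiTensorProduct.tprod k fun p : Σ i, K i => z p.1 p.2 := by
  classical
  have := Fintype.ofFinite I
  have := fun i => Fintype.ofFinite (K i)
  have key : ∀ (x : ⨂[k] i, ZTensor k (K i) n) (s : (Σ i, K i) → Simplices n),
      (ztBasis k (Σ i, K i) n).repr (ztFlatten k n x) s =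
        (Basis.piTensorProduct fun i => ztBasis k (K i) n).repr x (fun i j => s ⟨i, j⟩) := by
    intro x s
    have h : (Finsupp.lapply s ∘ₗ (ztBasis k (Σ i, K i) n).repr.toLinearMap) ∘ₗ ztFlatten k n =
        Finsupp.lapply (fun i j => s ⟨i, j⟩) ∘ₗ
          (Basis.piTensorProduct fun i => ztBasis k (K i) n).repr.toLinearMap := by
      refine (Basis.piTensorProduct fun i => ztBasis k (K i) n).ext fun t => ?_
      simp only [LinearMap.comp_apply, ztFlatten, Module.Basis.constr_basis,
        LinearEquiv.coe_coe, Module.Basis.repr_self, Finsupp.lapply_apply]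
      rw [Finsupp.single_apply, Finsupp.single_apply]
      congr 1
      refine propext ⟨fun h => ?_, fun h => ?_⟩
      · rw [← h]
      · rw [h]
    exact LinearMap.congr_fun h x
  refine (ztBasis k (Σ i, K i) n).ext_elem fun s => ?_
  rw [key]
  simp only [Basis.piTensorProduct_repr_tprod_apply, ztBasis]
  rw [Fintype.prod_sigma]

/-- Families of linear maps `Z([n]) → Z([n])^{⊗ I}`, `n ≥ 0`. -/
abbrev EZObj (I : Type) : Type u := ∀ n : SimplexCategory, ZChain k n →ₗ[k] ZTensor k I n

/-- The component of degree `r` of the complex `Tot Hom_Δ(Z, Z^{⊗ I})`: the maps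
of cosimplicial modules `Z → Z^{⊗ I}` which are homogeneous of degree `r`. -/
noncomputable def ezDeg (I : Type) [Fintype I] (r : ℤ) : Submodule k (EZObj k I) where
  carrier := {φ | (∀ {n n' : SimplexCategory} (f : n ⟶ n') (z : ZChain k n),
      φ n' (zMap k f z) = ztMap k I f (φ n z)) ∧
    ∀ (n : SimplexCategory) (p : ℤ), ∀ z ∈ zDeg k n p, φ n z ∈ ztDeg k I n (p + r)}
  add_mem' := fun {φ ψ} hφ hψ =>
    ⟨fun f z => by simp [hφ.1 f z, hψ.1 f z],
      fun n p z hz => add_mem (hφ.2 n p z hz) (hψ.2 n p z hz)⟩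
  zero_mem' := ⟨fun f z => by simp, fun n p z hz => zero_mem _⟩
  smul_mem' := fun c φ hφ =>
    ⟨fun f z => by simp [hφ.1 f z], fun n p z hz => Submodule.smul_mem _ c (hφ.2 n p z hz)⟩

/-- The differential `φ ↦ d ∘ φ - (-1)^|φ| φ ∘ d` of `Tot Hom_Δ(Z, Z^{⊗ I})`. -/
noncomputable def ezD (I : Type) [Fintype I] [LinearOrder I] : EZObj k I →ₗ[k] EZObj k I where
  toFun φ n := ztD k I n ∘ₗ φ n - ztSign k I n ∘ₗ φ n ∘ₗ zSign k n 1 ∘ₗ zD k n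
  map_add' φ ψ := by
    funext n
    simp only [Pi.add_apply, LinearMap.comp_add, LinearMap.add_comp]
    abel
  map_smul' c φ := by
    funext n
    simp only [Pi.smul_apply, LinearMap.comp_smul, LinearMap.smul_comp, smul_sub, RingHom.id_apply]

/-- Permutation of the factors of `Z^{⊗ I}`. -/
noncomputable def ezRelabel {I J : Type} [Fintype I] [LinearOrder I] [Fintype J] [LinearOrder J]
    (e : I ≃ J) : EZObj k I →ₗ[k] EZObj k J where
  toFun φ n := ztPerm k e n ∘ₗ φ n
  map_add' φ ψ := by
    funext n
    simp only [Pi.add_apply, LinearMap.comp_add]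
  map_smul' c φ := by
    funext n
    simp only [Pi.smul_apply, LinearMap.comp_smul, RingHom.id_apply]

/-- The identity `Z → Z`. -/
noncomputable def ezUnit : EZObj k Unit := fun n =>
  (PiTensorProduct.subsingletonEquiv (R := k) (s := fun _ : Unit => ZChain k n) ()).symm.toLinearMap

theorem ezComp_aux {I : Type} {K : I → Type} [DecidableEq I] (n : SimplexCategory)
    (g : ∀ i, EZObj k (K i)) (i : I) (c : EZObj k (K i)) (u : I → ZChain k n →ₗ[k] ZChain k n) :
    (fun i' => Function.update g i c i' n ∘ₗ u i') =
      Function.update (fun i' => g i' n ∘ₗ u i') i (c n ∘ₗ u i) := by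
  funext i'
  by_cases h : i' = i
  · subst h; simp
  · simp [h]

/-- The composition of the Eilenberg-Zilber operad: for `φ : Z → Z^{⊗ I}` of degree `p` and
`g i : Z → Z^{⊗ K i}` of degree `q i` the composition is
`(-1)^(p * ∑ i, q i) (⨂ i, g i) ∘ φ`, where
`(⨂ i, g i) (⨂ i, z i) = (-1)^(∑ i' < i, q i * |z i'|) ⨂ i, g i (z i)`. -/
noncomputable def ezComp {I : Type} {K : I → Type} [Fintype I] [LinearOrder I]
    [∀ i, Fintype (K i)] (p : ℤ) (q : I → ℤ) :
    EZObj k I →ₗ[k] MultilinearMap k (fun i => EZObj k (K i)) (EZObj k (Σ i, K i)) where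
  toFun φ :=
    { toFun := fun g n => ksign k (p * ∑ i, q i) •
        (ztFlatten k n ∘ₗ
          (PiTensorProduct.map fun i => g i n ∘ₗ zSign k n (∑ i' with i < i', q i')) ∘ₗ φ n)
      map_update_add' := fun g i a b => by
        funext n
        have key := fun c : EZObj k (K i) => ezComp_aux k n g i c
          (fun i => zSign k n (∑ i' with i < i', q i'))
        simp only [Pi.add_apply, key, LinearMap.add_comp]
        rw [PiTensorProduct.map_update_add, LinearMap.add_comp, LinearMap.comp_add, smul_add]
      map_update_smul' := fun g i c a => by
        funext n
        have key := fun c : EZObj k (K i) => ezComp_aux k n g i c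
          (fun i => zSign k n (∑ i' with i < i', q i'))
        simp only [Pi.smul_apply, key, LinearMap.smul_comp]
        rw [PiTensorProduct.map_update_smul, LinearMap.smul_comp, LinearMap.comp_smul, smul_comm] }
  map_add' φ ψ := by
    ext1 g
    funext n
    simp only [MultilinearMap.coe_mk, add_apply, Pi.add_apply, LinearMap.comp_add,
      smul_add]
  map_smul' c φ := by
    ext1 g
    funext n
    simp only [MultilinearMap.coe_mk, smul_apply, Pi.smul_apply,
      LinearMap.comp_smul, RingHom.id_apply]
    rw [smul_comm]

/-- The Eilenberg-Zilber operad `𝒵(I) = Tot Hom_Δ(Z, Z^{⊗ I})`. -/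
noncomputable def eilenbergZilber : DGOperadData.{u, u} k where
  obj I := EZObj k I
  deg I := ezDeg k I
  d I := ezD k I
  unit := ezUnit k
  relabel e := ezRelabel k e
  comp p q := ezComp k p q

/-- The augmentation `𝒵(I) → k` induced by the augmentations `Z → k` and `Z^{⊗ I} → k`. -/
noncomputable def ezAug (I : Type) [Fintype I] : EZObj k I →ₗ[k] k :=
  (PiTensorProduct.lift ((MultilinearMap.mkPiAlgebra k I k).compLinearMap
    fun _ => zAug k (SimplexCategory.mk 0))) ∘ₗ
    (LinearMap.applyₗ (Finsupp.single (⟨0, 𝟙 _⟩ : Simplices (SimplexCategory.mk 0)) (1 : k))) ∘ₗ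
    (LinearMap.proj (SimplexCategory.mk 0) : EZObj k I →ₗ[k] _)

end EilenbergZilber

/-! ## The Lie Eilenberg-Zilber operad -/

section Hadamard

variable {k : Type u} [Field k] {I : Type} [Finite I] {A B : I → Type u}
  [∀ i, AddCommGroup (A i)] [∀ i, Module k (A i)] [∀ i, AddCommGroup (B i)] [∀ i, Module k (B i)]

/-- The canonical map `⨂_i (A i ⊗ B i) → (⨂_i A i) ⊗ (⨂_i B i)`, which rearranges the factors
(see `tensorRearrange_tprod`; it is written down here in terms of bases). -/
noncomputable def tensorRearrange (k : Type u) [Field k] (A B : I → Type u)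
    [∀ i, AddCommGroup (A i)] [∀ i, Module k (A i)] [∀ i, AddCommGroup (B i)]
    [∀ i, Module k (B i)] :
    (⨂[k] i, (A i ⊗[k] B i)) →ₗ[k] (⨂[k] i, A i) ⊗[k] (⨂[k] i, B i) :=
  (Basis.piTensorProduct fun i => (Module.Basis.ofVectorSpace k (A i)).tensorProduct
    (Module.Basis.ofVectorSpace k (B i))).constr k fun s =>
      (PiTensorProduct.tprod k fun i => Module.Basis.ofVectorSpace k (A i) (s i).1) ⊗ₜ[k]
        (PiTensorProduct.tprod k fun i => Module.Basis.ofVectorSpace k (B i) (s i).2)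

theorem tensorRearrange_tprod (a : ∀ i, A i) (b : ∀ i, B i) :
    tensorRearrange k A B (PiTensorProduct.tprod k fun i => a i ⊗ₜ[k] b i) =
      (PiTensorProduct.tprod k a) ⊗ₜ[k] (PiTensorProduct.tprod k b) := by
  have h : (PiTensorProduct.map₂ fun i => TensorProduct.mk k (A i) (B i)).compr₂
      (tensorRearrange k A B) = TensorProduct.mk k (⨂[k] i, A i) (⨂[k] i, B i) := by
    refine (Basis.piTensorProduct fun i => Module.Basis.ofVectorSpace k (A i)).ext fun s => ?_
    refine (Basis.piTensorProduct fun i => Module.Basis.ofVectorSpace k (B i)).ext fun t => ?_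
    rw [LinearMap.compr₂_apply, Basis.piTensorProduct_apply, Basis.piTensorProduct_apply,
      PiTensorProduct.map₂_tprod_tprod]
    have := (Basis.piTensorProduct fun i => (Module.Basis.ofVectorSpace k (A i)).tensorProduct
      (Module.Basis.ofVectorSpace k (B i))).constr_basis k (fun s =>
      (PiTensorProduct.tprod k fun i => Module.Basis.ofVectorSpace k (A i) (s i).1) ⊗ₜ[k]
        (PiTensorProduct.tprod k fun i => Module.Basis.ofVectorSpace k (B i) (s i).2))
      (fun i => (s i, t i))
    rw [Basis.piTensorProduct_apply] at this
    simp only [Module.Basis.tensorProduct_apply] at this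
    exact this
  have h2 := LinearMap.congr_fun₂ h (PiTensorProduct.tprod k a) (PiTensorProduct.tprod k b)
  rwa [LinearMap.compr₂_apply, PiTensorProduct.map₂_tprod_tprod] at h2

/-- The tensor product of two multilinear maps `f` and `g`: it sends the family `a i ⊗ b i` to
`f a ⊗ g b`. -/
noncomputable def multilinearTensor {M N : Type u} [AddCommGroup M] [Module k M] [AddCommGroup N]
    [Module k N] (f : MultilinearMap k A M) (g : MultilinearMap k B N) :
    MultilinearMap k (fun i => A i ⊗[k] B i) (M ⊗[k] N) :=
  (TensorProduct.map (PiTensorProduct.lift f) (PiTensorProduct.lift g) ∘ₗ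
    tensorRearrange k A B).compMultilinearMap (PiTensorProduct.tprod k)

theorem multilinearTensor_tmul {M N : Type u} [AddCommGroup M] [Module k M] [AddCommGroup N]
    [Module k N] (f : MultilinearMap k A M) (g : MultilinearMap k B N)
    (a : ∀ i, A i) (b : ∀ i, B i) :
    multilinearTensor f g (fun i => a i ⊗ₜ[k] b i) = f a ⊗ₜ[k] g b := by
  simp [multilinearTensor, tensorRearrange_tprod]

end Hadamard

section LieEilenbergZilber

variable (k : Type u) [Field k]

/-- The composition of `𝒴 = 𝒵 ⊗ Lie`: for `φ ⊗ ψ` and `φ i ⊗ ψ i` it is the tensor product of the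
composition in `𝒵` of `φ` and the `φ i` and the composition in `Lie` of `ψ` and the `ψ i`. -/
noncomputable def lieEZComp {I : Type} {K : I → Type} [Fintype I] [LinearOrder I]
    [∀ i, Fintype (K i)] (p : ℤ) (q : I → ℤ) :
    EZObj k I ⊗[k] LieOp k I →ₗ[k] MultilinearMap k (fun i => EZObj k (K i) ⊗[k] LieOp k (K i))
      (EZObj k (Σ i, K i) ⊗[k] LieOp k (Σ i, K i)) :=
  TensorProduct.lift (LinearMap.mk₂ k
    (fun φ ψ => multilinearTensor (ezComp k (K := K) p q φ) (lieComp (K := K) ψ))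
    (fun φ φ' ψ => by
      ext1 t
      simp [multilinearTensor, TensorProduct.map_add_left])
    (fun c φ ψ => by
      ext1 t
      simp [multilinearTensor, TensorProduct.map_smul_left])
    (fun φ ψ ψ' => by
      ext1 t
      simp [multilinearTensor, TensorProduct.map_add_right])
    (fun c φ ψ => by
      ext1 t
      simp [multilinearTensor, TensorProduct.map_smul_right]))

/-- The Lie Eilenberg-Zilber operad `𝒴(I) = 𝒵(I) ⊗ Lie(I)`. -/
noncomputable def lieEilenbergZilber : DGOperadData.{u, u} k where
  obj I := EZObj k I ⊗[k] LieOp k I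
  deg I _ _ _ n :=
    LinearMap.range (TensorProduct.map (ezDeg k I n).subtype (LinearMap.id (M := LieOp k I)))
  d I := (ezD k I).rTensor (LieOp k I)
  unit := ezUnit k ⊗ₜ[k] lieUnit
  relabel e := TensorProduct.map (ezRelabel k e) (lieRelabel e)
  comp p q := lieEZComp k p q

/-- The truncated Lie Eilenberg-Zilber operad `τ_{≤ 0} 𝒴`. -/
noncomputable def truncLieEZ : DGOperadData.{u, u} k :=
  (lieEilenbergZilber k).truncLEZero

/-- The augmentation `τ_{≤ 0} 𝒴 → Lie`, `φ ⊗ ψ ↦ ε(φ) ψ`. -/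
noncomputable def truncLieEZAug : DGOperadData.Family (truncLieEZ k) (lieOperad k) :=
  fun I _ _ _ => (TensorProduct.lid k (LieOp k I)).toLinearMap ∘ₗ
    (ezAug k I).rTensor (LieOp k I)

end LieEilenbergZilber

/-! ## Complexes in a pseudo-tensor category -/

namespace PseudoTensorCategory

variable {k : Type u} [Field k] (C : PseudoTensorCategory.{u, v, w} k)

theorem postcomp_smul {I : Type} [Finite I] [Nonempty I] {y : I → C.Obj} {x x' : C.Obj}
    (g : C.P Unit (fun _ => x) x') (c : k) (f : C.P I y x) :
    C.postcomp g (c • f) = c • C.postcomp g f := by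
  have := (C.comp (K := fun _ : Unit => I) (z := fun p => y p.2) (y := fun _ => x)
    g).map_update_smul (fun _ => f) () c f
  have hu : ∀ c : C.P I y x, Function.update (fun _ : Unit => f) () c = fun _ => c :=
    fun c => funext fun _ => rfl
  simp only [hu] at this
  simp only [postcomp, this]
  exact map_smul _ _ _

theorem precomp_add {I : Type} [Finite I] [Nonempty I] {y y' : I → C.Obj} {x : C.Obj}
    (f f' : C.P I y x) (h : ∀ i, C.P Unit (fun _ => y' i) (y i)) :
    C.precomp (f + f') h = C.precomp f h + C.precomp f' h := by
  simp only [precomp, map_add, add_apply]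
  exact map_add _ _ _

theorem precomp_smul {I : Type} [Finite I] [Nonempty I] {y y' : I → C.Obj} {x : C.Obj}
    (c : k) (f : C.P I y x) (h : ∀ i, C.P Unit (fun _ => y' i) (y i)) :
    C.precomp (c • f) h = c • C.precomp f h := by
  simp only [precomp, map_smul, smul_apply]
  exact map_smul _ _ _

/-! Complexes in `C` are taken to be concentrated in degrees `≥ 0`: `C` need not have a zero object,
and in negative degrees nothing contributes to the operations of the complexes considered here. -/

variable {C} (X : CochainComplex C.Obj ℕ)

/-- The differential of a complex, as a unary operation. -/
def dOp (m n : ℕ) : C.P Unit (fun _ => X.X m) (X.X n) := X.d m n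

/-- The component `X^m → X^n` of the identity of `X`. -/
noncomputable def idOp (m n : ℕ) : C.P Unit (fun _ => X.X m) (X.X n) :=
  if h : m = n then eqToHom (congrArg X.X h) else (0 : X.X m ⟶ X.X n)

/-- Operations `{X}_I → X` for a complex `X` in `C`: families of operations
`{X^(a i)}_{i ∈ I} → X^b`, for all `a : I → ℕ` and `b : ℕ`. -/
abbrev ComplexOps (I : Type) [Finite I] [Nonempty I] : Type v :=
  ∀ (a : I → ℕ) (b : ℕ), C.P I (fun i => X.X (a i)) (X.X b)

/-- Operations of degree `r`: only the components with `b = ∑ i, a i + r` are nonzero. -/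
def complexOpsDeg (I : Type) [Fintype I] [Nonempty I] (r : ℤ) :
    Submodule k (ComplexOps X I) where
  carrier := {f | ∀ (a : I → ℕ) (b : ℕ), (b : ℤ) ≠ ∑ i, (a i : ℤ) + r → f a b = 0}
  add_mem' := fun hf hg a b h => by simp [hf a b h, hg a b h]
  zero_mem' := fun a b h => rfl
  smul_mem' := fun c f hf a b h => by simp [hf a b h]

/-- The composition of an operation with the differential of its output. -/
def complexOpsDOut {I : Type} [Finite I] [Nonempty I] (f : ComplexOps X I) : ComplexOps X I
  | _, 0 => 0
  | a, b + 1 => C.postcomp (dOp X b (b + 1)) (f a b)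

/-- The composition of an operation with the differential of its input number `i`. -/
noncomputable def complexOpsDIn {I : Type} [Finite I] [LinearOrder I] [Nonempty I]
    (f : ComplexOps X I) (i : I) : ComplexOps X I :=
  fun a b => C.precomp (f (Function.update a i (a i + 1)) b) fun j =>
    if j = i then dOp X (a j) (Function.update a i (a i + 1) j)
    else idOp X (a j) (Function.update a i (a i + 1) j)

/-- The differential of the simple complex associated to the multiple complex of operations:
`f ↦ d ∘ f - (-1)^|f| ∑ i, (-1)^(∑ i' < i, a i') f ∘_i d`, where `a i'` is the degree of the
input number `i'`.  Here `|f| = b - ∑ i, a i - 1` for the component with inputs of degrees `a i`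
and output of degree `b`. -/
noncomputable def complexOpsD (I : Type) [Fintype I] [LinearOrder I] [Nonempty I] :
    ComplexOps X I →ₗ[k] ComplexOps X I where
  toFun f := fun a b => complexOpsDOut X f a b -
    ksign k ((b : ℤ) - ∑ i, (a i : ℤ) - 1) •
      ∑ i, ksign k (∑ i' with i' < i, (a i' : ℤ)) • complexOpsDIn X f i a b
  map_add' f g := by
    funext a b
    cases b <;>
    simp only [complexOpsDOut, complexOpsDIn, Pi.add_apply, postcomp_add, precomp_add, smul_add,
      Finset.sum_add_distrib] <;> abel
  map_smul' c f := by
    funext a b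
    have h : complexOpsDOut X (c • f) a b = c • complexOpsDOut X f a b := by
      cases b <;> simp [complexOpsDOut, postcomp_smul]
    simp only [h, complexOpsDIn, Pi.smul_apply, precomp_smul, RingHom.id_apply, smul_sub,
      Finset.smul_sum, smul_comm c]

/-- Transport along a bijection of index sets, with the Koszul sign. -/
noncomputable def complexOpsRelabel {I J : Type} [Fintype I] [LinearOrder I] [Nonempty I]
    [Fintype J] [LinearOrder J] [Nonempty J] (e : I ≃ J) :
    ComplexOps X I →ₗ[k] ComplexOps X J where
  toFun f := fun a b => koszulSign k e (fun i => (a (e i) : ℤ)) •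
    C.relabel e (y := fun j => X.X (a j)) (f (fun i => a (e i)) b)
  map_add' f g := by
    funext a b
    simp
  map_smul' c f := by
    funext a b
    simp [smul_comm c]

/-- Composition of operations: for `g i` of degree `q i`, the component of `f ∘ (⨂ i, g i)` with
inputs of degrees `a (i, j)` is the composition of the component of `f` with inputs of degrees
`c i = ∑ j, a (i, j) + q i` and the components of the `g i` with outputs of degrees `c i`, with the
sign for moving every `g i` past the inputs of the `g i'` with `i' < i`. -/
noncomputable def complexOpsComp {I : Type} {K : I → Type} [Fintype I] [LinearOrder I]
    [Nonempty I] [∀ i, Fintype (K i)] [∀ i, Nonempty (K i)] (q : I → ℤ) :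
    ComplexOps X I →ₗ[k] MultilinearMap k (fun i => ComplexOps X (K i))
      (ComplexOps X (Σ i, K i)) where
  toFun f := MultilinearMap.pi fun a => MultilinearMap.pi fun b =>
    if ∀ i, 0 ≤ ∑ j, (a ⟨i, j⟩ : ℤ) + q i then
      ksign k (∑ i, ∑ i' with i' < i, q i * ∑ j, (a ⟨i', j⟩ : ℤ)) •
        (C.comp (z := fun s => X.X (a s)) (y := fun i => X.X (∑ j, (a ⟨i, j⟩ : ℤ) + q i).toNat)
          (f (fun i => (∑ j, (a ⟨i, j⟩ : ℤ) + q i).toNat) b)).compLinearMap fun i =>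
            LinearMap.proj (∑ j, (a ⟨i, j⟩ : ℤ) + q i).toNat ∘ₗ
              LinearMap.proj (fun j => a ⟨i, j⟩)
    else 0
  map_add' f g := by
    ext h a b
    simp only [MultilinearMap.pi_apply, add_apply, Pi.add_apply]
    split_ifs <;> simp
  map_smul' c f := by
    ext h a b
    simp only [MultilinearMap.pi_apply, smul_apply, Pi.smul_apply, RingHom.id_apply]
    split_ifs <;> simp [smul_comm c]

/-- The operad in complexes of operations `P_I({X}, X)` of a complex `X` in the pseudo-tensor
category of complexes in `C`. -/
noncomputable def complexOperad : DGOperadData.{u, v} k where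
  obj I := ComplexOps X I
  deg I := complexOpsDeg X I
  d I := complexOpsD X I
  unit := fun a b => idOp X (a ()) b
  relabel e := complexOpsRelabel X e
  comp _ q := complexOpsComp X q

end PseudoTensorCategory

/-- An algebra structure over a homotopy Lie operad on a complex `X` in a pseudo-tensor category:
`ε : L → Lie` is a homotopy Lie operad, and the maps `F I : L(I) → P_I({X}, X)` form a
pseudo-tensor functor. -/
structure IsHomotopyLieAlgebra {k : Type u} [Field k] {C : PseudoTensorCategory.{u, v, w} k}
    (L : DGOperadData.{u, w'} k) (ε : DGOperadData.Family L (lieOperad k))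
    (X : CochainComplex C.Obj ℕ)
    (F : DGOperadData.Family L (PseudoTensorCategory.complexOperad X)) : Prop where
  isHomotopyLieOperad : IsHomotopyLieOperad L ε
  isOperadMap : DGOperadData.IsOperadMap F

/-! ## Cosimplicial Lie algebras -/

noncomputable instance simplexHomFintype (m n : SimplexCategory) : Fintype (m ⟶ n) :=
  Fintype.ofFinite _

/-- A Lie algebra structure on an object `x` of a pseudo-tensor category: a pseudo-tensor functor
from the Lie operad which sends its unique object to `x`. -/
structure LieStructure {k : Type u} [Field k] (C : PseudoTensorCategory.{u, v, w} k)
    (x : C.Obj) where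
  act : (I : Type) → [Finite I] → [Nonempty I] → LieOp k I →ₗ[k] C.P I (fun _ => x) x
  act_unit : act Unit lieUnit = C.unit x
  act_relabel : ∀ {I J : Type} [Finite I] [Nonempty I] [Finite J] [Nonempty J] (e : I ≃ J)
    (ψ : LieOp k I), act J (lieRelabel e ψ) = C.relabel e (y := fun _ => x) (act I ψ)
  act_comp : ∀ {I : Type} {K : I → Type} [Finite I] [Nonempty I] [∀ i, Finite (K i)]
    [∀ i, Nonempty (K i)] (ψ : LieOp k I) (χ : ∀ i, LieOp k (K i)),
    act (Σ i, K i) (lieComp ψ χ) =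
      C.comp (z := fun _ => x) (y := fun _ => x) (act I ψ) (fun i => act (K i) (χ i))

/-- A cosimplicial Lie algebra in `C`: a cosimplicial object whose terms are Lie algebras and
whose structure maps are morphisms of Lie algebras. -/
structure CosimplicialLieAlgebra {k : Type u} [Field k] (C : PseudoTensorCategory.{u, v, w} k) where
  toCosimplicial : CosimplicialObject C.Obj
  lie : ∀ n : SimplexCategory, LieStructure C (toCosimplicial.obj n)
  map_act : ∀ {n n' : SimplexCategory} (f : n ⟶ n') (I : Type) [Finite I] [Nonempty I]
    (ψ : LieOp k I), C.postcomp (toCosimplicial.map f) ((lie n).act I ψ) =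
      C.precomp ((lie n').act I ψ) (fun _ => toCosimplicial.map f)

namespace CosimplicialLieAlgebra

variable {k : Type u} [Field k] {C : PseudoTensorCategory.{u, v, w} k}
  (B : CosimplicialLieAlgebra C)

/-- The complex `MB`: `(MB)^n = B^n`, with the alternating sum of the cofaces as differential. -/
noncomputable def complex : CochainComplex C.Obj ℕ :=
  (AlgebraicTopology.alternatingCofaceMapComplex C.Obj).obj B.toCosimplicial

/-- The operation `{B^(a i)}_{i ∈ I} → B^b` obtained by composing `ψ ∈ Lie(I)`, acting on the Lie
algebra `B^b`, with the maps `B(s i) : B^(a i) → B^b`. -/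
noncomputable def pullOp {I : Type} [Finite I] [Nonempty I] (ψ : LieOp k I) {a : I → ℕ} {b : ℕ}
    (s : ∀ i, SimplexCategory.mk (a i) ⟶ SimplexCategory.mk b) :
    C.P I (fun i => B.complex.X (a i)) (B.complex.X b) :=
  C.precomp (y := fun _ => B.toCosimplicial.obj (SimplexCategory.mk b))
    (y' := fun i => B.toCosimplicial.obj (SimplexCategory.mk (a i)))
    ((B.lie (SimplexCategory.mk b)).act I ψ) (fun i => B.toCosimplicial.map (s i))

theorem pullOp_add {I : Type} [Finite I] [Nonempty I] (ψ ψ' : LieOp k I) {a : I → ℕ} {b : ℕ}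
    (s : ∀ i, SimplexCategory.mk (a i) ⟶ SimplexCategory.mk b) :
    B.pullOp (ψ + ψ') s = B.pullOp ψ s + B.pullOp ψ' s := by
  unfold pullOp
  rw [map_add]
  exact C.precomp_add _ _ _

theorem pullOp_smul {I : Type} [Finite I] [Nonempty I] (c : k) (ψ : LieOp k I) {a : I → ℕ} {b : ℕ}
    (s : ∀ i, SimplexCategory.mk (a i) ⟶ SimplexCategory.mk b) :
    B.pullOp (c • ψ) s = c • B.pullOp ψ s := by
  unfold pullOp
  rw [map_smul]
  exact C.precomp_smul _ _ _

/-- For `φ : Z → Z^{⊗ I}` and `ψ ∈ Lie(I)`, the component of the operation on `MB` defined by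
`φ ⊗ ψ` with inputs of degrees `a i` and output of degree `b`.  If `φ(id_[b])` is the sum of the
`α_s ⨂ i, s i` over families `s` of simplices of `Δ^b`, this component is the sum, over the
families with `s i : [a i] → [b]`, of `α_s ψ_b (B(s i))_{i ∈ I}`, where `ψ_b` is the action of `ψ`
on `B^b`.  The sign `(-1)^(r (r + 1) / 2)`, where `r = b - ∑ i, a i` is the degree, makes these
maps commute with the differentials; it is `1` for `r = 0`. -/
noncomputable def actionComponent {I : Type} [Fintype I] [LinearOrder I] [Nonempty I]
    (φ : EZObj k I) (ψ : LieOp k I) (a : I → ℕ) (b : ℕ) :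
    C.P I (fun i => B.complex.X (a i)) (B.complex.X b) :=
  ksign k (((b : ℤ) - ∑ i, (a i : ℤ)) * ((b : ℤ) - ∑ i, (a i : ℤ) + 1) / 2) •
    ∑ s : ∀ i, SimplexCategory.mk (a i) ⟶ SimplexCategory.mk b,
      ((ztBasis k I (SimplexCategory.mk b)).repr
        (φ (SimplexCategory.mk b)
          (Finsupp.single (⟨b, 𝟙 _⟩ : Simplices (SimplexCategory.mk b)) (1 : k)))
        fun i => ⟨a i, s i⟩) • B.pullOp ψ s

/-- The canonical maps `τ_{≤ 0} 𝒴(I) → P_I({MB}, MB)`. -/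
noncomputable def action :
    DGOperadData.Family (truncLieEZ k) (PseudoTensorCategory.complexOperad B.complex) :=
  fun I _ _ _ => TensorProduct.lift (LinearMap.mk₂ k
    (fun (φ : EZObj k I) (ψ : LieOp k I) =>
      (B.actionComponent φ ψ : PseudoTensorCategory.ComplexOps B.complex I))
    (fun φ φ' ψ => by
      funext a b
      change B.actionComponent (φ + φ') ψ a b =
        B.actionComponent φ ψ a b + B.actionComponent φ' ψ a b
      simp [actionComponent, add_smul, Finset.sum_add_distrib])
    (fun c φ ψ => by
      funext a b
      change B.actionComponent (c • φ) ψ a b = c • B.actionComponent φ ψ a b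
      simp [actionComponent, mul_smul, Finset.smul_sum, smul_comm c])
    (fun φ ψ ψ' => by
      funext a b
      change B.actionComponent φ (ψ + ψ') a b =
        B.actionComponent φ ψ a b + B.actionComponent φ ψ' a b
      simp [actionComponent, pullOp_add, smul_add, Finset.sum_add_distrib])
    (fun c φ ψ => by
      funext a b
      change B.actionComponent φ (c • ψ) a b = c • B.actionComponent φ ψ a b
      simp [actionComponent, pullOp_smul, Finset.smul_sum, smul_comm c]))

end CosimplicialLieAlgebra

/-! ## Signs -/

section Signs

variable {k : Type u} [Field k]

/-! A natural family `Z → Z^{⊗ I}` is determined by its values on the fundamental simplices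
`id_[m]`, and these values may be prescribed freely (`ezDeg_ext`, `ezOfSeq`). Both halves of the
theorem become statements about the tensors `φ(id_[m])`.

Homotopy Lie operad. That `𝒵` is an operad in complexes is a matter of Koszul signs. Degrees are
carried by the operators `zSign`, which multiply a chain by a sign depending on its degree, so that
each law becomes an identity between linear maps checked on tensors of simplices. Most of the signs
on permutations are double products over pairs of indices and are compared pair by pair
(`prod_prod_eq_of_pairs`). The laws of `Lie` are associativity of substitution in free Lie algebras,
and those of `𝒴 = 𝒵 ⊗ Lie` follow on pure tensors by multilinearity. Truncation keeps the laws,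
because a composition of total degree `0` of operations of degree at most `0` involves only
operations of degree `0`.

The quasi-isomorphism is an acyclic models argument. Coning off the vertex `0` contracts `Z([p])`
onto that vertex, and the usual product homotopy contracts `Z([p])^{⊗ I}` (`ztD_comp_ztCone_add`).
Hence the equation `dχ = φ` can be solved for the values `χ(id_[m])` one `m` at a time
(`exists_ezD_eq`); the only obstruction is the augmentation. This kills the cohomology of negative
degree and the kernel of `ε` in degree `0`, and it also produces a cocycle of augmentation `1`. A
basis of `Lie(I)` carries the result over to `𝒴(I)`.

Action. A chain on `Δ^n` acts on a cosimplicial object by linear extension of `s ↦ B(s)`, and for `ψ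
∈ Lie(I)` a tensor in `Z([n])^{⊗ I}` gives an operation with values in `B^n` (`tensorOp`). There is
a dictionary: a map `[n] → [n']` applied to the tensor is composition on the output with `B` of it,
which holds because structure maps are Lie morphisms; the differential of a tensor factor is the
differential of the corresponding input; the alternating sum of faces is the differential of the
output; permuting and flattening tensors are relabelling and composing operations. Up to sign, `F(φ
⊗ ψ)` is the operation given by `φ(id_[b])`, so compatibility with everything is read off from the
dictionary. The differentials of source and target of `φ` become those of output and input, and the
function `s(r) = (-1)^(r (r + 1) / 2)` repairs the signs, through `s(r + t) = s(r) s(t) (-1)^(r t)`.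
-/

@[simp] theorem ksign_zero : ksign k 0 = 1 := by simp [ksign]

@[simp] theorem ksign_one : ksign k 1 = -1 := by simp [ksign]

theorem ksign_add (m n : ℤ) : ksign k (m + n) = ksign k m * ksign k n := by
  simp [ksign, Int.negOnePow_add]

@[simp] theorem ksign_neg (m : ℤ) : ksign k (-m) = ksign k m := by
  simp [ksign, Int.negOnePow_neg]

@[simp] theorem ksign_mul_ksign_self (m : ℤ) : ksign k m * ksign k m = 1 := by
  rw [← ksign_add, ksign, Int.negOnePow_even _ ⟨m, rfl⟩]
  simp

theorem ksign_congr {m n : ℤ} (h : Even (m - n)) : ksign k m = ksign k n := by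
  rw [ksign, ksign, (Int.negOnePow_eq_iff m n).2 h]

theorem ksign_sum {ι : Type*} (s : Finset ι) (f : ι → ℤ) :
    ksign k (∑ i ∈ s, f i) = ∏ i ∈ s, ksign k (f i) := by
  classical
  induction s using Finset.induction_on with
  | empty => simp
  | insert a s ha ih => rw [Finset.sum_insert ha, Finset.prod_insert ha, ksign_add, ih]

/-- Fold each pair `(j, i)` with `i < j` onto `(i, j)`: the product then depends only on the
diagonal and on the products over unordered pairs. Sign identities for permutations are verified
through this. -/
theorem prod_prod_eq_of_pairs {I M : Type*} [Fintype I] [LinearOrder I] [CommMonoid M]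
    {f g : I → I → M} (hd : ∀ i, f i i = g i i)
    (h : ∀ i j, i < j → f i j * f j i = g i j * g j i) :
    ∏ i, ∏ j, f i j = ∏ i, ∏ j, g i j := by
  -- The folded form of a double product: the part below the diagonal is transposed and multiplied
  -- into the part above it.
  have key : ∀ F : I → I → M, ∏ i, ∏ j, F i j =
      ∏ i, ∏ j, (if i = j then F i j else if i < j then F i j * F j i else 1) := by
    intro F
    have h1 : ∏ i, ∏ j, F i j = (∏ i, ∏ j, ((if i = j then F i j else 1) *
        (if i < j then F i j else 1))) * ∏ i, ∏ j, (if j < i then F i j else 1) := by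
      simp only [← Finset.prod_mul_distrib]
      refine Finset.prod_congr rfl fun i _ => Finset.prod_congr rfl fun j _ => ?_
      rcases lt_trichotomy i j with h | h | h
      · simp [h, h.ne, h.not_gt]
      · simp [h]
      · simp [h, h.ne', h.not_gt]
    rw [h1, Finset.prod_comm (f := fun i j => if j < i then F i j else 1)]
    simp only [← Finset.prod_mul_distrib]
    refine Finset.prod_congr rfl fun i _ => Finset.prod_congr rfl fun j _ => ?_
    rcases lt_trichotomy i j with h | h | h
    · simp [h, h.ne]
    · simp [h]
    · simp [h.ne', h.not_gt]
  rw [key f, key g]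
  refine Finset.prod_congr rfl fun i _ => Finset.prod_congr rfl fun j _ => ?_
  split_ifs with h1 h2
  · subst h1; exact hd i
  · exact h i j h2
  · rfl

/-! ### Koszul signs of bijections -/

section Koszul

variable {I J H : Type} [Fintype I] [LinearOrder I] [LinearOrder J] [LinearOrder H]

theorem koszulSign_of_strictMono (e : I ≃ J) (he : StrictMono e) (a : I → ℤ) :
    koszulSign k e a = 1 := by
  refine Finset.prod_eq_one fun i _ => Finset.prod_eq_one fun j _ => ?_
  rw [if_neg]
  rintro ⟨h1, h2⟩
  exact (he h1).not_gt h2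

theorem koszulSign_neg (e : I ≃ J) (a : I → ℤ) :
    koszulSign k e (fun i => -a i) = koszulSign k e a := by
  simp [koszulSign]

/-- A pair is reversed by the composite exactly when it is reversed by one of the two bijections but
not by both; when both reverse it, its sign occurs twice and cancels. -/
theorem koszulSign_trans [Fintype J] (e : I ≃ J) (e' : J ≃ H) (a : I → ℤ) :
    koszulSign k (e.trans e') a = koszulSign k e a * koszulSign k e' (fun j => a (e.symm j)) := by
  have h1 : koszulSign k e' (fun j => a (e.symm j)) =
      ∏ i, ∏ i', if e i < e i' ∧ e' (e i') < e' (e i) then ksign k (a i * a i') else 1 := by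
    rw [koszulSign, ← e.prod_comp]
    refine Finset.prod_congr rfl fun i _ => ?_
    rw [← e.prod_comp]
    simp
  rw [h1, koszulSign, koszulSign]
  simp only [← Finset.prod_mul_distrib]
  refine prod_prod_eq_of_pairs (fun i => by simp) fun i j hij => ?_
  have hne : e i ≠ e j := fun h => hij.ne (e.injective h)
  have hne' : e' (e i) ≠ e' (e j) := fun h => hne (e'.injective h)
  rw [mul_comm (a j) (a i)]
  rcases lt_or_gt_of_ne hne with h | h <;> rcases lt_or_gt_of_ne hne' with h' | h' <;>
    simp [hij, hij.not_gt, h, h.not_gt, h', h'.not_gt]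

/-- Raising `a i` by one changes the Koszul sign by `(-1)^(a j)` for every `j` whose order relative
to `i` is reversed. These `j` form the symmetric difference of the factors before `i` and the
factors before `e i`. This is why permutations commute with the differential of a tensor power. -/
theorem koszulSign_update_succ (e : I ≃ J) (a : I → ℤ) (i : I) :
    ksign k (∑ i' with i' < i, a i') * koszulSign k e (Function.update a i (a i + 1)) =
      koszulSign k e a * ksign k (∑ i' with e i' < e i, a i') := by
  -- The exponent is written as a double product concentrated in row `i`, so that both sides can be
  -- compared pair by pair.
  have h1 : ∀ P : I → Prop, ∀ [DecidablePred P], ksign k (∑ i' with P i', a i') =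
      ∏ i', ∏ j, if i' = i ∧ P j then ksign k (a j) else 1 := by
    intro P _
    rw [Finset.prod_eq_single i]
    · rw [ksign_sum, Finset.prod_filter]
      simp
    · intro b _ hb
      simp [hb]
    · simp
  rw [h1, h1, koszulSign, koszulSign]
  simp only [← Finset.prod_mul_distrib]
  refine prod_prod_eq_of_pairs (fun i' => ?_) fun i' j hij => ?_
  · by_cases h : i' = i
    · subst h; simp
    · simp [h]
  have hne : e i' ≠ e j := fun h => hij.ne (e.injective h)
  by_cases hi : i' = i
  · subst hi
    rcases lt_or_gt_of_ne hne with h | h <;>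
      simp [hij, hij.ne', hij.not_gt, h, h.not_gt, add_mul, ksign_add]
  · by_cases hj : j = i
    · subst hj
      rcases lt_or_gt_of_ne hne with h | h <;>
        simp [hij, hij.ne, hij.not_gt, h, h.not_gt, mul_add, ksign_add]
      rw [mul_assoc, ksign_mul_ksign_self, mul_one]
    · rcases lt_or_gt_of_ne hne with h | h <;>
        simp [hij, hi, hj, hij.not_gt, h, h.not_gt]

end Koszul

end Signs

/-! ## Multilinear maps -/

/-- Induction on the set of coordinates that are only known to lie in the span; one coordinate at a
time is handled by linearity. -/
theorem MultilinearMap.eq_of_mem_span {R ι N : Type*} [CommSemiring R] [Finite ι] {M : ι → Type*}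
    [∀ i, AddCommMonoid (M i)] [∀ i, Module R (M i)] [AddCommMonoid N] [Module R N]
    {f g : MultilinearMap R M N} {S : ∀ i, Set (M i)}
    (h : ∀ m : ∀ i, M i, (∀ i, m i ∈ S i) → f m = g m)
    {m : ∀ i, M i} (hm : ∀ i, m i ∈ Submodule.span R (S i)) : f m = g m := by
  classical
  have := Fintype.ofFinite ι
  have key : ∀ T : Finset ι, ∀ m : ∀ i, M i, (∀ i ∈ T, m i ∈ Submodule.span R (S i)) →
      (∀ i ∉ T, m i ∈ S i) → f m = g m := by
    intro T
    induction T using Finset.induction_on with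
    | empty => exact fun m _ h' => h m fun i => h' i (by simp)
    | insert i T hi ih =>
      intro m h1 h2
      have hu : ∀ x ∈ Submodule.span R (S i),
          f (Function.update m i x) = g (Function.update m i x) := by
        intro x hx
        induction hx using Submodule.span_induction with
        | mem x hx =>
          refine ih _ (fun j hj => ?_) fun j hj => ?_
          · have : j ≠ i := fun e => hi (e ▸ hj)
            simpa [this] using h1 j (by simp [hj])
          · by_cases hji : j = i
            · subst hji; simpa using hx
            · simpa [hji] using h2 j (by simp [hji, hj])
        | zero => simp
        | add x y _ _ hx hy => simp [hx, hy]
        | smul c x _ hx => simp [hx]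
      simpa using hu (m i) (h1 i (by simp))
  exact key Finset.univ m (fun i _ => hm i) (by simp)

/-- Membership in `p` is vanishing in the quotient by `p`, which reduces this to equality with the
zero map. -/
theorem MultilinearMap.mem_of_mem_span {R ι N : Type*} [CommRing R] [Finite ι] {M : ι → Type*}
    [∀ i, AddCommGroup (M i)] [∀ i, Module R (M i)] [AddCommGroup N] [Module R N]
    (f : MultilinearMap R M N) (p : Submodule R N) {S : ∀ i, Set (M i)}
    (h : ∀ m : ∀ i, M i, (∀ i, m i ∈ S i) → f m ∈ p)
    {m : ∀ i, M i} (hm : ∀ i, m i ∈ Submodule.span R (S i)) : f m ∈ p := by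
  have := MultilinearMap.eq_of_mem_span (f := p.mkQ.compMultilinearMap f) (g := 0) (S := S)
    (fun m hm => by simpa using h m hm) hm
  simpa using this

/-! ## Chains on the standard simplices -/

section Chains

variable {k : Type u} [Field k] {n : SimplexCategory}

@[simp] theorem zMap_single {n' : SimplexCategory} (f : n ⟶ n') (s : Simplices n) (c : k) :
    zMap k f (Finsupp.single s c) = Finsupp.single (⟨s.1, s.2 ≫ f⟩ : Simplices n') c := by
  simp [zMap]

@[simp] theorem zSign_single (r : ℤ) (s : Simplices n) (c : k) :
    zSign k n r (Finsupp.single s c) = Finsupp.single s (c * ksign k (r * s.1)) := by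
  simp [zSign]

theorem zSign_single_one (r : ℤ) (s : Simplices n) :
    zSign k n r (Finsupp.single s 1) = ksign k (r * s.1) • Finsupp.single s (1 : k) := by
  simp

@[simp] theorem zD_single (s : Simplices n) : zD k n (Finsupp.single s 1) = simplexBoundary k s := by
  simp [zD]

theorem zChain_hom_ext {M : Type*} [AddCommGroup M] [Module k M] {f g : ZChain k n →ₗ[k] M}
    (h : ∀ s, f (Finsupp.single s 1) = g (Finsupp.single s 1)) : f = g :=
  Finsupp.basisSingleOne.ext fun s => by simpa using h s

theorem single_mem_zDeg (s : Simplices n) (c : k) : Finsupp.single s c ∈ zDeg k n (-(s.1 : ℤ)) :=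
  Finsupp.single_mem_supported k c rfl

theorem zDeg_eq_span (p : ℤ) : zDeg k n p =
    Submodule.span k ((fun s => Finsupp.single s (1 : k)) '' {s : Simplices n | -(s.1 : ℤ) = p}) :=
  Finsupp.supported_eq_span_single k _

@[simp] theorem zSign_zero : zSign k n 0 = LinearMap.id :=
  zChain_hom_ext fun s => by simp

theorem zSign_comp_zSign (a b : ℤ) : zSign k n a ∘ₗ zSign k n b = zSign k n (a + b) :=
  zChain_hom_ext fun s => by simp [add_mul, ksign_add, mul_comm]

theorem zSign_of_mem (r : ℤ) {p : ℤ} {z : ZChain k n} (hz : z ∈ zDeg k n p) :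
    zSign k n r z = ksign k (r * p) • z := by
  rw [zDeg_eq_span] at hz
  induction hz using Submodule.span_induction with
  | mem x hx =>
    obtain ⟨s, rfl, rfl⟩ := hx
    simp
  | zero => simp
  | add x y _ _ hx hy => rw [map_add, hx, hy, smul_add]
  | smul c x _ hx => rw [map_smul, hx, smul_comm]

theorem simplexBoundary_mem (s : Simplices n) :
    simplexBoundary k s ∈ zDeg k n (-(s.1 : ℤ) + 1) := by
  obtain ⟨m, s⟩ := s
  cases m with
  | zero => exact zero_mem _
  | succ m =>
    refine sum_mem fun i _ => ?_
    convert single_mem_zDeg (k := k) (⟨m, SimplexCategory.δ i ≫ s⟩ : Simplices n) _ using 2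
    push_cast
    ring

theorem zD_mem {p : ℤ} {z : ZChain k n} (hz : z ∈ zDeg k n p) : zD k n z ∈ zDeg k n (p + 1) := by
  rw [zDeg_eq_span] at hz
  induction hz using Submodule.span_induction with
  | mem x hx =>
    obtain ⟨s, rfl, rfl⟩ := hx
    simpa using simplexBoundary_mem s
  | zero => simp
  | add x y _ _ hx hy => rw [map_add]; exact add_mem hx hy
  | smul c x _ hx => rw [map_smul]; exact Submodule.smul_mem _ _ hx

/-- The boundary raises the cohomological degree by one, so the two signs differ by `(-1)^m`. -/
theorem zSign_comp_zD (m : ℤ) :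
    zSign k n m ∘ₗ zD k n = ksign k m • zD k n ∘ₗ zSign k n m :=
  zChain_hom_ext fun s => by
    rw [LinearMap.comp_apply, LinearMap.smul_apply, LinearMap.comp_apply, zSign_single_one,
      map_smul, zD_single, zSign_of_mem _ (simplexBoundary_mem s), smul_smul, mul_add, ksign_add,
      mul_comm, mul_one, mul_neg, ksign_neg]

theorem zD_zMap {n' : SimplexCategory} (f : n ⟶ n') :
    zD k n' ∘ₗ zMap k f = zMap k f ∘ₗ zD k n := by
  refine zChain_hom_ext ?_
  rintro ⟨m, s⟩
  cases m with
  | zero => simp [simplexBoundary]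
  | succ m => simp [simplexBoundary]

theorem zSign_zMap {n' : SimplexCategory} (f : n ⟶ n') (m : ℤ) :
    zSign k n' m ∘ₗ zMap k f = zMap k f ∘ₗ zSign k n m :=
  zChain_hom_ext fun s => by simp

theorem zMap_id : zMap k (𝟙 n) = LinearMap.id :=
  zChain_hom_ext fun s => by simp

theorem zMap_comp {n' n'' : SimplexCategory} (f : n ⟶ n') (g : n' ⟶ n'') :
    zMap k (f ≫ g) = zMap k g ∘ₗ zMap k f :=
  zChain_hom_ext fun s => by simp

theorem zD_comp_zD : zD k n ∘ₗ zD k n = 0 := by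
  refine zChain_hom_ext ?_
  rintro ⟨m, s⟩
  rcases m with _ | _ | m
  · simp [simplexBoundary]
  · simp only [LinearMap.comp_apply, zD_single, simplexBoundary, map_sum]
    refine Finset.sum_eq_zero fun i _ => ?_
    rw [← mul_one ((-1 : k) ^ _), ← smul_eq_mul, ← Finsupp.smul_single, map_smul, zD_single]
    simp [simplexBoundary]
  · have h : ∀ i : Fin (m + 3), zD k n (Finsupp.single
        (⟨m + 1, SimplexCategory.δ i ≫ s⟩ : Simplices n) ((-1 : k) ^ (i : ℕ))) =
        ∑ j : Fin (m + 2), Finsupp.single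
          (⟨m, SimplexCategory.δ j ≫ SimplexCategory.δ i ≫ s⟩ : Simplices n)
          ((-1 : k) ^ ((i : ℕ) + j)) := by
      intro i
      rw [← mul_one ((-1 : k) ^ _), ← smul_eq_mul, ← Finsupp.smul_single, map_smul, zD_single]
      simp [simplexBoundary, Finset.smul_sum, pow_add]
    simp only [LinearMap.comp_apply, zD_single, LinearMap.zero_apply]
    simp only [simplexBoundary, map_sum, h]
    rw [Finset.sum_comm, ← Finset.sum_product']
    -- The double faces fall into two halves, `S` and its complement. The pair `(j, i)` with `i ≤ j`
    -- is matched with `(i, j + 1)`: by the cosimplicial identity both give the same simplex, and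
    -- the signs are opposite.
    let P := Fin (m + 2) × Fin (m + 3)
    let S : Finset P := {ij : P | (ij.2 : ℕ) ≤ (ij.1 : ℕ)}
    rw [Finset.univ_product_univ, ← Finset.sum_add_sum_compl S, ← eq_neg_iff_add_eq_zero,
      ← Finset.sum_neg_distrib]
    let φ : ∀ ij : P, ij ∈ S → P := fun ij hij =>
      (Fin.castLT ij.2 (lt_of_le_of_lt (Finset.mem_filter.mp hij).right (Fin.is_lt ij.1)),
        ij.1.succ)
    apply Finset.sum_bij φ
    · intro ij hij
      simp_rw [S, φ, Finset.compl_filter, Finset.mem_filter_univ, Fin.val_succ,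
        Fin.val_castLT] at hij ⊢
      lia
    · rintro ⟨i, j⟩ hij ⟨i', j'⟩ hij' h
      rw [Prod.mk_inj]
      exact ⟨by simpa [φ] using! congr_arg Prod.snd h,
        by simpa [φ, Fin.castSucc_castLT] using! congr_arg Fin.castSucc (congr_arg Prod.fst h)⟩
    · rintro ⟨i', j'⟩ hij'
      simp_rw [S, Finset.compl_filter, Finset.mem_filter_univ, not_le] at hij'
      refine ⟨(j'.pred <| ?_, Fin.castSucc i'), ?_, ?_⟩
      · rintro rfl
        simp only [Fin.val_zero, not_lt_zero] at hij'
      · simpa [S] using! Nat.le_sub_one_of_lt hij'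
      · simp only [φ, Fin.castLT_castSucc, Fin.succ_pred]
    · rintro ⟨i, j⟩ hij
      have hij' : j ≤ i.castSucc := by simpa [S] using! hij
      have e := SimplexCategory.δ_comp_δ'' hij'
      simp only [φ, Fin.val_succ, Fin.val_castLT]
      rw [← Category.assoc, ← e, Category.assoc, ← Finsupp.single_neg]
      congr 1
      ring

end Chains

/-! ## Tensor powers of the chains -/

theorem LinearMap.comp_finset_sum {R M N P ι : Type*} [CommRing R] [AddCommGroup M] [Module R M]
    [AddCommGroup N] [Module R N] [AddCommGroup P] [Module R P] (f : N →ₗ[R] P) (s : Finset ι)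
    (g : ι → M →ₗ[R] N) : f ∘ₗ (∑ i ∈ s, g i) = ∑ i ∈ s, f ∘ₗ g i := by
  ext x
  simp

theorem LinearMap.finset_sum_comp {R M N P ι : Type*} [CommRing R] [AddCommGroup M] [Module R M]
    [AddCommGroup N] [Module R N] [AddCommGroup P] [Module R P] (f : M →ₗ[R] N) (s : Finset ι)
    (g : ι → N →ₗ[R] P) : (∑ i ∈ s, g i) ∘ₗ f = ∑ i ∈ s, g i ∘ₗ f := by
  ext x
  simp

theorem PiTensorProduct.map_smul_univ {R ι : Type*} [CommRing R] [Fintype ι] {M N : ι → Type*}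
    [∀ i, AddCommGroup (M i)] [∀ i, Module R (M i)] [∀ i, AddCommGroup (N i)]
    [∀ i, Module R (N i)] (c : ι → R) (f : ∀ i, M i →ₗ[R] N i) :
    PiTensorProduct.map (fun i => c i • f i) = (∏ i, c i) • PiTensorProduct.map f :=
  (PiTensorProduct.mapMultilinear R M N).map_smul_univ c f

theorem PiTensorProduct.map_eq_zero {R ι : Type*} [CommRing R] {M N : ι → Type*}
    [∀ i, AddCommGroup (M i)] [∀ i, Module R (M i)] [∀ i, AddCommGroup (N i)]
    [∀ i, Module R (N i)] {f : ∀ i, M i →ₗ[R] N i} (i : ι) (h : f i = 0) :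
    PiTensorProduct.map f = 0 :=
  (PiTensorProduct.mapMultilinear R M N).map_coord_zero i h

section TensorPowers

variable {k : Type u} [Field k] {n : SimplexCategory}

theorem ztBasis_apply (I : Type) [Finite I] (s : I → Simplices n) :
    ztBasis k I n s = PiTensorProduct.tprod k fun i => Finsupp.single (s i) (1 : k) := by
  simp [ztBasis, Basis.piTensorProduct_apply]

/-- Multiplication by `(-1)^(m * p)` on the component of `Z([n])^{⊗ I}` of degree `p`. -/
noncomputable def ztSignPow (k : Type u) [Field k] (I : Type) (n : SimplexCategory) (m : ℤ) :
    ZTensor k I n →ₗ[k] ZTensor k I n :=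
  PiTensorProduct.map fun _ => zSign k n m

theorem ztSign_eq (I : Type) : ztSign k I n = ztSignPow k I n 1 := rfl

/-- The differential of the tensor factor number `i` of `Z([n])^{⊗ I}`. -/
noncomputable def ztDAt (k : Type u) [Field k] {I : Type} [LinearOrder I] (n : SimplexCategory)
    (i : I) : ZTensor k I n →ₗ[k] ZTensor k I n :=
  PiTensorProduct.map fun j =>
    if j < i then zSign k n 1 else if j = i then zD k n else LinearMap.id

theorem ztD_eq_sum (I : Type) [Fintype I] [LinearOrder I] : ztD k I n = ∑ i, ztDAt k n i := rfl

theorem tprod_mem_ztDeg {I : Type} [Fintype I] {z : I → ZChain k n} {a : I → ℤ}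
    (hz : ∀ i, z i ∈ zDeg k n (a i)) {p : ℤ} (hp : ∑ i, a i = p) :
    PiTensorProduct.tprod k z ∈ ztDeg k I n p :=
  Submodule.subset_span ⟨a, z, hz, hp, rfl⟩

theorem ztBasis_mem {I : Type} [Fintype I] (s : I → Simplices n) {p : ℤ}
    (hp : ∑ i, -((s i).1 : ℤ) = p) : ztBasis k I n s ∈ ztDeg k I n p := by
  rw [ztBasis_apply]
  exact tprod_mem_ztDeg (fun i => single_mem_zDeg _ _) hp

/-- Homogeneous chains are combinations of simplices of one dimension; expanding each factor of a
homogeneous tensor multilinearly gives families of simplices of the right total degree. -/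
theorem ztDeg_eq_span (I : Type) [Fintype I] (p : ℤ) : ztDeg k I n p =
    Submodule.span k (ztBasis k I n '' {s | ∑ i, -((s i).1 : ℤ) = p}) := by
  refine le_antisymm (Submodule.span_le.2 ?_) (Submodule.span_le.2 ?_)
  · rintro _ ⟨a, z, hz, hp, rfl⟩
    refine MultilinearMap.mem_of_mem_span (PiTensorProduct.tprod k) _
      (S := fun i => (fun s => Finsupp.single s (1 : k)) '' {s : Simplices n | -(s.1 : ℤ) = a i})
      (fun m hm => ?_) fun i => by rw [← zDeg_eq_span]; exact hz i
    choose s hs hs' using hm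
    refine Submodule.subset_span ⟨s, ?_, ?_⟩
    · simp only [Set.mem_ofPred_eq] at hs ⊢
      rw [← hp]
      exact Finset.sum_congr rfl fun i _ => hs i
    · rw [ztBasis_apply]
      congr 1
      funext i
      exact hs' i
  · rintro _ ⟨s, hs, rfl⟩
    exact ztBasis_mem s hs

theorem ztDeg_induction {I : Type} [Fintype I] {p : ℤ} {P : ZTensor k I n → Prop}
    (basis : ∀ s, ∑ i, -((s i).1 : ℤ) = p → P (ztBasis k I n s)) (zero : P 0)
    (add : ∀ x y, P x → P y → P (x + y)) (smul : ∀ (c : k) x, P x → P (c • x))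
    {x : ZTensor k I n} (hx : x ∈ ztDeg k I n p) : P x := by
  rw [ztDeg_eq_span] at hx
  induction hx using Submodule.span_induction with
  | mem x hx =>
    obtain ⟨s, hs, rfl⟩ := hx
    exact basis s hs
  | zero => exact zero
  | add x y _ _ hx hy => exact add x y hx hy
  | smul c x _ hx => exact smul c x hx

theorem map_mem_ztDeg {I J : Type} [Fintype I] [Fintype J] {n' : SimplexCategory}
    (f : ZTensor k I n →ₗ[k] ZTensor k J n') {p q : ℤ}
    (h : ∀ s, ∑ i, -((s i).1 : ℤ) = p → f (ztBasis k I n s) ∈ ztDeg k J n' q)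
    {x : ZTensor k I n} (hx : x ∈ ztDeg k I n p) : f x ∈ ztDeg k J n' q :=
  ztDeg_induction (P := fun x => f x ∈ ztDeg k J n' q) h (by simp)
    (fun x y hx hy => by rw [map_add]; exact add_mem hx hy)
    (fun c x hx => by rw [map_smul]; exact Submodule.smul_mem _ _ hx) hx

theorem ztSignPow_of_mem {I : Type} [Fintype I] (m : ℤ) {p : ℤ} {x : ZTensor k I n}
    (hx : x ∈ ztDeg k I n p) : ztSignPow k I n m x = ksign k (m * p) • x := by
  refine ztDeg_induction (P := fun x => ztSignPow k I n m x = ksign k (m * p) • x) ?_ (by simp)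
    (fun x y hx hy => by rw [map_add, hx, hy, smul_add])
    (fun c x hx => by rw [map_smul, hx, smul_comm]) hx
  rintro s rfl
  rw [ztBasis_apply, ztSignPow, PiTensorProduct.map_tprod]
  simp only [zSign_single_one]
  rw [MultilinearMap.map_smul_univ, Finset.mul_sum, ksign_sum]
  simp

theorem ztDAt_comp_self {I : Type} [LinearOrder I] (i : I) :
    ztDAt k n i ∘ₗ ztDAt k n i = 0 := by
  rw [ztDAt, ← PiTensorProduct.map_comp]
  exact PiTensorProduct.map_eq_zero i (by simp [zD_comp_zD])

variable {I : Type} [Fintype I] [LinearOrder I]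

/-- The two composites differ only in slot `j`, where `d` meets the sign operator belonging to the
differential of the later slot `i`; interchanging them costs `-1`. -/
theorem ztDAt_comp_of_lt {i j : I} (h : j < i) :
    ztDAt k n i ∘ₗ ztDAt k n j = -(ztDAt k n j ∘ₗ ztDAt k n i) := by
  rw [ztDAt, ztDAt, ← PiTensorProduct.map_comp, ← PiTensorProduct.map_comp]
  have e : (fun l => (if l < i then zSign k n 1 else if l = i then zD k n else LinearMap.id) ∘ₗ
      (if l < j then zSign k n 1 else if l = j then zD k n else LinearMap.id)) =
      fun l => (if l = j then (-1 : k) else 1) •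
        ((if l < j then zSign k n 1 else if l = j then zD k n else LinearMap.id) ∘ₗ
        (if l < i then zSign k n 1 else if l = i then zD k n else LinearMap.id)) := by
    funext l
    rcases lt_trichotomy l j with hl | hl | hl
    · simp [hl, hl.ne, hl.trans h]
    · subst hl
      simp [h, zSign_comp_zD]
    · simp only [hl.ne', hl.not_gt, if_false, one_smul, LinearMap.comp_id, LinearMap.id_comp]
  rw [e, PiTensorProduct.map_smul_univ, Finset.prod_ite_eq' Finset.univ j, if_pos (by simp)]
  exact neg_one_smul k (M := ZTensor k I n →ₗ[k] ZTensor k I n) _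

theorem ztD_comp_ztD : ztD k I n ∘ₗ ztD k I n = 0 := by
  simp only [ztD_eq_sum, LinearMap.comp_finset_sum, LinearMap.finset_sum_comp]
  -- The pairwise comparison is stated for products; passing to `Multiplicative` gives it for sums.
  -- Diagonal terms vanish and the others cancel in pairs.
  have h := @prod_prod_eq_of_pairs I (Multiplicative (ZTensor k I n →ₗ[k] ZTensor k I n)) _ _ _
    (fun i j => Multiplicative.ofAdd (ztDAt k n j ∘ₗ ztDAt k n i)) (fun _ _ => 1)
    (fun i => by rw [ztDAt_comp_self]; rfl)
    (fun i j hij => by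
      rw [ztDAt_comp_of_lt hij, ← ofAdd_add]
      simp)
  simpa [← ofAdd_sum] using congrArg Multiplicative.toAdd h

theorem ztMap_tprod (J : Type) {n' : SimplexCategory} (f : n ⟶ n') (z : J → ZChain k n) :
    ztMap k J f (PiTensorProduct.tprod k z) = PiTensorProduct.tprod k fun j => zMap k f (z j) := by
  simp [ztMap]

theorem ztMap_ztBasis (J : Type) [Finite J] {n' : SimplexCategory} (f : n ⟶ n')
    (s : J → Simplices n) :
    ztMap k J f (ztBasis k J n s) = ztBasis k J n' fun j => ⟨(s j).1, (s j).2 ≫ f⟩ := by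
  simp [ztBasis_apply, ztMap_tprod]

theorem ztMap_id (J : Type) : ztMap k J (𝟙 n) = LinearMap.id := by
  simp [ztMap, zMap_id]

theorem ztMap_comp (J : Type) {n' n'' : SimplexCategory} (f : n ⟶ n') (g : n' ⟶ n'') :
    ztMap k J (f ≫ g) = ztMap k J g ∘ₗ ztMap k J f := by
  simp [ztMap, zMap_comp, PiTensorProduct.map_comp]

theorem ztMap_mem {J : Type} [Fintype J] {n' : SimplexCategory} (f : n ⟶ n') {p : ℤ}
    {x : ZTensor k J n} (hx : x ∈ ztDeg k J n p) : ztMap k J f x ∈ ztDeg k J n' p :=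
  map_mem_ztDeg _ (fun s hs => by rw [ztMap_ztBasis]; exact ztBasis_mem _ hs) hx

theorem ztMap_comp_ztD {n' : SimplexCategory} (f : n ⟶ n') :
    ztMap k I f ∘ₗ ztD k I n = ztD k I n' ∘ₗ ztMap k I f := by
  simp only [ztD_eq_sum, LinearMap.comp_finset_sum, LinearMap.finset_sum_comp, ztMap, ztDAt,
    ← PiTensorProduct.map_comp]
  refine Finset.sum_congr rfl fun i _ => congrArg _ (funext fun j => ?_)
  split_ifs
  · rw [zSign_zMap]
  · rw [zD_zMap]
  · rfl

theorem ztD_mem {p : ℤ} {x : ZTensor k I n} (hx : x ∈ ztDeg k I n p) :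
    ztD k I n x ∈ ztDeg k I n (p + 1) := by
  refine map_mem_ztDeg _ (fun s hs => ?_) hx
  rw [ztD_eq_sum, LinearMap.sum_apply]
  refine sum_mem fun i _ => ?_
  rw [ztBasis_apply, ztDAt, PiTensorProduct.map_tprod]
  refine tprod_mem_ztDeg (a := fun j => -((s j).1 : ℤ) + if j = i then 1 else 0) (fun j => ?_) ?_
  · rcases lt_trichotomy j i with h | h | h
    · simp only [h, h.ne, if_true, if_false, zSign_single_one, add_zero]
      exact Submodule.smul_mem _ _ (single_mem_zDeg _ _)
    · subst h
      simpa using simplexBoundary_mem (s j)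
    · simp only [h.ne', h.not_gt, if_false, add_zero]
      exact single_mem_zDeg _ _
  · rw [Finset.sum_add_distrib, hs]
    simp

end TensorPowers

/-! ## Iterated tensor powers and permutations of factors -/

section SigmaOrder

variable {I : Type} {K : I → Type} [LinearOrder I] [∀ i, LinearOrder (K i)]

/-- The strict order underlying the lexicographic order of a disjoint union. -/
abbrev sigmaLexLT : LT (Σ i, K i) := sigmaLexOrder.toLT

/-- The instance is named explicitly so that `<` is the lexicographic order, for which different
blocks are compared by their indices alone. -/
theorem sigma_mk_lt_mk_of_ne {i i' : I} (h : i ≠ i') (j : K i) (j' : K i') :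
    @LT.lt _ sigmaLexLT (⟨i, j⟩ : Σ i, K i) ⟨i', j'⟩ ↔ i < i' := by
  refine (Sigma.Lex.lt_def (α := K) (a := ⟨i, j⟩) (b := ⟨i', j'⟩)).trans ⟨?_, Or.inl⟩
  rintro (h' | ⟨h', -⟩)
  · exact h'
  · exact absurd h' h

theorem sigma_mk_lt_mk_iff {i : I} (j j' : K i) :
    @LT.lt _ sigmaLexLT (⟨i, j⟩ : Σ i, K i) ⟨i, j'⟩ ↔ j < j' := by
  refine (Sigma.Lex.lt_def (α := K) (a := ⟨i, j⟩) (b := ⟨i, j'⟩)).trans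
    ⟨?_, fun h => Or.inr ⟨rfl, h⟩⟩
  rintro (h | ⟨_, h⟩)
  · exact absurd h (lt_irrefl i)
  · exact h

end SigmaOrder

/-! ### Koszul signs of the structural bijections of disjoint unions -/

section KoszulSigma

variable {k : Type u} [Field k] {I : Type} [Fintype I] [LinearOrder I]

/-- The two conditions say that `e` is strictly increasing for the lexicographic order, so no pair
is reversed. Reassociation and the two unit bijections are of this kind and carry no sign. -/
theorem koszulSign_sigma_eq_one {K : I → Type} [∀ i, Fintype (K i)] [∀ i, LinearOrder (K i)]
    {J : Type} [LinearOrder J] (e : (Σ i, K i) ≃ J)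
    (h1 : ∀ i i' (j : K i) (j' : K i'), i < i' → e ⟨i, j⟩ < e ⟨i', j'⟩)
    (h2 : ∀ i (j j' : K i), j < j' → e ⟨i, j⟩ < e ⟨i, j'⟩) (a : (Σ i, K i) → ℤ) :
    koszulSign k e a = 1 := by
  refine koszulSign_of_strictMono e ?_ a
  rintro ⟨i, j⟩ ⟨i', j'⟩ h
  by_cases hi : i = i'
  · subst hi
    exact h2 _ _ _ ((sigma_mk_lt_mk_iff _ _).1 h)
  · exact h1 _ _ _ _ ((sigma_mk_lt_mk_of_ne hi _ _).1 h)

theorem koszulSign_sigmaAssoc {K : I → Type} [∀ i, Fintype (K i)] [∀ i, LinearOrder (K i)]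
    {H : (i : I) → K i → Type} [∀ i j, Fintype (H i j)] [∀ i j, LinearOrder (H i j)]
    (a : (Σ p : Σ i, K i, H p.1 p.2) → ℤ) : koszulSign k (Equiv.sigmaAssoc H) a = 1 := by
  refine koszulSign_sigma_eq_one _ ?_ ?_ a
  · rintro ⟨i, j⟩ ⟨i', j'⟩ l l' h
    by_cases hi : i = i'
    · subst hi
      refine (sigma_mk_lt_mk_iff (K := fun i => Σ j, H i j) _ _).2 ?_
      have hj := (sigma_mk_lt_mk_iff _ _).1 h
      exact (sigma_mk_lt_mk_of_ne hj.ne _ _).2 hj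
    · exact (sigma_mk_lt_mk_of_ne (K := fun i => Σ j, H i j) hi _ _).2
        ((sigma_mk_lt_mk_of_ne hi _ _).1 h)
  · rintro ⟨i, j⟩ l l' h
    exact (sigma_mk_lt_mk_iff (K := fun i => Σ j, H i j) _ _).2
      ((sigma_mk_lt_mk_iff (K := H i) _ _).2 h)

theorem koszulSign_uniqueSigma {J : Type} [Fintype J] [LinearOrder J]
    (a : (Σ _ : Unit, J) → ℤ) :
    koszulSign k (Equiv.uniqueSigma (fun _ : Unit => J)) a = 1 :=
  koszulSign_sigma_eq_one _ (fun _ _ _ _ h => absurd h (by simp)) (fun _ _ _ h => h) a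

theorem koszulSign_sigmaPUnit (a : (Σ _ : I, Unit) → ℤ) :
    koszulSign k (Equiv.sigmaPUnit.{0} I) a = 1 :=
  koszulSign_sigma_eq_one _ (fun _ _ _ _ h => h) (fun _ _ _ h => absurd h (lt_irrefl _)) a

/-- Elements of different blocks keep their order, so only pairs inside one block contribute. -/
theorem koszulSign_sigmaCongrRight {K K' : I → Type} [∀ i, Fintype (K i)]
    [∀ i, LinearOrder (K i)] [∀ i, LinearOrder (K' i)] (e : ∀ i, K i ≃ K' i)
    (a : (Σ i, K i) → ℤ) :
    koszulSign k (Equiv.sigmaCongrRight e) a = ∏ i, koszulSign k (e i) fun j => a ⟨i, j⟩ := by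
  simp only [koszulSign, Fintype.prod_sigma]
  refine Finset.prod_congr rfl fun i _ => Finset.prod_congr rfl fun j _ => ?_
  rw [Finset.prod_eq_single i]
  · refine Finset.prod_congr rfl fun j' _ => if_congr ?_ rfl rfl
    exact and_congr (sigma_mk_lt_mk_iff _ _) (sigma_mk_lt_mk_iff (K := K') _ _)
  · intro i' _ hi
    refine Finset.prod_eq_one fun j' _ => if_neg ?_
    rintro ⟨h1, h2⟩
    exact lt_asymm ((sigma_mk_lt_mk_of_ne hi.symm _ _).1 h1)
      ((sigma_mk_lt_mk_of_ne (K := K') hi _ _).1 h2)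
  · simp

/-- Blocks move as wholes: a reversed pair of blocks contributes all its pairs of elements, and
their exponents add up to the product of the total degrees of the two blocks. -/
theorem koszulSign_sigmaCongrLeft {I' : Type} [LinearOrder I'] {K : I' → Type}
    [∀ i, Fintype (K i)] [∀ i, LinearOrder (K i)] (e : I ≃ I')
    (a : (Σ i, K (e i)) → ℤ) :
    koszulSign k (Equiv.sigmaCongrLeft (β := K) e) a = koszulSign k e fun i => ∑ j, a ⟨i, j⟩ := by
  simp only [koszulSign, Fintype.prod_sigma]
  refine Finset.prod_congr rfl fun i _ => ?_
  rw [Finset.prod_comm]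
  refine Finset.prod_congr rfl fun i' _ => ?_
  by_cases hi : i = i'
  · subst hi
    rw [if_neg (by simp)]
    refine Finset.prod_eq_one fun j' _ => Finset.prod_eq_one fun j _ => if_neg ?_
    rintro ⟨h1, h2⟩
    exact lt_asymm ((sigma_mk_lt_mk_iff (K := fun i => K (e i)) _ _).1 h1)
      ((sigma_mk_lt_mk_iff (K := K) _ _).1 h2)
  · have hi' : e i' ≠ e i := fun h => hi (e.injective h).symm
    by_cases h : i < i' ∧ e i' < e i
    · rw [if_pos h, Finset.sum_mul_sum, ksign_sum]
      refine Finset.prod_congr rfl fun j _ => ?_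
      rw [ksign_sum]
      refine Finset.prod_congr rfl fun j' _ => if_pos ?_
      exact ⟨(sigma_mk_lt_mk_of_ne (K := fun i => K (e i)) hi _ _).2 h.1,
          (sigma_mk_lt_mk_of_ne (K := K) hi' _ _).2 h.2⟩
    · rw [if_neg h]
      refine Finset.prod_eq_one fun j' _ => Finset.prod_eq_one fun j _ => if_neg ?_
      exact fun h' => h ⟨(sigma_mk_lt_mk_of_ne (K := fun i => K (e i)) hi _ _).1 h'.1,
          (sigma_mk_lt_mk_of_ne (K := K) hi' _ _).1 h'.2⟩

end KoszulSigma

/-! ### Flattening of iterated tensor powers -/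

section Flatten

variable {k : Type u} [Field k] {n : SimplexCategory} {I : Type} {K : I → Type}

theorem ztFlatten_basis [Finite I] [∀ i, Finite (K i)] (s : ∀ i, K i → Simplices n) :
    ztFlatten k n (PiTensorProduct.tprod k fun i => ztBasis k (K i) n (s i)) =
      ztBasis k (Σ i, K i) n fun p => s p.1 p.2 := by
  simp only [ztBasis_apply]
  exact ztFlatten_tprod k n fun i j => Finsupp.single (s i j) 1

theorem iteratedTensor_hom_ext [Finite I] [∀ i, Finite (K i)] {M : Type*} [AddCommGroup M]
    [Module k M] {f g : (⨂[k] i, ZTensor k (K i) n) →ₗ[k] M}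
    (h : ∀ s : ∀ i, K i → Simplices n,
      f (PiTensorProduct.tprod k fun i => PiTensorProduct.tprod k fun j =>
        Finsupp.single (s i j) 1) =
      g (PiTensorProduct.tprod k fun i => PiTensorProduct.tprod k fun j =>
        Finsupp.single (s i j) 1)) : f = g :=
  (Basis.piTensorProduct fun i => ztBasis k (K i) n).ext fun s => by
    simpa [Basis.piTensorProduct_apply, ztBasis_apply] using h s

theorem multilinear_ztensor_ext [Finite I] [∀ i, Finite (K i)] {M : Type*} [AddCommGroup M]
    [Module k M] {f g : MultilinearMap k (fun i => ZTensor k (K i) n) M}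
    (h : ∀ s : ∀ i, K i → Simplices n,
      f (fun i => ztBasis k (K i) n (s i)) = g (fun i => ztBasis k (K i) n (s i))) : f = g :=
  Module.Basis.ext_multilinear (fun i => ztBasis k (K i) n) h

theorem map_comp_ztFlatten [Finite I] [∀ i, Finite (K i)] {n' : SimplexCategory}
    (F : (Σ i, K i) → ZChain k n →ₗ[k] ZChain k n') :
    PiTensorProduct.map F ∘ₗ ztFlatten k n =
      ztFlatten k n' ∘ₗ PiTensorProduct.map fun i => PiTensorProduct.map fun j => F ⟨i, j⟩ := by
  refine iteratedTensor_hom_ext fun s => ?_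
  simp only [LinearMap.comp_apply, PiTensorProduct.map_tprod]
  rw [ztFlatten_tprod, ztFlatten_tprod k n' fun i j => F ⟨i, j⟩ (Finsupp.single (s i j) 1),
    PiTensorProduct.map_tprod]

theorem ztMap_comp_ztFlatten [Finite I] [∀ i, Finite (K i)] {n' : SimplexCategory}
    (f : n ⟶ n') : ztMap k (Σ i, K i) f ∘ₗ ztFlatten k n =
      ztFlatten k n' ∘ₗ PiTensorProduct.map fun i => ztMap k (K i) f :=
  map_comp_ztFlatten _

/-- Before `(i, j)` in the lexicographic order come the whole blocks `l < i`, on which the sign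
operator of the block acts, and the elements `j' < j` of block `i`, which belong to the differential
of factor `j` within that block. -/
theorem ztDAt_comp_ztFlatten [Finite I] [LinearOrder I] [∀ i, Finite (K i)]
    [∀ i, LinearOrder (K i)] (i : I) (j : K i) :
    ztDAt k n (⟨i, j⟩ : Σ i, K i) ∘ₗ ztFlatten k n =
      ztFlatten k n ∘ₗ PiTensorProduct.map (Function.update
        (fun l => if l < i then ztSignPow k (K l) n 1 else LinearMap.id) i (ztDAt k n j)) := by
  rw [ztDAt, map_comp_ztFlatten]
  congr 2
  funext l
  by_cases hl : l = i
  · subst hl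
    rw [Function.update_self, ztDAt]
    refine congrArg _ (funext fun j' => ?_)
    refine if_congr (sigma_mk_lt_mk_iff _ _) rfl (if_congr ?_ rfl rfl)
    simp
  · have h : ∀ j', (⟨l, j'⟩ : Σ i, K i) ≠ ⟨i, j⟩ := fun j' h => hl (congrArg Sigma.fst h)
    rw [Function.update_of_ne hl]
    split_ifs with hli
    · exact congrArg _ (funext fun j' => if_pos ((sigma_mk_lt_mk_of_ne hl _ _).2 hli))
    · refine Eq.trans (congrArg _ (funext fun j' => ?_)) PiTensorProduct.map_id
      rw [if_neg (fun h' => hli ((sigma_mk_lt_mk_of_ne hl _ _).1 h')), if_neg (h j')]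

theorem ztD_comp_ztFlatten [Fintype I] [LinearOrder I] [∀ i, Fintype (K i)]
    [∀ i, LinearOrder (K i)] :
    ztD k (Σ i, K i) n ∘ₗ ztFlatten k n =
      ∑ i, ztFlatten k n ∘ₗ PiTensorProduct.map (Function.update
        (fun l => if l < i then ztSignPow k (K l) n 1 else LinearMap.id) i (ztD k (K i) n)) := by
  rw [ztD_eq_sum, LinearMap.finset_sum_comp, Fintype.sum_sigma]
  refine Finset.sum_congr rfl fun i _ => ?_
  simp only [ztDAt_comp_ztFlatten]
  rw [← LinearMap.comp_finset_sum, ztD_eq_sum]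
  congr 1
  -- Summing over `j` is additivity of the tensor product of maps in slot `i`.
  exact ((PiTensorProduct.mapMultilinear k _ _).map_update_sum _ _ _ _).symm

theorem ztFlatten_mem [Fintype I] [∀ i, Fintype (K i)] {w : ∀ i, ZTensor k (K i) n} {a : I → ℤ}
    (hw : ∀ i, w i ∈ ztDeg k (K i) n (a i)) {p : ℤ} (hp : ∑ i, a i = p) :
    ztFlatten k n (PiTensorProduct.tprod k w) ∈ ztDeg k (Σ i, K i) n p := by
  refine MultilinearMap.mem_of_mem_span
    ((ztFlatten k n).compMultilinearMap (PiTensorProduct.tprod k)) _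
    (S := fun i => ztBasis k (K i) n '' {s | ∑ j, -((s j).1 : ℤ) = a i})
    (fun m hm => ?_) fun i => by rw [← ztDeg_eq_span]; exact hw i
  choose s hs hs' using hm
  obtain rfl : (fun i => ztBasis k (K i) n (s i)) = m := funext hs'
  rw [LinearMap.compMultilinearMap_apply, ztFlatten_basis]
  refine ztBasis_mem _ ?_
  rw [Fintype.sum_sigma, ← hp]
  exact Finset.sum_congr rfl fun i _ => hs i

end Flatten

/-! ### Permutations of tensor factors -/

section Perm

variable {k : Type u} [Field k] {n : SimplexCategory} {I J : Type} [Fintype I] [LinearOrder I]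
  [Fintype J] [LinearOrder J]

theorem ztPerm_ztBasis (e : I ≃ J) (s : I → Simplices n) :
    ztPerm k e n (ztBasis k I n s) =
      koszulSign k e (fun i => ((s i).1 : ℤ)) • ztBasis k J n fun j => s (e.symm j) := by
  rw [ztPerm, Module.Basis.constr_basis, koszulSign_neg]

/-- The Koszul sign depends only on the degrees, so the formula defining the permutation on
simplices extends multilinearly to all homogeneous factors. -/
theorem ztPerm_tprod (e : I ≃ J) {z : I → ZChain k n} {a : I → ℤ}
    (hz : ∀ i, z i ∈ zDeg k n (a i)) :
    ztPerm k e n (PiTensorProduct.tprod k z) =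
      koszulSign k e a • PiTensorProduct.tprod k fun j => z (e.symm j) := by
  refine MultilinearMap.eq_of_mem_span
    (f := (ztPerm k e n).compMultilinearMap (PiTensorProduct.tprod k))
    (g := koszulSign k e a • ((PiTensorProduct.tprod k).domDomCongr e.symm))
    (S := fun i => (fun s => Finsupp.single s (1 : k)) '' {s : Simplices n | -(s.1 : ℤ) = a i})
    (fun m hm => ?_) fun i => by rw [← zDeg_eq_span]; exact hz i
  choose s hs hs' using hm
  obtain rfl : (fun i => Finsupp.single (s i) (1 : k)) = m := funext hs'
  have := ztPerm_ztBasis (k := k) e s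
  rw [ztBasis_apply, ztBasis_apply, ← koszulSign_neg] at this
  simp only [LinearMap.compMultilinearMap_apply, this, smul_apply,
    MultilinearMap.domDomCongr_apply]
  congr 2
  funext i
  exact hs i

theorem ztPerm_refl : ztPerm k (Equiv.refl I) n = LinearMap.id :=
  (ztBasis k I n).ext fun s => by
    rw [ztPerm_ztBasis, koszulSign_of_strictMono _ fun _ _ h => h, one_smul]
    rfl

theorem ztPerm_trans {H : Type} [Fintype H] [LinearOrder H] (e : I ≃ J) (e' : J ≃ H) :
    ztPerm k (e.trans e') n = ztPerm k e' n ∘ₗ ztPerm k e n :=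
  (ztBasis k I n).ext fun s => by
    rw [LinearMap.comp_apply, ztPerm_ztBasis, ztPerm_ztBasis, map_smul, ztPerm_ztBasis, smul_smul,
      koszulSign_trans]
    rfl

theorem ztPerm_mem (e : I ≃ J) {p : ℤ} {x : ZTensor k I n} (hx : x ∈ ztDeg k I n p) :
    ztPerm k e n x ∈ ztDeg k J n p := by
  refine map_mem_ztDeg _ (fun s hs => ?_) hx
  rw [ztPerm_ztBasis]
  refine Submodule.smul_mem _ _ (ztBasis_mem _ ?_)
  rw [← hs]
  exact e.symm.sum_comp fun i => -((s i).1 : ℤ)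

theorem ztPerm_comp_ztMap (e : I ≃ J) {n' : SimplexCategory} (f : n ⟶ n') :
    ztPerm k e n' ∘ₗ ztMap k I f = ztMap k J f ∘ₗ ztPerm k e n :=
  (ztBasis k I n).ext fun s => by
    simp [ztPerm_ztBasis, ztMap_ztBasis]

theorem ztDAt_tprod (i : I) {z : I → ZChain k n} {a : I → ℤ} (hz : ∀ i, z i ∈ zDeg k n (a i)) :
    ztDAt k n i (PiTensorProduct.tprod k z) = ksign k (∑ j with j < i, a j) •
      PiTensorProduct.tprod k (Function.update z i (zD k n (z i))) := by
  rw [ztDAt, PiTensorProduct.map_tprod]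
  have h : (fun j => (if j < i then zSign k n 1 else if j = i then zD k n else LinearMap.id)
      (z j)) = fun j => (if j < i then ksign k (a j) else 1) •
        Function.update z i (zD k n (z i)) j := by
    funext j
    rcases lt_trichotomy j i with h | h | h
    · simp [h, h.ne, zSign_of_mem 1 (hz j)]
    · subst h; simp
    · simp [h.ne', h.not_gt]
  rw [h, MultilinearMap.map_smul_univ, ← Finset.prod_filter, ksign_sum]

theorem ztD_tprod {z : I → ZChain k n} {a : I → ℤ} (hz : ∀ i, z i ∈ zDeg k n (a i)) :
    ztD k I n (PiTensorProduct.tprod k z) = ∑ i, ksign k (∑ j with j < i, a j) •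
      PiTensorProduct.tprod k (Function.update z i (zD k n (z i))) := by
  rw [ztD_eq_sum, LinearMap.sum_apply]
  exact Finset.sum_congr rfl fun i _ => ztDAt_tprod i hz

/-- The summand `i` on one side is the summand `e i` on the other. After differentiating factor `i`
its degree is one larger, and the signs agree by `koszulSign_update_succ`. -/
theorem ztD_comp_ztPerm (e : I ≃ J) :
    ztD k J n ∘ₗ ztPerm k e n = ztPerm k e n ∘ₗ ztD k I n := by
  refine (ztBasis k I n).ext fun s => ?_
  have hz : ∀ i, Finsupp.single (s i) (1 : k) ∈ zDeg k n (-((s i).1 : ℤ)) :=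
    fun i => single_mem_zDeg _ _
  rw [LinearMap.comp_apply, LinearMap.comp_apply, ztBasis_apply, ztPerm_tprod e hz, map_smul,
    ztD_tprod hz, ztD_tprod fun j => hz (e.symm j), map_sum, ← e.sum_comp, Finset.smul_sum]
  refine Finset.sum_congr rfl fun i _ => ?_
  set a : I → ℤ := fun i => -((s i).1 : ℤ)
  rw [map_smul, ztPerm_tprod (a := Function.update a i (a i + 1)) e fun j => ?_, smul_smul,
    smul_smul, koszulSign_update_succ]
  · have hs : ∑ j with j < e i, -((s (e.symm j)).1 : ℤ) = ∑ i' with e i' < e i, a i' :=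
      (Finset.sum_equiv e (by simp) (by simp [a])).symm
    rw [hs]
    congr 2
    · funext j
      by_cases hj : j = e i
      · subst hj; simp
      · have : e.symm j ≠ i := fun h => hj (by simp [← h])
        simp [hj, this]
  · by_cases hj : j = i
    · subst hj
      simpa using zD_mem (hz j)
    · simpa [hj] using hz j

variable {K : I → Type} [∀ i, Fintype (K i)] [∀ i, LinearOrder (K i)]

theorem ztPerm_sigmaCongrRight {K' : I → Type} [∀ i, Fintype (K' i)] [∀ i, LinearOrder (K' i)]
    (e : ∀ i, K i ≃ K' i) :
    ztPerm k (Equiv.sigmaCongrRight e) n ∘ₗ ztFlatten k n =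
      ztFlatten k n ∘ₗ PiTensorProduct.map fun i => ztPerm k (e i) n := by
  refine (Basis.piTensorProduct fun i => ztBasis k (K i) n).ext fun s => ?_
  rw [Basis.piTensorProduct_apply, LinearMap.comp_apply, LinearMap.comp_apply, ztFlatten_basis,
    ztPerm_ztBasis, PiTensorProduct.map_tprod, koszulSign_sigmaCongrRight]
  simp only [ztPerm_ztBasis]
  rw [MultilinearMap.map_smul_univ, map_smul, ztFlatten_basis]
  rfl

theorem ztPerm_sigmaAssoc {H : (i : I) → K i → Type} [∀ i j, Fintype (H i j)]
    [∀ i j, LinearOrder (H i j)] (w : ∀ i j, ZTensor k (H i j) n) :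
    ztPerm k (Equiv.sigmaAssoc H) n (ztFlatten k n (K := fun p : Σ i, K i => H p.1 p.2)
      (PiTensorProduct.tprod k fun p => w p.1 p.2)) =
    ztFlatten k n (PiTensorProduct.tprod k fun i =>
      ztFlatten k n (PiTensorProduct.tprod k fun j => w i j)) := by
  have h : ((ztPerm k (Equiv.sigmaAssoc H) n ∘ₗ
        ztFlatten k n (K := fun p : Σ i, K i => H p.1 p.2)).compMultilinearMap
          (PiTensorProduct.tprod k)) =
      ((ztFlatten k n).compMultilinearMap (PiTensorProduct.tprod k)).compMultilinearMap
        (fun i => (ztFlatten k n (K := H i)).compMultilinearMap (PiTensorProduct.tprod k)) := by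
    refine multilinear_ztensor_ext (K := fun p : Σ i, K i => H p.1 p.2) fun s => ?_
    rw [LinearMap.compMultilinearMap_apply, LinearMap.comp_apply, ztFlatten_basis, ztPerm_ztBasis,
      koszulSign_sigmaAssoc, one_smul]
    have h2 := fun i => ztFlatten_basis (k := k) (n := n) (K := H i) fun j => s ⟨i, j⟩
    simp only [MultilinearMap.compMultilinearMap_apply, LinearMap.compMultilinearMap_apply]
    have hc : ∀ i, Sigma.curry (γ := fun i j => ZTensor k (H i j) n) (fun p : Σ i, K i => ztBasis k (H p.1 p.2) n (s p)) i =
        fun j => ztBasis k (H i j) n (s ⟨i, j⟩) := fun i => rfl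
    simp only [hc, h2]
    rw [ztFlatten_basis (K := fun i => Σ j, H i j) fun i p => s ⟨i, p.1⟩ p.2]
    rfl
  exact congrArg (fun F => F fun p : Σ i, K i => w p.1 p.2) h

/-- On tensors of simplices this is `koszulSign_sigmaCongrLeft`, the total degree of the block `i`
being `a i`. -/
theorem ztFlatten_perm_sigmaCongrLeft {I' : Type} [Fintype I'] [LinearOrder I'] {K : I' → Type}
    [∀ i, Fintype (K i)] [∀ i, LinearOrder (K i)] (e : I ≃ I') {a : I' → ℤ}
    {w : ∀ i, ZTensor k (K i) n} (hw : ∀ i, w i ∈ ztDeg k (K i) n (a i)) :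
    ztPerm k (Equiv.sigmaCongrLeft (β := K) e) n (ztFlatten k n
      (PiTensorProduct.tprod k fun i => w (e i))) =
      koszulSign k e (fun i => a (e i)) • ztFlatten k n (PiTensorProduct.tprod k w) := by
  -- The left side involves `w ∘ e`; transporting along `e.symm` exhibits it as a multilinear
  -- function of `w`.
  have key := MultilinearMap.eq_of_mem_span
    (f := (MultilinearMap.domDomCongrLinearEquiv' k k (fun i => ZTensor k (K i) n)
      (ZTensor k (Σ i, K i) n) e.symm).symm
        ((ztPerm k (Equiv.sigmaCongrLeft (β := K) e) n ∘ₗ ztFlatten k n).compMultilinearMap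
          (PiTensorProduct.tprod k)))
    (g := koszulSign k e (fun i => a (e i)) •
      (ztFlatten k n).compMultilinearMap (PiTensorProduct.tprod k))
    (S := fun i => ztBasis k (K i) n '' {s | ∑ j, -((s j).1 : ℤ) = a i})
    (fun m hm => ?_) fun i => by rw [← ztDeg_eq_span]; exact hw i
  · exact key
  choose s hs hs' using hm
  obtain rfl : (fun i => ztBasis k (K i) n (s i)) = m := funext hs'
  change ztPerm k (Equiv.sigmaCongrLeft (β := K) e) n (ztFlatten k n
      (PiTensorProduct.tprod k fun i => ztBasis k (K (e i)) n (s (e i)))) =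
    koszulSign k e (fun i => a (e i)) •
      ztFlatten k n (PiTensorProduct.tprod k fun i => ztBasis k (K i) n (s i))
  rw [ztFlatten_basis (K := fun i => K (e i)) fun i => s (e i), ztPerm_ztBasis,
    ztFlatten_basis (K := K),
    koszulSign_sigmaCongrLeft]
  congr 1
  · rw [← koszulSign_neg]
    congr 1
    funext i
    rw [← hs (e i)]
    simp
  · congr 1
    funext p
    obtain ⟨q, rfl⟩ := (Equiv.sigmaCongrLeft (β := K) e).surjective p
    rw [Equiv.symm_apply_apply]
    rfl

end Perm

/-! ## The Eilenberg-Zilber operad is an operad in complexes -/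

theorem PiTensorProduct.map_update_sub_smul {R ι : Type*} [CommRing R] [DecidableEq ι]
    {M N : ι → Type*} [∀ i, AddCommGroup (M i)] [∀ i, Module R (M i)] [∀ i, AddCommGroup (N i)]
    [∀ i, Module R (N i)] (f : ∀ i, M i →ₗ[R] N i) (i : ι) (x y : M i →ₗ[R] N i) (c : R) :
    PiTensorProduct.map (Function.update f i (x - c • y)) =
      PiTensorProduct.map (Function.update f i x) -
        c • PiTensorProduct.map (Function.update f i y) := by
  rw [eq_sub_iff_add_eq, ← PiTensorProduct.map_update_smul, ← PiTensorProduct.map_update_add,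
    sub_add_cancel]

section EilenbergZilberOperad

variable {k : Type u} [Field k]

/-- A Yoneda argument: every simplex `s` is the image of a fundamental simplex under the map induced
by `s` itself. -/
theorem ezDeg_ext {I : Type} {φ ψ : EZObj k I} (hφ : ∀ {n n' : SimplexCategory} (f : n ⟶ n'),
      φ n' ∘ₗ zMap k f = ztMap k I f ∘ₗ φ n)
    (hψ : ∀ {n n' : SimplexCategory} (f : n ⟶ n'), ψ n' ∘ₗ zMap k f = ztMap k I f ∘ₗ ψ n)
    (h : ∀ m : ℕ, φ (SimplexCategory.mk m)
        (Finsupp.single (⟨m, 𝟙 _⟩ : Simplices (SimplexCategory.mk m)) 1) =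
      ψ (SimplexCategory.mk m)
        (Finsupp.single (⟨m, 𝟙 _⟩ : Simplices (SimplexCategory.mk m)) 1)) : φ = ψ := by
  funext n
  refine zChain_hom_ext fun s => ?_
  have h1 := LinearMap.congr_fun (hφ s.2)
    (Finsupp.single (⟨s.1, 𝟙 _⟩ : Simplices (SimplexCategory.mk s.1)) 1)
  have h2 := LinearMap.congr_fun (hψ s.2)
    (Finsupp.single (⟨s.1, 𝟙 _⟩ : Simplices (SimplexCategory.mk s.1)) 1)
  simp only [LinearMap.comp_apply, zMap_single, Category.id_comp] at h1 h2
  rw [h1, h2, h]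

/-! ### Homogeneous natural families and their differential -/

section Degree

variable {I : Type} [Fintype I] {φ ψ : EZObj k I} {r : ℤ}

theorem ezDeg_comp_zMap (hφ : φ ∈ ezDeg k I r) {n n' : SimplexCategory} (f : n ⟶ n') :
    φ n' ∘ₗ zMap k f = ztMap k I f ∘ₗ φ n :=
  LinearMap.ext fun z => hφ.1 f z

theorem mem_ezDeg (h1 : ∀ {n n' : SimplexCategory} (f : n ⟶ n'),
      φ n' ∘ₗ zMap k f = ztMap k I f ∘ₗ φ n)
    (h2 : ∀ (n : SimplexCategory) (s : Simplices n),
      φ n (Finsupp.single s 1) ∈ ztDeg k I n (-(s.1 : ℤ) + r)) : φ ∈ ezDeg k I r := by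
  refine ⟨fun f z => LinearMap.congr_fun (h1 f) z, fun n p z hz => ?_⟩
  rw [zDeg_eq_span] at hz
  induction hz using Submodule.span_induction with
  | mem x hx =>
    obtain ⟨s, rfl, rfl⟩ := hx
    exact h2 n s
  | zero => simp
  | add x y _ _ hx hy => rw [map_add]; exact add_mem hx hy
  | smul c x _ hx => rw [map_smul]; exact Submodule.smul_mem _ _ hx

/-- The family shifts degrees by `r`, so sign operators pass through it at the cost of `(-1)^(m r)`.
This replaces all arguments on degrees of elements below. -/
theorem ztSignPow_comp_of_mem (hφ : φ ∈ ezDeg k I r) (n : SimplexCategory) (m : ℤ) :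
    ztSignPow k I n m ∘ₗ φ n = ksign k (m * r) • φ n ∘ₗ zSign k n m :=
  zChain_hom_ext fun s => by
    rw [LinearMap.comp_apply, ztSignPow_of_mem m (hφ.2 n _ _ (single_mem_zDeg s 1)),
      LinearMap.smul_apply, LinearMap.comp_apply, zSign_single_one, map_smul, smul_smul, mul_add,
      ksign_add, mul_comm, mul_neg, ksign_neg]

/-- The definition encodes `(-1)^|φ|` by sign operators on both sides of `φ`; moving one through `φ`
produces `(-1)^r`, and the two then cancel. -/
theorem ezD_of_mem [LinearOrder I] (hφ : φ ∈ ezDeg k I r) (n : SimplexCategory) :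
    ezD k I φ n = ztD k I n ∘ₗ φ n - ksign k r • φ n ∘ₗ zD k n := by
  change ztD k I n ∘ₗ φ n - ztSign k I n ∘ₗ φ n ∘ₗ zSign k n 1 ∘ₗ zD k n = _
  rw [← LinearMap.comp_assoc, ztSign_eq, ztSignPow_comp_of_mem hφ, LinearMap.smul_comp,
    LinearMap.comp_assoc, ← LinearMap.comp_assoc (zD k n), zSign_comp_zSign, one_mul]
  congr 2
  refine congrArg _ (LinearMap.ext fun z => ?_)
  congr 1
  have : zSign k n (1 + 1) = LinearMap.id := zChain_hom_ext fun s => by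
    rw [zSign_single, add_mul, ksign_add, ksign_mul_ksign_self, mul_one, LinearMap.id_apply]
  rw [this]
  rfl

variable [LinearOrder I]

theorem ezD_mem (hφ : φ ∈ ezDeg k I r) : ezD k I φ ∈ ezDeg k I (r + 1) := by
  refine mem_ezDeg (fun {n n'} f => ?_) fun n s => ?_
  · rw [ezD_of_mem hφ, ezD_of_mem hφ, LinearMap.sub_comp, LinearMap.comp_sub, LinearMap.smul_comp,
      LinearMap.comp_smul, LinearMap.comp_assoc, LinearMap.comp_assoc, zD_zMap,
      ezDeg_comp_zMap hφ, ← LinearMap.comp_assoc, ← LinearMap.comp_assoc, ← ztMap_comp_ztD,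
      ezDeg_comp_zMap hφ]
    rfl
  · rw [ezD_of_mem hφ, LinearMap.sub_apply]
    refine sub_mem ?_ ?_
    · rw [← add_assoc]
      exact ztD_mem (hφ.2 n _ _ (single_mem_zDeg s 1))
    · refine Submodule.smul_mem _ _ ?_
      have := hφ.2 n _ _ (zD_mem (single_mem_zDeg s (1 : k)))
      rwa [add_assoc, add_comm 1 r] at this

theorem ezD_ezD (hφ : φ ∈ ezDeg k I r) : ezD k I (ezD k I φ) = 0 := by
  funext n
  rw [ezD_of_mem (ezD_mem hφ), ezD_of_mem hφ, LinearMap.comp_sub, LinearMap.sub_comp,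
    ← LinearMap.comp_assoc, ztD_comp_ztD, LinearMap.comp_smul, LinearMap.smul_comp,
    LinearMap.comp_assoc, LinearMap.comp_assoc, zD_comp_zD, LinearMap.zero_comp,
    LinearMap.comp_zero, ksign_add, ksign_one, smul_zero, sub_zero, zero_sub, mul_neg, mul_one,
    neg_smul (M := ZChain k n →ₗ[k] ZTensor k I n), sub_neg_eq_add, neg_add_cancel]
  rfl

end Degree

/-! ### The unit of the Eilenberg-Zilber operad -/

section Unit

theorem ezUnit_apply (n : SimplexCategory) (z : ZChain k n) :
    ezUnit k n z = PiTensorProduct.tprod k fun _ : Unit => z :=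
  PiTensorProduct.subsingletonEquiv_symm_apply' _ _

theorem ezUnit_mem : ezUnit k ∈ ezDeg k Unit 0 := by
  refine mem_ezDeg (fun {n n'} f => LinearMap.ext fun z => ?_) fun n s => ?_
  · simp only [LinearMap.comp_apply, ezUnit_apply, ztMap_tprod]
  · rw [ezUnit_apply]
    exact tprod_mem_ztDeg (fun _ => single_mem_zDeg s 1) (by simp)

theorem ezD_ezUnit : ezD k Unit (ezUnit k) = 0 := by
  funext n
  rw [ezD_of_mem ezUnit_mem]
  refine zChain_hom_ext fun s => ?_
  have h := ztD_tprod (I := Unit) (fun _ => single_mem_zDeg s (1 : k))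
  simp only [LinearMap.sub_apply, LinearMap.comp_apply, LinearMap.smul_apply, ezUnit_apply, h]
  simp only [Finset.univ_unique, Finset.sum_singleton, ksign_zero, one_smul]
  rw [Finset.filter_false_of_mem (by simp), Finset.sum_empty, ksign_zero, one_smul]
  refine sub_eq_zero.2 ?_
  congr 1

end Unit

/-! ### Permutations acting on natural families -/

section Relabel

variable {I J : Type} [Fintype I] [LinearOrder I] [Fintype J] [LinearOrder J]

theorem ezRelabel_apply (e : I ≃ J) (φ : EZObj k I) (n : SimplexCategory) :
    ezRelabel k e φ n = ztPerm k e n ∘ₗ φ n := rfl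

theorem ezRelabel_mem (e : I ≃ J) {φ : EZObj k I} {r : ℤ} (hφ : φ ∈ ezDeg k I r) :
    ezRelabel k e φ ∈ ezDeg k J r := by
  refine mem_ezDeg (fun {n n'} f => ?_) fun n s => ?_
  · simp only [ezRelabel_apply]
    rw [LinearMap.comp_assoc, ezDeg_comp_zMap hφ, ← LinearMap.comp_assoc, ztPerm_comp_ztMap]
    rfl
  · exact ztPerm_mem e (hφ.2 n _ _ (single_mem_zDeg s 1))

theorem ezD_ezRelabel (e : I ≃ J) {φ : EZObj k I} {r : ℤ} (hφ : φ ∈ ezDeg k I r) :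
    ezD k J (ezRelabel k e φ) = ezRelabel k e (ezD k I φ) := by
  funext n
  rw [ezD_of_mem (ezRelabel_mem e hφ)]
  simp only [ezRelabel_apply]
  rw [ezD_of_mem hφ, LinearMap.comp_sub, LinearMap.comp_smul, ← LinearMap.comp_assoc,
    ztD_comp_ztPerm]
  rfl

end Relabel

/-! ### Composition and the Leibniz rule -/

section Comp

variable {I : Type} {K : I → Type} [Fintype I] [LinearOrder I] [∀ i, Fintype (K i)]
  {p : ℤ} {q : I → ℤ} {f : EZObj k I} {g : ∀ i, EZObj k (K i)}

theorem ezComp_apply (p : ℤ) (q : I → ℤ) (f : EZObj k I) (g : ∀ i, EZObj k (K i))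
    (n : SimplexCategory) : ezComp k p q f g n = ksign k (p * ∑ i, q i) •
      (ztFlatten k n ∘ₗ
        (PiTensorProduct.map fun i => g i n ∘ₗ zSign k n (∑ i' with i < i', q i')) ∘ₗ f n) := rfl

theorem ezComp_mem (hf : f ∈ ezDeg k I p) (hg : ∀ i, g i ∈ ezDeg k (K i) (q i)) :
    ezComp k p q f g ∈ ezDeg k (Σ i, K i) (p + ∑ i, q i) := by
  refine mem_ezDeg (fun {n n'} φ => ?_) fun n s => ?_
  · simp only [ezComp_apply]
    rw [LinearMap.smul_comp, LinearMap.comp_smul, LinearMap.comp_assoc, LinearMap.comp_assoc,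
      ezDeg_comp_zMap hf, ← LinearMap.comp_assoc _ (ztFlatten k n) (ztMap k _ φ), ztMap_comp_ztFlatten,
      LinearMap.comp_assoc]
    have h : (PiTensorProduct.map fun i => g i n' ∘ₗ zSign k n' (∑ i' with i < i', q i')) ∘ₗ
        ztMap k I φ = (PiTensorProduct.map fun i => ztMap k (K i) φ) ∘ₗ
          PiTensorProduct.map fun i => g i n ∘ₗ zSign k n (∑ i' with i < i', q i') := by
      rw [ztMap, ← PiTensorProduct.map_comp, ← PiTensorProduct.map_comp]
      congr 1
      funext i
      rw [LinearMap.comp_assoc, zSign_zMap, ← LinearMap.comp_assoc, ezDeg_comp_zMap (hg i)]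
      rfl
    rw [← LinearMap.comp_assoc (f n), h]
    rfl
  · rw [ezComp_apply]
    refine Submodule.smul_mem _ _ ?_
    rw [← add_assoc]
    refine map_mem_ztDeg (ztFlatten k n ∘ₗ PiTensorProduct.map fun i =>
      g i n ∘ₗ zSign k n (∑ i' with i < i', q i')) (fun t ht => ?_)
      (hf.2 n _ _ (single_mem_zDeg s 1))
    rw [LinearMap.comp_apply, ztBasis_apply, PiTensorProduct.map_tprod]
    refine ztFlatten_mem (a := fun i => -((t i).1 : ℤ) + q i) (fun i => ?_) ?_
    · rw [LinearMap.comp_apply, zSign_single_one, map_smul]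
      exact Submodule.smul_mem _ _ ((hg i).2 n _ _ (single_mem_zDeg _ _))
    · rw [Finset.sum_add_distrib, ht]

theorem sum_lt_add_sum_gt (q : I → ℤ) (i : I) :
    ∑ i', q i' = ∑ i' with i' < i, q i' + q i + ∑ i' with i < i', q i' := by
  have h : ∀ i', q i' = (if i' < i then q i' else 0) + (if i' = i then q i' else 0) +
      (if i < i' then q i' else 0) := by
    intro i'
    rcases lt_trichotomy i' i with h | h | h
    · simp [h, h.ne, h.not_gt]
    · simp [h]
    · simp [h, h.ne', h.not_gt]
  rw [Finset.sum_congr rfl fun i' _ => h i']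
  simp [Finset.sum_add_distrib, Finset.sum_filter]

theorem sum_update_succ (q : I → ℤ) (i : I) :
    ∑ i', Function.update q i (q i + 1) i' = ∑ i', q i' + 1 := by
  have h : ∀ i', Function.update q i (q i + 1) i' = q i' + if i' = i then 1 else 0 := by
    intro i'
    by_cases hi : i' = i
    · subst hi; simp
    · simp [hi]
  simp [h, Finset.sum_add_distrib]

theorem sum_gt_update_succ (q : I → ℤ) (i l : I) :
    ∑ i' with l < i', Function.update q i (q i + 1) i' =
      ∑ i' with l < i', q i' + if l < i then 1 else 0 := by
  have h : ∀ i', Function.update q i (q i + 1) i' = q i' + if i' = i then 1 else 0 := by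
    intro i'
    by_cases hi : i' = i
    · subst hi; simp
    · simp [hi]
  simp [h, Finset.sum_add_distrib]

/-- Both `d` and `⨂ g i` are tensor products of maps, so differentiating a composition puts one `d`
next to one `g i`, after it (`X i`) or before it (`Y i`). The `X i` and `Y i` combine to the
differential of `g i`, and the remaining `d` meets `f`. -/
theorem ezD_ezComp [∀ i, LinearOrder (K i)] (hf : f ∈ ezDeg k I p)
    (hg : ∀ i, g i ∈ ezDeg k (K i) (q i)) :
    ezD k (Σ i, K i) (ezComp k p q f g) = ezComp k (p + 1) q (ezD k I f) g +
      ∑ i, ksign k (p + ∑ i' with i' < i, q i') •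
        ezComp k p (Function.update q i (q i + 1)) f
          (Function.update g i (ezD k (K i) (g i))) := by
  funext n
  set Q : I → ℤ := fun i => ∑ i' with i < i', q i' with hQ
  -- Slot `i` is left free. In the slots before it the exponent is one larger, which accounts for an
  -- operator of degree one acting in slot `i`.
  let F : (i l : I) → (ZChain k n →ₗ[k] ZTensor k (K i) n) → ZChain k n →ₗ[k] ZTensor k (K l) n :=
    fun i l y => Function.update (fun l => g l n ∘ₗ
      zSign k n (Q l + if l < i then 1 else 0)) i y l
  let T : (i : I) → (ZChain k n →ₗ[k] ZTensor k (K i) n) →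
      ZTensor k I n →ₗ[k] ZTensor k (Σ i, K i) n :=
    fun i y => ztFlatten k n ∘ₗ PiTensorProduct.map fun l => F i l y
  have hT : ∀ i (c : k) y y', T i (y - c • y') = T i y - c • T i y' := by
    intro i c y y'
    have h := PiTensorProduct.map_update_sub_smul
      (fun l => g l n ∘ₗ zSign k n (Q l + if l < i then 1 else 0)) i y y' c
    refine (congrArg (fun t => ztFlatten k n ∘ₗ t) h).trans ?_
    rw [LinearMap.comp_sub, LinearMap.comp_smul]
  let X : I → ZTensor k I n →ₗ[k] ZTensor k (Σ i, K i) n :=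
    fun i => T i (ztD k (K i) n ∘ₗ g i n ∘ₗ zSign k n (Q i))
  let Y : I → ZTensor k I n →ₗ[k] ZTensor k (Σ i, K i) n :=
    fun i => T i (g i n ∘ₗ zD k n ∘ₗ zSign k n (Q i))
  let A : ZTensor k I n →ₗ[k] ZTensor k (Σ i, K i) n :=
    ztFlatten k n ∘ₗ PiTensorProduct.map fun i => g i n ∘ₗ zSign k n (Q i)
  -- The sign operators on the blocks `l < i` pass through the `g l`; each costs `(-1)^(q l)` and
  -- merges with the sign operator already there.
  have h1 : ztD k (Σ i, K i) n ∘ₗ A = ∑ i, ksign k (∑ i' with i' < i, q i') • X i := by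
    rw [← LinearMap.comp_assoc, ztD_comp_ztFlatten, LinearMap.finset_sum_comp]
    refine Finset.sum_congr rfl fun i _ => ?_
    rw [LinearMap.comp_assoc, ← PiTensorProduct.map_comp]
    have : (fun l => Function.update
        (fun l => if l < i then ztSignPow k (K l) n 1 else LinearMap.id) i (ztD k (K i) n) l ∘ₗ
          g l n ∘ₗ zSign k n (Q l)) = fun l => (if l < i then ksign k (q l) else 1) •
        F i l (ztD k (K i) n ∘ₗ g i n ∘ₗ zSign k n (Q i)) := by
      funext l
      by_cases hl : l = i
      · subst hl
        simp [F]
      · simp only [F, Function.update_of_ne hl]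
        split_ifs with hli
        · rw [← LinearMap.comp_assoc, ztSignPow_comp_of_mem (hg l), LinearMap.smul_comp,
            LinearMap.comp_assoc, zSign_comp_zSign, one_mul, add_comm]
        · simp
    rw [this, PiTensorProduct.map_smul_univ, ← Finset.prod_filter, ← ksign_sum,
      LinearMap.comp_smul]
  -- In the slots before `i` the sign operators simply add. In slot `i` the boundary has to pass
  -- `zSign (Q i)`, which costs `(-1)^(Q i)`.
  have h2 : A ∘ₗ ztD k I n = ∑ i, ksign k (Q i) • Y i := by
    rw [ztD_eq_sum, LinearMap.comp_finset_sum]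
    refine Finset.sum_congr rfl fun i _ => ?_
    rw [LinearMap.comp_assoc, ztDAt, ← PiTensorProduct.map_comp]
    have : (fun l => (g l n ∘ₗ zSign k n (Q l)) ∘ₗ
        (if l < i then zSign k n 1 else if l = i then zD k n else LinearMap.id)) =
        fun l => (if l = i then ksign k (Q i) else 1) •
          F i l (g i n ∘ₗ zD k n ∘ₗ zSign k n (Q i)) := by
      funext l
      by_cases hl : l = i
      · subst hl
        simp only [F, lt_irrefl, if_false, if_true, Function.update_self, LinearMap.comp_assoc,
          zSign_comp_zD, LinearMap.comp_smul]
      · simp only [F, Function.update_of_ne hl, hl, if_false, one_smul]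
        split_ifs with hli
        · rw [LinearMap.comp_assoc, zSign_comp_zSign]
        · simp
    rw [this, PiTensorProduct.map_smul_univ, LinearMap.comp_smul]
    simp [Y, T]
  -- Replacing `q i` by `q i + 1` raises the exponent exactly in the slots before `i`, which
  -- reproduces the maps in `F`.
  have h3 : ∀ i, ezComp k p (Function.update q i (q i + 1)) f
      (Function.update g i (ezD k (K i) (g i))) n =
        ksign k (p * (∑ i, q i + 1)) • (X i - ksign k (q i) • Y i) ∘ₗ f n := by
    intro i
    rw [ezComp_apply, sum_update_succ, ← hT, ← LinearMap.comp_assoc]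
    congr 4
    funext l
    rw [sum_gt_update_succ]
    by_cases hl : l = i
    · subst hl
      simp only [F, Function.update_self, ezD_of_mem (hg l), lt_irrefl, if_false, add_zero]
      rfl
    · simp only [F, Function.update_of_ne hl]
      rfl
  have h4 : ezComp k p q f g n = ksign k (p * ∑ i, q i) • A ∘ₗ f n := rfl
  have h5 : ezComp k (p + 1) q (ezD k I f) g n =
      ksign k ((p + 1) * ∑ i, q i) • A ∘ₗ ezD k I f n := rfl
  rw [Pi.add_apply, Finset.sum_apply, ezD_of_mem (ezComp_mem hf hg), h4, h5, ezD_of_mem hf,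
    LinearMap.comp_smul, ← LinearMap.comp_assoc, h1, LinearMap.comp_sub,
    ← LinearMap.comp_assoc, h2]
  simp only [Pi.smul_apply, h3, LinearMap.finset_sum_comp, LinearMap.smul_comp,
    LinearMap.comp_smul, LinearMap.sub_comp, smul_sub, Finset.smul_sum, smul_smul,
    Finset.sum_sub_distrib, ← ksign_add]
  -- It remains to match the parities of the coefficients of `X i`, of `Y i`, and of `A ∘ f ∘ d`.
  have e1 : ∑ i, ksign k (p * ∑ i, q i + ∑ i' with i' < i, q i') • X i ∘ₗ f n =
      ∑ i, ksign k (p + ∑ i' with i' < i, q i' + p * (∑ i, q i + 1)) • X i ∘ₗ f n := by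
    refine Finset.sum_congr rfl fun i _ => ?_
    rw [ksign_congr (m := p * ∑ i, q i + ∑ i' with i' < i, q i')]
    exact ⟨-p, by ring⟩
  have e2 : ∑ i, ksign k ((p + 1) * ∑ i, q i + Q i) • Y i ∘ₗ f n =
      ∑ i, ksign k (p + ∑ i' with i' < i, q i' + (p * (∑ i, q i + 1) + q i)) • Y i ∘ₗ f n := by
    refine Finset.sum_congr rfl fun i _ => ?_
    rw [ksign_congr (m := (p + 1) * ∑ i, q i + Q i)]
    have := sum_lt_add_sum_gt q i
    exact ⟨Q i - p, by rw [this]; ring⟩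
  have e3 : ksign k (p + ∑ i, q i + p * ∑ i, q i) = ksign k ((p + 1) * ∑ i, q i + p) := by
    congr 1; ring
  simp only [add_assoc] at e1 e2 e3 ⊢
  rw [e1, e2, e3]
  simp only [LinearMap.comp_assoc]
  abel

end Comp

end EilenbergZilberOperad

section EilenbergZilberOperad

variable {k : Type u} [Field k]

/-! ### Associativity of composition -/

section CompAssoc

variable {I : Type} {K : I → Type} {H : (i : I) → K i → Type} [Fintype I] [LinearOrder I]
  [∀ i, Fintype (K i)] [∀ i, LinearOrder (K i)]

theorem sum_sigma_gt (r : ∀ i, K i → ℤ) (i : I) (j : K i) :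
    ∑ s with (sigmaLexLT.lt (⟨i, j⟩ : Σ i, K i) s), r s.1 s.2 =
      ∑ j' with j < j', r i j' + ∑ i' with i < i', ∑ j', r i' j' := by
  have h : ∀ i', ∑ j', (if sigmaLexLT.lt (⟨i, j⟩ : Σ i, K i) ⟨i', j'⟩ then r i' j' else 0) =
      (if i' = i then ∑ j' with j < j', r i j' else 0) +
        if i < i' then ∑ j', r i' j' else 0 := by
    intro i'
    by_cases hi : i' = i
    · subst hi
      simp only [sigma_mk_lt_mk_iff, if_true, lt_irrefl, if_false, add_zero, Finset.sum_filter]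
    · simp only [sigma_mk_lt_mk_of_ne (Ne.symm hi), hi, if_false, zero_add]
      split_ifs <;> simp
  rw [Finset.sum_filter, Fintype.sum_sigma]
  simp only [h, Finset.sum_add_distrib, Finset.sum_ite_eq', Finset.mem_univ, if_true]
  rw [Finset.sum_filter (fun i' => i < i')]

variable [∀ i j, Fintype (H i j)] [∀ i j, LinearOrder (H i j)]

theorem ztPerm_sigmaAssoc_comp {n : SimplexCategory}
    (F : ∀ i j, ZChain k n →ₗ[k] ZTensor k (H i j) n) :
    ztPerm k (Equiv.sigmaAssoc H) n ∘ₗ ztFlatten k n (K := fun p : Σ i, K i => H p.1 p.2) ∘ₗ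
      (PiTensorProduct.map fun p : Σ i, K i => F p.1 p.2) ∘ₗ ztFlatten k n =
    ztFlatten k n ∘ₗ PiTensorProduct.map fun i => ztFlatten k n ∘ₗ
      PiTensorProduct.map fun j => F i j := by
  refine iteratedTensor_hom_ext fun s => ?_
  simp only [LinearMap.comp_apply, PiTensorProduct.map_tprod]
  rw [ztFlatten_tprod, PiTensorProduct.map_tprod]
  exact ztPerm_sigmaAssoc fun i j => F i j (Finsupp.single (s i j) 1)

/-- Both sides are the same tensor product of maps applied to `f`. The sign comes from moving the
sign operators of the outer layer `h` through the middle layer `g`. -/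
theorem ezComp_assoc (p : ℤ) (q : I → ℤ) (r : ∀ i, K i → ℤ) {f : EZObj k I}
    {g : ∀ i, EZObj k (K i)} (h : ∀ i j, EZObj k (H i j))
    (hg : ∀ i, g i ∈ ezDeg k (K i) (q i)) :
    ezRelabel k (Equiv.sigmaAssoc H)
      (ezComp k (K := fun s : Σ i, K i => H s.1 s.2) (p + ∑ i, q i) (fun s => r s.1 s.2)
        (ezComp k p q f g) (fun s => h s.1 s.2)) =
      ksign k (∑ i, ∑ i' with i' < i, q i * ∑ j, r i' j) •
        ezComp k p (fun i => q i + ∑ j, r i j) f (fun i => ezComp k (q i) (r i) (g i) (h i)) := by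
  funext n
  set R : I → ℤ := fun i => ∑ i' with i < i', ∑ j, r i' j with hR
  set Q : I → ℤ := fun i => ∑ i' with i < i', q i' with hQ
  -- The sign exponent at `(i, j)` for the lexicographic order splits into the part from the same
  -- block, kept in `G`, and the part `R i` from later blocks.
  let F : ∀ i (j : K i), ZChain k n →ₗ[k] ZTensor k (H i j) n :=
    fun i j => h i j n ∘ₗ zSign k n (∑ j' with j < j', r i j' + R i)
  let G : ∀ i (j : K i), ZChain k n →ₗ[k] ZTensor k (H i j) n :=
    fun i j => h i j n ∘ₗ zSign k n (∑ j' with j < j', r i j')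
  let M : ZTensor k I n →ₗ[k] ZTensor k (Σ i, Σ j, H i j) n :=
    ztFlatten k n ∘ₗ PiTensorProduct.map fun i => ztFlatten k n ∘ₗ (PiTensorProduct.map (G i)) ∘ₗ
      g i n ∘ₗ zSign k n (R i + Q i)
  have h1 : ezRelabel k (Equiv.sigmaAssoc H)
      (ezComp k (K := fun s : Σ i, K i => H s.1 s.2) (p + ∑ i, q i) (fun s => r s.1 s.2)
        (ezComp k p q f g) (fun s => h s.1 s.2)) n =
      (ksign k ((p + ∑ i, q i) * ∑ i, ∑ j, r i j) * ksign k (p * ∑ i, q i)) •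
        ((ztPerm k (Equiv.sigmaAssoc H) n ∘ₗ
          ztFlatten k n (K := fun p : Σ i, K i => H p.1 p.2) ∘ₗ
          (PiTensorProduct.map fun p : Σ i, K i => F p.1 p.2) ∘ₗ ztFlatten k n) ∘ₗ
          PiTensorProduct.map fun i => g i n ∘ₗ zSign k n (Q i)) ∘ₗ f n := by
    rw [ezRelabel_apply, ezComp_apply, ezComp_apply, Fintype.sum_sigma, mul_smul,
      LinearMap.comp_smul, LinearMap.comp_smul, LinearMap.comp_smul, LinearMap.comp_smul]
    have hF : (fun s : Σ i, K i => h s.1 s.2 n ∘ₗ zSign k n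
        (∑ s' : Σ i, K i with (sigmaLexLT.lt s s'), r s'.1 s'.2)) =
        fun s : Σ i, K i => F s.1 s.2 := by
      funext s
      rw [sum_sigma_gt]
    rw [hF]
    simp only [LinearMap.comp_assoc]
    rfl
  have h2 : (PiTensorProduct.map fun i => ztFlatten k n ∘ₗ PiTensorProduct.map (F i)) ∘ₗ
      (PiTensorProduct.map fun i => g i n ∘ₗ zSign k n (Q i)) =
      ksign k (∑ i, R i * q i) • PiTensorProduct.map fun i => ztFlatten k n ∘ₗ
        (PiTensorProduct.map (G i)) ∘ₗ g i n ∘ₗ zSign k n (R i + Q i) := by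
    rw [← PiTensorProduct.map_comp, ksign_sum, ← PiTensorProduct.map_smul_univ]
    congr 1
    funext i
    have hF : PiTensorProduct.map (F i) =
        PiTensorProduct.map (G i) ∘ₗ ztSignPow k (K i) n (R i) := by
      rw [ztSignPow, ← PiTensorProduct.map_comp]
      congr 1
      funext j
      rw [LinearMap.comp_assoc, zSign_comp_zSign]
    rw [hF, LinearMap.comp_assoc, LinearMap.comp_assoc, ← LinearMap.comp_assoc _ (g i n),
      ztSignPow_comp_of_mem (hg i), LinearMap.smul_comp, LinearMap.comp_smul,
      LinearMap.comp_smul, LinearMap.comp_assoc, zSign_comp_zSign]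
  have h3 : ezComp k p (fun i => q i + ∑ j, r i j) f
      (fun i => ezComp k (q i) (r i) (g i) (h i)) n =
      (ksign k (p * ∑ i, (q i + ∑ j, r i j)) * ksign k (∑ i, q i * ∑ j, r i j)) • M ∘ₗ f n := by
    have : (fun i => ezComp k (q i) (r i) (g i) (h i) n ∘ₗ
        zSign k n (∑ i' with i < i', (q i' + ∑ j, r i' j))) =
        fun i => ksign k (q i * ∑ j, r i j) • (ztFlatten k n ∘ₗ (PiTensorProduct.map (G i)) ∘ₗ
          g i n ∘ₗ zSign k n (R i + Q i)) := by
      funext i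
      rw [ezComp_apply, LinearMap.smul_comp, Finset.sum_add_distrib, add_comm (Finset.sum _ _)]
      rfl
    rw [ezComp_apply, mul_smul, this, PiTensorProduct.map_smul_univ, ← ksign_sum,
      LinearMap.smul_comp, LinearMap.comp_smul]
    rfl
  rw [h1, ztPerm_sigmaAssoc_comp, LinearMap.comp_assoc _ _ (ztFlatten k n), h2, Pi.smul_apply, h3,
    LinearMap.comp_smul, LinearMap.smul_comp, smul_smul, smul_smul]
  congr 1
  simp only [← ksign_add]
  -- The two exponents differ by twice `∑ i, R i * q i`.
  refine ksign_congr ⟨∑ i, R i * q i - p * 0, ?_⟩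
  have e1 : (∑ i, q i) * ∑ i, ∑ j, r i j = ∑ i, (q i * ∑ i' with i' < i, ∑ j, r i' j) +
      ∑ i, q i * ∑ j, r i j + ∑ i, R i * q i := by
    rw [Finset.sum_mul, ← Finset.sum_add_distrib, ← Finset.sum_add_distrib]
    refine Finset.sum_congr rfl fun i _ => ?_
    rw [sum_lt_add_sum_gt (fun i => ∑ j, r i j) i]
    ring
  simp only [add_mul, e1, Finset.sum_add_distrib, ← Finset.mul_sum]
  ring

end CompAssoc

/-! ### Equivariance of composition -/

section RelabelComp

variable {I I' : Type} {K : I' → Type} [Fintype I] [LinearOrder I] [Fintype I'] [LinearOrder I']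
  [∀ i, Fintype (K i)] [∀ i, LinearOrder (K i)]

/-- The sign for permuting simplices of dimensions `t` and then applying the `g i` is compared with
the sign for applying them first and permuting results of degrees `q - t`. Only a reversed pair
needs an argument: there the exponents differ by an even number. -/
theorem koszulSign_comp_identity (e : I ≃ I') (q : I' → ℤ) (t : I → ℤ) :
    koszulSign k e t * ∏ i, ksign k ((∑ i' with i < i', q i') * t (e.symm i)) =
      koszulSign k e (fun i => q (e i)) * (koszulSign k e (fun i => q (e i) - t i) *
        ∏ i, ksign k ((∑ i' with i < i', q (e i')) * t i)) := by
  have h1 : ∏ i, ksign k ((∑ i' with i < i', q i') * t (e.symm i)) =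
      ∏ i, ∏ i', if e i < e i' then ksign k (q (e i') * t i) else 1 := by
    rw [← e.prod_comp]
    refine Finset.prod_congr rfl fun i _ => ?_
    rw [Finset.sum_mul, ksign_sum, Finset.prod_filter, ← e.prod_comp]
    simp
  have h2 : ∏ i, ksign k ((∑ i' with i < i', q (e i')) * t i) =
      ∏ i, ∏ i', if i < i' then ksign k (q (e i') * t i) else 1 := by
    refine Finset.prod_congr rfl fun i _ => ?_
    rw [Finset.sum_mul, ksign_sum, Finset.prod_filter]
  rw [h1, h2, koszulSign, koszulSign, koszulSign]
  simp only [← Finset.prod_mul_distrib]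
  refine prod_prod_eq_of_pairs (fun i => by simp) fun i j hij => ?_
  have hne : e i ≠ e j := fun h => hij.ne (e.injective h)
  rcases lt_or_gt_of_ne hne with h | h
  · simp [hij, hij.not_gt, h, h.not_gt]
  · simp only [hij, hij.not_gt, h, h.not_gt, and_self, if_true, if_false, one_mul, mul_one,
      ← ksign_add]
    exact ksign_congr ⟨q (e i) * t j - q (e i) * q (e j), by ring⟩

theorem ezComp_relabel_left (e : I ≃ I') (p : ℤ) (q : I' → ℤ) {f : EZObj k I}
    {g : ∀ i, EZObj k (K i)} (hg : ∀ i, g i ∈ ezDeg k (K i) (q i)) :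
    ezComp k p q (ezRelabel k e f) g =
      koszulSign k e (fun i => q (e i)) •
        ezRelabel k (Equiv.sigmaCongrLeft (β := K) e)
          (ezComp k (K := fun i => K (e i)) p (fun i => q (e i)) f (fun i => g (e i))) := by
  funext n
  have key : (ztFlatten k n ∘ₗ PiTensorProduct.map fun i => g i n ∘ₗ
        zSign k n (∑ i' with i < i', q i')) ∘ₗ ztPerm k e n =
      koszulSign k e (fun i => q (e i)) • ztPerm k (Equiv.sigmaCongrLeft (β := K) e) n ∘ₗ
        ztFlatten k n ∘ₗ PiTensorProduct.map fun i => g (e i) n ∘ₗ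
          zSign k n (∑ i' with i < i', q (e i')) := by
    refine (ztBasis k I n).ext fun t => ?_
    rw [LinearMap.comp_apply, ztPerm_ztBasis, LinearMap.smul_apply, LinearMap.comp_apply,
      LinearMap.comp_apply, map_smul, LinearMap.comp_apply, ztBasis_apply, ztBasis_apply,
      PiTensorProduct.map_tprod, PiTensorProduct.map_tprod]
    simp only [LinearMap.comp_apply, zSign_single_one, map_smul]
    rw [MultilinearMap.map_smul_univ, MultilinearMap.map_smul_univ, map_smul, map_smul, map_smul]
    have hw : ∀ i, g i n (Finsupp.single (t (e.symm i)) (1 : k)) ∈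
        ztDeg k (K i) n (-((t (e.symm i)).1 : ℤ) + q i) :=
      fun i => (hg i).2 n _ _ (single_mem_zDeg _ _)
    have h := ztFlatten_perm_sigmaCongrLeft e hw
    simp only [Equiv.symm_apply_apply] at h
    have hc : ∀ i, -((t i).1 : ℤ) + q (e i) = q (e i) - (t i).1 := fun i => by ring
    simp only [hc] at h
    have hs : (fun i => g (e i) n (Finsupp.single (t i) (1 : k))) =
      fun i => g (e i) n (Finsupp.single (t (e.symm (e i))) (1 : k)) := by simp
    rw [h, smul_smul, smul_smul, smul_smul, koszulSign_comp_identity,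
      mul_comm (koszulSign k e fun i => q (e i) - _), mul_assoc]
  have h1 : ezComp k p q (ezRelabel k e f) g n = ksign k (p * ∑ i, q i) •
      ((ztFlatten k n ∘ₗ PiTensorProduct.map fun i => g i n ∘ₗ
        zSign k n (∑ i' with i < i', q i')) ∘ₗ ztPerm k e n) ∘ₗ f n := rfl
  rw [h1, key, Pi.smul_apply, ezRelabel_apply, ezComp_apply, e.sum_comp, LinearMap.smul_comp,
    LinearMap.comp_smul, smul_comm]
  rfl

theorem ezComp_relabel_right {K K' : I → Type} [∀ i, Fintype (K i)] [∀ i, LinearOrder (K i)]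
    [∀ i, Fintype (K' i)] [∀ i, LinearOrder (K' i)] (e : ∀ i, K i ≃ K' i) (p : ℤ) (q : I → ℤ)
    (f : EZObj k I) (g : ∀ i, EZObj k (K i)) :
    ezComp k p q f (fun i => ezRelabel k (e i) (g i)) =
      ezRelabel k (Equiv.sigmaCongrRight e) (ezComp k p q f g) := by
  funext n
  have h : (PiTensorProduct.map fun i => ezRelabel k (e i) (g i) n ∘ₗ
      zSign k n (∑ i' with i < i', q i')) = (PiTensorProduct.map fun i => ztPerm k (e i) n) ∘ₗ
        PiTensorProduct.map fun i => g i n ∘ₗ zSign k n (∑ i' with i < i', q i') := by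
    rw [← PiTensorProduct.map_comp]
    rfl
  rw [ezRelabel_apply, ezComp_apply, ezComp_apply, LinearMap.comp_smul, h,
    ← LinearMap.comp_assoc _ (ztFlatten k n) (ztPerm k _ n), ztPerm_sigmaCongrRight]
  rfl

end RelabelComp

/-! ### Unit laws -/

section UnitComp

theorem ezUnit_comp {J : Type} [Fintype J] [LinearOrder J] (n : ℤ) (f : EZObj k J) :
    ezRelabel k (Equiv.uniqueSigma (fun _ : Unit => J))
      (ezComp k (K := fun _ : Unit => J) 0 (fun _ => n) (ezUnit k) (fun _ => f)) = f := by
  funext m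
  have h : ∀ w : ZTensor k J m, ztPerm k (Equiv.uniqueSigma (fun _ : Unit => J)) m
      (ztFlatten k m (PiTensorProduct.tprod k fun _ : Unit => w)) = w := by
    intro w
    rw [← PiTensorProduct.subsingletonEquiv_symm_apply' (R := k) () w]
    refine LinearMap.congr_fun (f := ztPerm k (Equiv.uniqueSigma (fun _ : Unit => J)) m ∘ₗ
      ztFlatten k m ∘ₗ (PiTensorProduct.subsingletonEquiv (R := k)
        (s := fun _ : Unit => ZTensor k J m) ()).symm.toLinearMap) (g := LinearMap.id) ?_ w
    refine (ztBasis k J m).ext fun s => ?_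
    rw [LinearMap.comp_apply, LinearMap.comp_apply, LinearEquiv.coe_coe,
      PiTensorProduct.subsingletonEquiv_symm_apply', ztFlatten_basis (K := fun _ : Unit => J)
        fun _ => s, ztPerm_ztBasis, koszulSign_uniqueSigma, one_smul]
    rfl
  refine LinearMap.ext fun z => ?_
  rw [ezRelabel_apply, ezComp_apply, zero_mul, ksign_zero, one_smul]
  simp only [LinearMap.comp_apply, ezUnit_apply, PiTensorProduct.map_tprod]
  have h0 : ∀ u : Unit, ∑ _i' : Unit with u < _i', n = 0 := fun u => by simp
  simp only [h0, zSign_zero, LinearMap.id_apply]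
  exact h _

theorem ezComp_unit {I : Type} [Fintype I] [LinearOrder I] (n : ℤ) (f : EZObj k I) :
    ezRelabel k (Equiv.sigmaPUnit I)
      (ezComp k (K := fun _ : I => Unit) n (fun _ => 0) f (fun _ => ezUnit k)) = f := by
  funext m
  have h : ztPerm k (Equiv.sigmaPUnit.{0} I) m ∘ₗ ztFlatten k m ∘ₗ
      (PiTensorProduct.map fun _ : I => ezUnit k m) = LinearMap.id := by
    refine (ztBasis k I m).ext fun s => ?_
    rw [LinearMap.comp_apply, LinearMap.comp_apply, ztBasis_apply, PiTensorProduct.map_tprod]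
    simp only [ezUnit_apply]
    rw [ztFlatten_tprod k m (K := fun _ : I => Unit) fun i _ => Finsupp.single (s i) 1]
    have := ztPerm_ztBasis (k := k) (Equiv.sigmaPUnit.{0} I) (fun p => s p.1)
    rw [koszulSign_sigmaPUnit, one_smul, ztBasis_apply, ztBasis_apply] at this
    exact this
  rw [ezRelabel_apply, ezComp_apply]
  simp only [Finset.sum_const_zero, mul_zero, ksign_zero, one_smul, zSign_zero, LinearMap.comp_id]
  rw [← LinearMap.comp_assoc (f m), ← LinearMap.comp_assoc (f m), h, LinearMap.id_comp]

end UnitComp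

theorem eilenbergZilber_isDGOperad : (eilenbergZilber k).IsDGOperad where
  d_mem _ _ hx := ezD_mem hx
  d_d _ _ hx := ezD_ezD hx
  unit_mem := ezUnit_mem
  d_unit := ezD_ezUnit
  relabel_mem e _ _ hx := ezRelabel_mem e hx
  d_relabel e _ _ hx := ezD_ezRelabel e hx
  relabel_refl _ x _ := funext fun n => by
    change ztPerm k (Equiv.refl _) n ∘ₗ x n = x n
    rw [ztPerm_refl, LinearMap.id_comp]
  relabel_trans e e' _ x _ := funext fun n => by
    change ztPerm k (e.trans e') n ∘ₗ x n = ztPerm k e' n ∘ₗ ztPerm k e n ∘ₗ x n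
    rw [ztPerm_trans, LinearMap.comp_assoc]
  comp_mem _ _ _ _ hf hg := ezComp_mem hf hg
  d_comp _ _ _ _ hf hg := ezD_ezComp hf hg
  relabel_comp e p q _ _ _ hg := ezComp_relabel_left e p q hg
  comp_relabel e p q f g _ _ := ezComp_relabel_right e p q f g
  comp_assoc p q r _ _ h _ hg _ := ezComp_assoc p q r h hg
  unit_comp n f _ := ezUnit_comp n f
  comp_unit n f _ := ezComp_unit n f

end EilenbergZilberOperad

/-! ## The Lie operad -/

section LieLaws

variable {k : Type u} [Field k]

/-- Both sides are Lie homomorphisms agreeing on generators. Each law of the Lie operad is an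
iterated substitution and follows from this by evaluating on variables. -/
theorem freeLie_lift_lift {X Y Z : Type} (h : Y → FreeLieAlgebra k Z) (h' : X → FreeLieAlgebra k Y)
    (x : FreeLieAlgebra k X) :
    FreeLieAlgebra.lift k h (FreeLieAlgebra.lift k h' x) =
      FreeLieAlgebra.lift k (fun i => FreeLieAlgebra.lift k h (h' i)) x := by
  have : (FreeLieAlgebra.lift k h).comp (FreeLieAlgebra.lift k h') =
      FreeLieAlgebra.lift k (fun i => FreeLieAlgebra.lift k h (h' i)) := by
    refine FreeLieAlgebra.hom_ext ?_
    intro i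
    simp
  exact LieHom.congr_fun this x

theorem freeLie_lift_of {X : Type} (x : FreeLieAlgebra k X) :
    FreeLieAlgebra.lift k (FreeLieAlgebra.of k) x = x := by
  have : FreeLieAlgebra.lift k (FreeLieAlgebra.of k) = (LieHom.id : FreeLieAlgebra k X →ₗ⁅k⁆ _) := by
    refine FreeLieAlgebra.hom_ext ?_
    intro i
    simp
  exact LieHom.congr_fun this x

theorem coe_lieRelabel {I J : Type} (e : I ≃ J) (ψ : LieOp k I) :
    (lieRelabel e ψ : FreeLieAlgebra k J) =
      FreeLieAlgebra.lift k (fun i => FreeLieAlgebra.of k (e i)) (ψ : FreeLieAlgebra k I) := rfl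

theorem coe_lieComp {I : Type} {K : I → Type} (ψ : LieOp k I) (χ : ∀ i, LieOp k (K i)) :
    (lieComp ψ χ : FreeLieAlgebra k (Σ i, K i)) =
      FreeLieAlgebra.lift k (fun i => FreeLieAlgebra.lift k
        (fun j => FreeLieAlgebra.of k (⟨i, j⟩ : Σ i, K i)) (χ i : FreeLieAlgebra k (K i)))
        (ψ : FreeLieAlgebra k I) := rfl

theorem coe_lieUnit : ((lieUnit : LieOp k Unit) : FreeLieAlgebra k Unit) =
    FreeLieAlgebra.of k () := rfl

theorem lieRelabel_refl {I : Type} (ψ : LieOp k I) : lieRelabel (Equiv.refl I) ψ = ψ :=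
  Subtype.ext (freeLie_lift_of _)

theorem lieRelabel_trans {I J H : Type} (e : I ≃ J) (e' : J ≃ H) (ψ : LieOp k I) :
    lieRelabel (e.trans e') ψ = lieRelabel e' (lieRelabel e ψ) := by
  apply Subtype.ext
  simp only [coe_lieRelabel, freeLie_lift_lift, FreeLieAlgebra.lift_of_apply, Equiv.trans_apply]

theorem lieComp_relabel_left {I I' : Type} {K : I' → Type} (e : I ≃ I') (ψ : LieOp k I)
    (χ : ∀ i, LieOp k (K i)) :
    lieComp (lieRelabel e ψ) χ = lieRelabel (Equiv.sigmaCongrLeft (β := K) e)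
      (lieComp (K := fun i => K (e i)) ψ fun i => χ (e i)) := by
  apply Subtype.ext
  simp only [coe_lieRelabel, coe_lieComp, freeLie_lift_lift, FreeLieAlgebra.lift_of_apply]
  rfl

theorem lieComp_relabel_right {I : Type} {K K' : I → Type} (e : ∀ i, K i ≃ K' i) (ψ : LieOp k I)
    (χ : ∀ i, LieOp k (K i)) :
    lieComp ψ (fun i => lieRelabel (e i) (χ i)) =
      lieRelabel (Equiv.sigmaCongrRight e) (lieComp ψ χ) := by
  apply Subtype.ext
  simp only [coe_lieRelabel, coe_lieComp, freeLie_lift_lift, FreeLieAlgebra.lift_of_apply]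
  rfl

theorem lieComp_assoc {I : Type} {K : I → Type} {H : (i : I) → K i → Type} (ψ : LieOp k I)
    (χ : ∀ i, LieOp k (K i)) (ω : ∀ i j, LieOp k (H i j)) :
    lieRelabel (Equiv.sigmaAssoc H)
      (lieComp (K := fun s : Σ i, K i => H s.1 s.2) (lieComp ψ χ) fun s => ω s.1 s.2) =
      lieComp ψ fun i => lieComp (χ i) (ω i) := by
  apply Subtype.ext
  simp only [coe_lieRelabel, coe_lieComp, freeLie_lift_lift, FreeLieAlgebra.lift_of_apply]
  rfl

theorem lieUnit_comp {J : Type} (ψ : LieOp k J) :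
    lieRelabel (Equiv.uniqueSigma fun _ : Unit => J)
      (lieComp (K := fun _ : Unit => J) lieUnit fun _ => ψ) = ψ := by
  apply Subtype.ext
  simp only [coe_lieRelabel, coe_lieComp, coe_lieUnit, freeLie_lift_lift,
    FreeLieAlgebra.lift_of_apply]
  exact freeLie_lift_of _

theorem lieComp_unit {I : Type} (ψ : LieOp k I) :
    lieRelabel (Equiv.sigmaPUnit I) (lieComp (K := fun _ : I => Unit) ψ fun _ => lieUnit) = ψ := by
  apply Subtype.ext
  simp only [coe_lieRelabel, coe_lieComp, coe_lieUnit, freeLie_lift_lift,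
    FreeLieAlgebra.lift_of_apply]
  exact freeLie_lift_of _

end LieLaws

/-! ## Truncation -/

namespace DGOperadData

variable {k : Type u} [Field k] {L : DGOperadData.{u, v} k}

section

variable (L) (I : Type) [Fintype I] [LinearOrder I] [Nonempty I] (n : ℤ)

/-- The component of degree `n` of `τ_{≤ 0} L(I)`, as a subspace of `L.obj I`. -/
def truncDeg : Submodule k (L.obj I) :=
  if n < 0 then L.deg I n else if n = 0 then L.deg I 0 ⊓ LinearMap.ker (L.d I) else ⊥

end

section

variable {I : Type} [Fintype I] [LinearOrder I] [Nonempty I] {n : ℤ} {x : L.obj I}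

theorem mem_deg_of_mem_truncDeg (hx : x ∈ L.truncDeg I n) : x ∈ L.deg I n := by
  unfold truncDeg at hx
  split_ifs at hx with h1 h2
  · exact hx
  · subst h2
    exact hx.1
  · rw [(Submodule.mem_bot k).1 hx]
    exact zero_mem _

theorem mem_truncDeg (hn : n ≤ 0) (hx : x ∈ L.deg I n) (h0 : n = 0 → L.d I x = 0) :
    x ∈ L.truncDeg I n := by
  unfold truncDeg
  split_ifs with h1 h2
  · exact hx
  · subst h2
    exact ⟨hx, h0 rfl⟩
  · omega

theorem eq_zero_of_mem_truncDeg (hn : 0 < n) (hx : x ∈ L.truncDeg I n) : x = 0 := by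
  rwa [truncDeg, if_neg hn.not_gt, if_neg hn.ne', Submodule.mem_bot] at hx

theorem d_eq_zero_of_mem_truncDeg (hx : x ∈ L.truncDeg I 0) : L.d I x = 0 := by
  rw [truncDeg, if_neg (lt_irrefl _), if_pos rfl] at hx
  exact hx.2

theorem IsDGOperad.d_mem_truncDeg (hL : L.IsDGOperad) (hx : x ∈ L.truncDeg I n) :
    L.d I x ∈ L.truncDeg I (n + 1) := by
  rcases lt_trichotomy n 0 with h | rfl | h
  · exact mem_truncDeg (by omega) (hL.d_mem n x (mem_deg_of_mem_truncDeg hx))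
      fun _ => hL.d_d n x (mem_deg_of_mem_truncDeg hx)
  · rw [d_eq_zero_of_mem_truncDeg hx]
    exact zero_mem _
  · rw [eq_zero_of_mem_truncDeg h hx, map_zero]
    exact zero_mem _

theorem IsDGOperad.relabel_mem_truncDeg (hL : L.IsDGOperad) {J : Type} [Fintype J] [LinearOrder J]
    [Nonempty J] (e : I ≃ J) (hx : x ∈ L.truncDeg I n) : L.relabel e x ∈ L.truncDeg J n := by
  rcases lt_or_ge 0 n with h | h
  · rw [eq_zero_of_mem_truncDeg h hx, map_zero]
    exact zero_mem _
  · refine mem_truncDeg h (hL.relabel_mem e n x (mem_deg_of_mem_truncDeg hx)) ?_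
    rintro rfl
    rw [hL.d_relabel e 0 x (mem_deg_of_mem_truncDeg hx), d_eq_zero_of_mem_truncDeg hx, map_zero]

/-- An entry of positive degree is zero. Otherwise all degrees are at most `0`, so a composition of
degree `0` has all entries of degree `0`; these are cocycles, and the Leibniz rule makes the
composition one. -/
theorem IsDGOperad.comp_mem_truncDeg (hL : L.IsDGOperad) {K : I → Type} [∀ i, Fintype (K i)]
    [∀ i, LinearOrder (K i)] [∀ i, Nonempty (K i)] (p : ℤ) (q : I → ℤ) (f : L.obj I)
    (g : ∀ i, L.obj (K i)) (hf : f ∈ L.truncDeg I p) (hg : ∀ i, g i ∈ L.truncDeg (K i) (q i)) :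
    L.comp p q f g ∈ L.truncDeg (Σ i, K i) (p + ∑ i, q i) := by
  rcases lt_or_ge 0 p with h | hp
  · rw [eq_zero_of_mem_truncDeg h hf, map_zero]
    exact zero_mem _
  by_cases hq : ∃ i, 0 < q i
  · obtain ⟨i, hi⟩ := hq
    rw [(L.comp p q f).map_coord_zero i (eq_zero_of_mem_truncDeg hi (hg i))]
    exact zero_mem _
  have hq : ∀ i, q i ≤ 0 := fun i => not_lt.1 fun h => hq ⟨i, h⟩
  have hf' := mem_deg_of_mem_truncDeg hf
  have hg' := fun i => mem_deg_of_mem_truncDeg (hg i)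
  have hs : ∑ i, q i ≤ 0 := Finset.sum_nonpos fun i _ => hq i
  refine mem_truncDeg (add_nonpos hp hs) (hL.comp_mem p q f g hf' hg') fun h => ?_
  obtain rfl : p = 0 := by omega
  have hq0 : ∀ i, q i = 0 := fun i =>
    (Finset.sum_eq_zero_iff_of_nonpos fun i _ => hq i).1 (by omega) i (Finset.mem_univ i)
  have hgd : ∀ i, L.d (K i) (g i) = 0 := fun i =>
    d_eq_zero_of_mem_truncDeg (by rw [← hq0 i]; exact hg i)
  rw [hL.d_comp 0 q f g hf' hg', d_eq_zero_of_mem_truncDeg hf, map_zero]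
  refine (zero_add _).trans (Finset.sum_eq_zero fun i _ => ?_)
  rw [(L.comp 0 _ f).map_coord_zero i (by rw [Function.update_self, hgd]), smul_zero]

end

theorem truncLEZero_deg_le (I : Type) [Fintype I] [LinearOrder I] [Nonempty I] (n : ℤ) :
    L.truncLEZero.deg I n ≤ L.deg I n :=
  fun _ hx => mem_deg_of_mem_truncDeg hx

theorem IsDGOperad.truncLEZero (hL : L.IsDGOperad) : L.truncLEZero.IsDGOperad where
  d_mem n x hx := hL.d_mem_truncDeg hx
  d_d n x hx := hL.d_d n x (truncLEZero_deg_le _ n hx)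
  unit_mem := mem_truncDeg le_rfl hL.unit_mem fun _ => hL.d_unit
  d_unit := hL.d_unit
  relabel_mem e n x hx := hL.relabel_mem_truncDeg e hx
  d_relabel e n x hx := hL.d_relabel e n x (truncLEZero_deg_le _ n hx)
  relabel_refl n x hx := hL.relabel_refl n x (truncLEZero_deg_le _ n hx)
  relabel_trans e e' n x hx := hL.relabel_trans e e' n x (truncLEZero_deg_le _ n hx)
  comp_mem p q f g hf hg := hL.comp_mem_truncDeg p q f g hf hg
  d_comp p q f g hf hg := hL.d_comp p q f g (truncLEZero_deg_le _ p hf)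
    fun i => truncLEZero_deg_le _ (q i) (hg i)
  relabel_comp e p q f g hf hg := hL.relabel_comp e p q f g (truncLEZero_deg_le _ p hf)
    fun i => truncLEZero_deg_le _ (q i) (hg i)
  comp_relabel e p q f g hf hg := hL.comp_relabel e p q f g (truncLEZero_deg_le _ p hf)
    fun i => truncLEZero_deg_le _ (q i) (hg i)
  comp_assoc p q r f g h hf hg hh := hL.comp_assoc p q r f g h (truncLEZero_deg_le _ p hf)
    (fun i => truncLEZero_deg_le _ (q i) (hg i)) fun i j => truncLEZero_deg_le _ (r i j) (hh i j)
  unit_comp n f hf := hL.unit_comp n f (truncLEZero_deg_le _ n hf)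
  comp_unit n f hf := hL.comp_unit n f (truncLEZero_deg_le _ n hf)

end DGOperadData

/-! ## The Lie Eilenberg-Zilber operad -/

section LieEZLaws

variable (k : Type u) [Field k]

/-- The component of degree `n` of `𝒴(I)`. -/
noncomputable abbrev lieEZDeg (I : Type) [Fintype I] (n : ℤ) : Submodule k (EZObj k I ⊗[k] LieOp k I) :=
  LinearMap.range (TensorProduct.map (ezDeg k I n).subtype (LinearMap.id (M := LieOp k I)))

/-- The pure tensors of degree `n` in `𝒴(I)`. -/
noncomputable def lieEZPure (I : Type) [Fintype I] (n : ℤ) : Set (EZObj k I ⊗[k] LieOp k I) :=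
  {x | ∃ φ ∈ ezDeg k I n, ∃ ψ : LieOp k I, x = φ ⊗ₜ ψ}

variable {k}

theorem lieEZDeg_eq_span (I : Type) [Fintype I] (n : ℤ) :
    lieEZDeg k I n = Submodule.span k (lieEZPure k I n) := by
  rw [lieEZDeg, TensorProduct.range_map_eq_span_tmul]
  congr 1
  ext x
  constructor
  · rintro ⟨φ, ψ, rfl⟩
    exact ⟨φ, φ.2, ψ, rfl⟩
  · rintro ⟨φ, hφ, ψ, rfl⟩
    exact ⟨⟨φ, hφ⟩, ψ, rfl⟩

theorem tmul_mem_lieEZDeg {I : Type} [Fintype I] {n : ℤ} {φ : EZObj k I} (hφ : φ ∈ ezDeg k I n)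
    (ψ : LieOp k I) : φ ⊗ₜ[k] ψ ∈ lieEZDeg k I n :=
  ⟨⟨φ, hφ⟩ ⊗ₜ ψ, rfl⟩

/-- Linear maps agreeing on the pure tensors of degree `n` agree on all elements of degree `n`. -/
theorem eq_of_mem_lieEZDeg {I : Type} [Fintype I] {n : ℤ} {M : Type*} [AddCommMonoid M] [Module k M]
    {f g : EZObj k I ⊗[k] LieOp k I →ₗ[k] M}
    (h : ∀ φ ∈ ezDeg k I n, ∀ ψ : LieOp k I, f (φ ⊗ₜ ψ) = g (φ ⊗ₜ ψ))
    {x : EZObj k I ⊗[k] LieOp k I} (hx : x ∈ lieEZDeg k I n) : f x = g x := by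
  rw [lieEZDeg_eq_span] at hx
  refine LinearMap.eqOn_span ?_ hx
  rintro _ ⟨φ, hφ, ψ, rfl⟩
  exact h φ hφ ψ

theorem mem_of_mem_lieEZDeg {I : Type} [Fintype I] {n : ℤ} {M : Type*} [AddCommMonoid M]
    [Module k M] (f : EZObj k I ⊗[k] LieOp k I →ₗ[k] M) (p : Submodule k M)
    (h : ∀ φ ∈ ezDeg k I n, ∀ ψ : LieOp k I, f (φ ⊗ₜ ψ) ∈ p)
    {x : EZObj k I ⊗[k] LieOp k I} (hx : x ∈ lieEZDeg k I n) : f x ∈ p := by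
  rw [lieEZDeg_eq_span] at hx
  refine (Submodule.span_le (p := p.comap f)).2 ?_ hx
  rintro _ ⟨φ, hφ, ψ, rfl⟩
  exact h φ hφ ψ

/-- Multilinear maps agreeing on the families of pure tensors of degrees `n i` agree on all
families of elements of degrees `n i`. -/
theorem eq_of_forall_mem_lieEZDeg {T : Type} [Finite T] {I : T → Type} [∀ i, Fintype (I i)]
    {n : T → ℤ} {M : Type*} [AddCommMonoid M] [Module k M]
    {f g : MultilinearMap k (fun i => EZObj k (I i) ⊗[k] LieOp k (I i)) M}
    (h : ∀ (φ : ∀ i, EZObj k (I i)) (ψ : ∀ i, LieOp k (I i)), (∀ i, φ i ∈ ezDeg k (I i) (n i)) →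
      f (fun i => φ i ⊗ₜ ψ i) = g (fun i => φ i ⊗ₜ ψ i))
    {x : ∀ i, EZObj k (I i) ⊗[k] LieOp k (I i)} (hx : ∀ i, x i ∈ lieEZDeg k (I i) (n i)) :
    f x = g x := by
  refine MultilinearMap.eq_of_mem_span (S := fun i => lieEZPure k (I i) (n i)) ?_
    fun i => by rw [← lieEZDeg_eq_span]; exact hx i
  intro m hm
  choose φ hφ ψ hm using hm
  obtain rfl : m = fun i => φ i ⊗ₜ ψ i := funext hm
  exact h φ ψ hφ

theorem mem_of_forall_mem_lieEZDeg {T : Type} [Finite T] {I : T → Type} [∀ i, Fintype (I i)]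
    {n : T → ℤ} {M : Type*} [AddCommGroup M] [Module k M]
    (f : MultilinearMap k (fun i => EZObj k (I i) ⊗[k] LieOp k (I i)) M) (p : Submodule k M)
    (h : ∀ (φ : ∀ i, EZObj k (I i)) (ψ : ∀ i, LieOp k (I i)), (∀ i, φ i ∈ ezDeg k (I i) (n i)) →
      f (fun i => φ i ⊗ₜ ψ i) ∈ p)
    {x : ∀ i, EZObj k (I i) ⊗[k] LieOp k (I i)} (hx : ∀ i, x i ∈ lieEZDeg k (I i) (n i)) :
    f x ∈ p := by
  refine MultilinearMap.mem_of_mem_span f p (S := fun i => lieEZPure k (I i) (n i)) ?_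
    fun i => by rw [← lieEZDeg_eq_span]; exact hx i
  intro m hm
  choose φ hφ ψ hm using hm
  obtain rfl : m = fun i => φ i ⊗ₜ ψ i := funext hm
  exact h φ ψ hφ

theorem lieEZComp_tmul {I : Type} {K : I → Type} [Fintype I] [LinearOrder I] [∀ i, Fintype (K i)]
    (p : ℤ) (q : I → ℤ) (φ : EZObj k I) (ψ : LieOp k I) (φ' : ∀ i, EZObj k (K i))
    (ψ' : ∀ i, LieOp k (K i)) :
    lieEZComp k p q (φ ⊗ₜ ψ) (fun i => φ' i ⊗ₜ ψ' i) =
      ezComp k p q φ φ' ⊗ₜ lieComp ψ ψ' := by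
  rw [lieEZComp, TensorProduct.lift.tmul, LinearMap.mk₂_apply, multilinearTensor_tmul]

theorem ezD_rTensor_tmul {I : Type} [Fintype I] [LinearOrder I] (φ : EZObj k I) (ψ : LieOp k I) :
    (ezD k I).rTensor (LieOp k I) (φ ⊗ₜ ψ) = ezD k I φ ⊗ₜ ψ := rfl

theorem update_tmul {T : Type} [DecidableEq T] {I : T → Type} (φ : ∀ i, EZObj k (I i))
    (ψ : ∀ i, LieOp k (I i)) (i : T) (φ' : EZObj k (I i)) :
    Function.update (fun i => φ i ⊗ₜ[k] ψ i) i (φ' ⊗ₜ ψ i) =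
      fun j => Function.update φ i φ' j ⊗ₜ ψ j := by
  funext j
  by_cases h : j = i
  · subst h; simp
  · simp [h]

section Multilinear

variable {T : Type} {M : T → Type*} {N : Type*}
  [∀ i, AddCommMonoid (M i)] [∀ i, Module k (M i)] [AddCommMonoid N] [Module k N]

/-- Evaluation of multilinear maps, as a linear map. -/
def MultilinearMap.evalLinear (m : ∀ i, M i) : MultilinearMap k M N →ₗ[k] N where
  toFun f := f m
  map_add' _ _ := rfl
  map_smul' _ _ := rfl

theorem MultilinearMap.evalLinear_apply (m : ∀ i, M i) (f : MultilinearMap k M N) :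
    MultilinearMap.evalLinear m f = f m := rfl

/-- Applying the linear map `d` to the argument number `i` of a multilinear map. -/
theorem exists_multilinearMap_update [DecidableEq T]
    (f : MultilinearMap k M N) (i : T) (d : M i →ₗ[k] M i) :
    ∃ g : MultilinearMap k M N, ∀ m, g m = f (Function.update m i (d (m i))) := by
  refine ⟨f.compLinearMap (Function.update (fun _ => LinearMap.id) i d), fun m => ?_⟩
  rw [MultilinearMap.compLinearMap_apply]
  congr 1
  funext j
  by_cases h : j = i
  · subst h; simp
  · simp [h]

/-- Reindexing the arguments of a multilinear map. -/
theorem exists_multilinearMap_reindex {T' : Type} (e : T' ≃ T)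
    (f : MultilinearMap k (fun i => M (e i)) N) :
    ∃ g : MultilinearMap k M N, ∀ m, g m = f fun i => m (e i) := by
  classical
  have key : ∀ (m : ∀ i, M i) (j : T') (x : M (e j)),
      (fun i => Function.update m (e j) x (e i)) = Function.update (fun i => m (e i)) j x :=
    fun m j x => Function.update_comp_eq_of_injective' m e.injective j x
  refine ⟨⟨fun m => f fun i => m (e i), ?_, ?_⟩, fun _ => rfl⟩
  · intro inst m i x y
    obtain rfl : inst = Classical.decEq _ := Subsingleton.elim _ _
    obtain ⟨j, rfl⟩ := e.surjective i
    have := f.map_update_add (fun i => m (e i)) j x y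
    rwa [← key, ← key, ← key] at this
  · intro inst m i c x
    obtain rfl : inst = Classical.decEq _ := Subsingleton.elim _ _
    obtain ⟨j, rfl⟩ := e.surjective i
    have := f.map_update_smul (fun i => m (e i)) j c x
    rwa [← key, ← key] at this

end Multilinear

section Laws

variable {I : Type} {K : I → Type} [Fintype I] [LinearOrder I] [∀ i, Fintype (K i)]
  [∀ i, LinearOrder (K i)]

omit [∀ i, LinearOrder (K i)] in
theorem lieEZComp_mem {p : ℤ} {q : I → ℤ} {f : EZObj k I ⊗[k] LieOp k I}
    {g : ∀ i, EZObj k (K i) ⊗[k] LieOp k (K i)} (hf : f ∈ lieEZDeg k I p)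
    (hg : ∀ i, g i ∈ lieEZDeg k (K i) (q i)) :
    lieEZComp k p q f g ∈ lieEZDeg k (Σ i, K i) (p + ∑ i, q i) := by
  refine mem_of_forall_mem_lieEZDeg (M := EZObj k (Σ i, K i) ⊗[k] LieOp k (Σ i, K i))
    (lieEZComp k p q f)
    (lieEZDeg k (Σ i, K i) (p + ∑ i, q i)) (fun φ' ψ' hφ' => ?_) hg
  refine mem_of_mem_lieEZDeg (MultilinearMap.evalLinear (k := k)
    (N := EZObj k (Σ i, K i) ⊗[k] LieOp k (Σ i, K i)) (fun i => φ' i ⊗ₜ[k] ψ' i) ∘ₗ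
      lieEZComp k p q) _ (fun φ hφ ψ => ?_) hf
  rw [LinearMap.comp_apply, MultilinearMap.evalLinear_apply, lieEZComp_tmul]
  exact tmul_mem_lieEZDeg (ezComp_mem hφ hφ') _

/-- As for the other laws, both sides are multilinear in the `g i` and linear in `f`, so pure
tensors suffice; there the Lie factor is the same in all terms and the Leibniz rule of `𝒵` applies.
-/
theorem lieEZ_d_comp {p : ℤ} {q : I → ℤ} {f : EZObj k I ⊗[k] LieOp k I}
    {g : ∀ i, EZObj k (K i) ⊗[k] LieOp k (K i)} (hf : f ∈ lieEZDeg k I p)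
    (hg : ∀ i, g i ∈ lieEZDeg k (K i) (q i)) :
    (ezD k (Σ i, K i)).rTensor (LieOp k (Σ i, K i)) (lieEZComp k p q f g) =
      lieEZComp k (p + 1) q ((ezD k I).rTensor (LieOp k I) f) g +
        ∑ i, ksign k (p + ∑ i' with i' < i, q i') •
          lieEZComp k p (Function.update q i (q i + 1)) f
            (Function.update g i ((ezD k (K i)).rTensor (LieOp k (K i)) (g i))) := by
  -- The term with `d (g i)` has to be a multilinear map in `g` before the reduction to pure tensors
  -- can be applied.
  choose G hG using fun i : I => exists_multilinearMap_update
    (M := fun i => EZObj k (K i) ⊗[k] LieOp k (K i)) (lieEZComp k p (Function.update q i (q i + 1)) f) i ((ezD k (K i)).rTensor (LieOp k (K i)))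
  have h := eq_of_forall_mem_lieEZDeg
    (f := ((ezD k (Σ i, K i)).rTensor (LieOp k (Σ i, K i))).compMultilinearMap
      (lieEZComp k p q f))
    (g := lieEZComp k (p + 1) q ((ezD k I).rTensor (LieOp k I) f) +
      ∑ i, ksign k (p + ∑ i' with i' < i, q i') • G i) ?_ hg
  · simpa only [LinearMap.compMultilinearMap_apply, add_apply,
      sum_apply, smul_apply, hG] using h
  intro φ' ψ' hφ'
  simp only [LinearMap.compMultilinearMap_apply, add_apply,
      sum_apply, smul_apply, hG, ezD_rTensor_tmul, update_tmul]
  have h := eq_of_mem_lieEZDeg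
    (f := (ezD k (Σ i, K i)).rTensor (LieOp k (Σ i, K i)) ∘ₗ
      MultilinearMap.evalLinear (fun i => φ' i ⊗ₜ[k] ψ' i) ∘ₗ lieEZComp k p q)
    (g := MultilinearMap.evalLinear (fun i => φ' i ⊗ₜ[k] ψ' i) ∘ₗ lieEZComp k (p + 1) q ∘ₗ
      (ezD k I).rTensor (LieOp k I) + ∑ i, ksign k (p + ∑ i' with i' < i, q i') •
        (MultilinearMap.evalLinear (fun j => Function.update φ' i (ezD k (K i) (φ' i)) j ⊗ₜ[k] ψ' j)
          ∘ₗ lieEZComp k p (Function.update q i (q i + 1)))) ?_ hf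
  · simpa only [LinearMap.add_apply, LinearMap.comp_apply, MultilinearMap.evalLinear_apply,
      LinearMap.sum_apply, LinearMap.smul_apply] using h
  intro φ hφ ψ
  simp only [LinearMap.add_apply, LinearMap.comp_apply, MultilinearMap.evalLinear_apply,
      LinearMap.sum_apply, LinearMap.smul_apply, ezD_rTensor_tmul, lieEZComp_tmul]
  rw [ezD_ezComp hφ hφ', TensorProduct.add_tmul, TensorProduct.sum_tmul]
  rfl

theorem lieEZ_relabel_comp {I' : Type} {K : I' → Type} [Fintype I'] [LinearOrder I']
    [∀ i, Fintype (K i)] [∀ i, LinearOrder (K i)] (e : I ≃ I') {p : ℤ} {q : I' → ℤ}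
    {f : EZObj k I ⊗[k] LieOp k I} {g : ∀ i, EZObj k (K i) ⊗[k] LieOp k (K i)}
    (hf : f ∈ lieEZDeg k I p) (hg : ∀ i, g i ∈ lieEZDeg k (K i) (q i)) :
    lieEZComp k p q (TensorProduct.map (ezRelabel k e) (lieRelabel e) f) g =
      koszulSign k e (fun i => q (e i)) •
        TensorProduct.map (ezRelabel k (Equiv.sigmaCongrLeft (β := K) e))
          (lieRelabel (Equiv.sigmaCongrLeft (β := K) e))
          (lieEZComp k (K := fun i => K (e i)) p (fun i => q (e i)) f (fun i => g (e i))) := by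
  obtain ⟨G, hG⟩ := exists_multilinearMap_reindex (k := k)
    (M := fun i => EZObj k (K i) ⊗[k] LieOp k (K i))
    (N := EZObj k (Σ i, K (e i)) ⊗[k] LieOp k (Σ i, K (e i))) e
    (lieEZComp k (K := fun i => K (e i)) p (fun i => q (e i)) f)
  have h := eq_of_forall_mem_lieEZDeg
    (f := lieEZComp k p q (TensorProduct.map (ezRelabel k e) (lieRelabel e) f))
    (g := koszulSign k e (fun i => q (e i)) •
      (TensorProduct.map (ezRelabel k (Equiv.sigmaCongrLeft (β := K) e))
          (lieRelabel (Equiv.sigmaCongrLeft (β := K) e))).compMultilinearMap G) ?_ hg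
  · simpa only [LinearMap.compMultilinearMap_apply, smul_apply, hG] using h
  intro φ' ψ' hφ'
  simp only [LinearMap.compMultilinearMap_apply, smul_apply, hG]
  have h := eq_of_mem_lieEZDeg
    (f := MultilinearMap.evalLinear (fun i => φ' i ⊗ₜ[k] ψ' i) ∘ₗ lieEZComp k p q ∘ₗ
      TensorProduct.map (ezRelabel k e) (lieRelabel e))
    (g := koszulSign k e (fun i => q (e i)) •
      (TensorProduct.map (ezRelabel k (Equiv.sigmaCongrLeft (β := K) e))
          (lieRelabel (Equiv.sigmaCongrLeft (β := K) e)) ∘ₗ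
        MultilinearMap.evalLinear (fun i => φ' (e i) ⊗ₜ[k] ψ' (e i)) ∘ₗ
          lieEZComp k (K := fun i => K (e i)) p (fun i => q (e i)))) ?_ hf
  · simpa only [LinearMap.comp_apply, MultilinearMap.evalLinear_apply, LinearMap.smul_apply] using h
  intro φ hφ ψ
  simp only [LinearMap.comp_apply, MultilinearMap.evalLinear_apply, LinearMap.smul_apply,
    TensorProduct.map_tmul, lieEZComp_tmul, ezComp_relabel_left e p q hφ', lieComp_relabel_left]
  rfl

theorem lieEZ_comp_relabel {K' : I → Type} [∀ i, Fintype (K' i)] [∀ i, LinearOrder (K' i)]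
    (e : ∀ i, K i ≃ K' i) {p : ℤ} {q : I → ℤ} {f : EZObj k I ⊗[k] LieOp k I}
    {g : ∀ i, EZObj k (K i) ⊗[k] LieOp k (K i)} (hf : f ∈ lieEZDeg k I p)
    (hg : ∀ i, g i ∈ lieEZDeg k (K i) (q i)) :
    lieEZComp k p q f
        (fun i => TensorProduct.map (ezRelabel k (e i)) (lieRelabel (e i)) (g i)) =
      TensorProduct.map (ezRelabel k (Equiv.sigmaCongrRight e))
        (lieRelabel (Equiv.sigmaCongrRight e)) (lieEZComp k p q f g) := by
  refine eq_of_forall_mem_lieEZDeg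
    (f := (lieEZComp k p q f).compLinearMap fun i =>
      TensorProduct.map (ezRelabel k (e i)) (lieRelabel (e i)))
    (g := (TensorProduct.map (ezRelabel k (Equiv.sigmaCongrRight e))
        (lieRelabel (Equiv.sigmaCongrRight e))).compMultilinearMap (lieEZComp k p q f)) ?_ hg
  intro φ' ψ' hφ'
  simp only [LinearMap.compMultilinearMap_apply, MultilinearMap.compLinearMap_apply,
    TensorProduct.map_tmul]
  refine eq_of_mem_lieEZDeg
    (f := MultilinearMap.evalLinear (fun i => ezRelabel k (e i) (φ' i) ⊗ₜ[k]
      lieRelabel (e i) (ψ' i)) ∘ₗ lieEZComp k p q)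
    (g := TensorProduct.map (ezRelabel k (Equiv.sigmaCongrRight e))
        (lieRelabel (Equiv.sigmaCongrRight e)) ∘ₗ
      MultilinearMap.evalLinear (fun i => φ' i ⊗ₜ[k] ψ' i) ∘ₗ lieEZComp k p q) ?_ hf
  intro φ hφ ψ
  simp only [LinearMap.comp_apply, MultilinearMap.evalLinear_apply, TensorProduct.map_tmul,
    lieEZComp_tmul, ezComp_relabel_right, lieComp_relabel_right]

/-- The reduction to pure tensors is made in `h`, then in `g`, then in `f`; on pure tensors the law
is the tensor product of associativity in `𝒵` and in `Lie`. -/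
theorem lieEZ_comp_assoc {H : (i : I) → K i → Type} [∀ i j, Fintype (H i j)]
    [∀ i j, LinearOrder (H i j)] {p : ℤ} {q : I → ℤ} {r : ∀ i, K i → ℤ}
    {f : EZObj k I ⊗[k] LieOp k I} {g : ∀ i, EZObj k (K i) ⊗[k] LieOp k (K i)}
    {h : ∀ i j, EZObj k (H i j) ⊗[k] LieOp k (H i j)} (hf : f ∈ lieEZDeg k I p)
    (hg : ∀ i, g i ∈ lieEZDeg k (K i) (q i)) (hh : ∀ i j, h i j ∈ lieEZDeg k (H i j) (r i j)) :
    TensorProduct.map (ezRelabel k (Equiv.sigmaAssoc H)) (lieRelabel (Equiv.sigmaAssoc H))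
      (lieEZComp k (K := fun s : Σ i, K i => H s.1 s.2) (p + ∑ i, q i) (fun s => r s.1 s.2)
        (lieEZComp k p q f g) (fun s => h s.1 s.2)) =
      ksign k (∑ i, ∑ i' with i' < i, q i * ∑ j, r i' j) •
        lieEZComp k p (fun i => q i + ∑ j, r i j) f
          (fun i => lieEZComp k (q i) (r i) (g i) (h i)) := by
  set A := TensorProduct.map (ezRelabel k (Equiv.sigmaAssoc H)) (lieRelabel (Equiv.sigmaAssoc H))
  set B := lieEZComp k (K := fun s : Σ i, K i => H s.1 s.2) (p + ∑ i, q i) (fun s => r s.1 s.2)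
    with hB
  set c := ksign k (∑ i, ∑ i' with i' < i, q i * ∑ j, r i' j) with hc
  have e1 := eq_of_forall_mem_lieEZDeg (T := Σ i, K i) (I := fun s => H s.1 s.2)
    (n := fun s => r s.1 s.2) (x := fun s => h s.1 s.2)
    (f := A.compMultilinearMap (B (lieEZComp k p q f g)))
    (g := c • (lieEZComp k p (fun i => q i + ∑ j, r i j) f).compMultilinearMap
      (N := fun i j => EZObj k (H i j) ⊗[k] LieOp k (H i j))
      fun i => lieEZComp k (K := H i) (q i) (r i) (g i)) ?_ (fun s => hh s.1 s.2)
  · exact e1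
  intro φ'' ψ'' hφ''
  have e2 := eq_of_forall_mem_lieEZDeg (T := I) (x := g) (n := q)
    (f := (A ∘ₗ MultilinearMap.evalLinear (fun s => φ'' s ⊗ₜ[k] ψ'' s) ∘ₗ B).compMultilinearMap
      (lieEZComp k p q f))
    (g := c • (lieEZComp k p (fun i => q i + ∑ j, r i j) f).compLinearMap
      fun i => MultilinearMap.evalLinear (fun j => φ'' ⟨i, j⟩ ⊗ₜ[k] ψ'' ⟨i, j⟩) ∘ₗ
        lieEZComp k (q i) (r i)) ?_ hg
  · exact e2
  intro φ' ψ' hφ'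
  have e3 := eq_of_mem_lieEZDeg
    (f := A ∘ₗ MultilinearMap.evalLinear (fun s => φ'' s ⊗ₜ[k] ψ'' s) ∘ₗ B ∘ₗ
      MultilinearMap.evalLinear (fun i => φ' i ⊗ₜ[k] ψ' i) ∘ₗ lieEZComp k p q)
    (g := c • (MultilinearMap.evalLinear (fun i =>
      lieEZComp k (q i) (r i) (φ' i ⊗ₜ[k] ψ' i) fun j => φ'' ⟨i, j⟩ ⊗ₜ[k] ψ'' ⟨i, j⟩) ∘ₗ
        lieEZComp k p (fun i => q i + ∑ j, r i j))) ?_ hf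
  · exact e3
  intro φ hφ ψ
  simp only [LinearMap.comp_apply, LinearMap.smul_apply, MultilinearMap.evalLinear_apply, A, hB,
    lieEZComp_tmul, TensorProduct.map_tmul]
  have h1 := ezComp_assoc p q r (f := φ) (g := φ') (fun i j => φ'' ⟨i, j⟩) hφ'
  have h2 := lieComp_assoc ψ ψ' (fun i j => ψ'' ⟨i, j⟩)
  exact (congrArg₂ (· ⊗ₜ[k] ·) h1 h2).trans (TensorProduct.smul_tmul' _ _ _).symm

end Laws

theorem lieEZ_unit_comp {J : Type} [Fintype J] [LinearOrder J] (n : ℤ)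
    {f : EZObj k J ⊗[k] LieOp k J} (hf : f ∈ lieEZDeg k J n) :
    TensorProduct.map (ezRelabel k (Equiv.uniqueSigma (fun _ : Unit => J)))
      (lieRelabel (Equiv.uniqueSigma (fun _ : Unit => J)))
      (lieEZComp k (K := fun _ : Unit => J) 0 (fun _ => n) (ezUnit k ⊗ₜ[k] lieUnit)
        (fun _ => f)) = f := by
  refine eq_of_forall_mem_lieEZDeg (T := Unit) (I := fun _ => J) (n := fun _ => n)
    (x := fun _ => f)
    (f := (TensorProduct.map (ezRelabel k (Equiv.uniqueSigma (fun _ : Unit => J)))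
      (lieRelabel (Equiv.uniqueSigma (fun _ : Unit => J)))).compMultilinearMap
      (lieEZComp k (K := fun _ : Unit => J) 0 (fun _ => n) (ezUnit k ⊗ₜ[k] lieUnit)))
    (g := MultilinearMap.ofSubsingleton k _ _ () LinearMap.id) ?_ (fun _ => hf)
  intro φ ψ hφ
  simp only [LinearMap.compMultilinearMap_apply, lieEZComp_tmul, TensorProduct.map_tmul]
  exact congrArg₂ _ (ezUnit_comp n (φ ())) (lieUnit_comp (ψ ()))

theorem lieEZ_comp_unit {I : Type} [Fintype I] [LinearOrder I] (n : ℤ)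
    {f : EZObj k I ⊗[k] LieOp k I} (hf : f ∈ lieEZDeg k I n) :
    TensorProduct.map (ezRelabel k (Equiv.sigmaPUnit I)) (lieRelabel (Equiv.sigmaPUnit I))
      (lieEZComp k (K := fun _ : I => Unit) n (fun _ => 0) f
        (fun _ => ezUnit k ⊗ₜ[k] lieUnit)) = f := by
  refine eq_of_mem_lieEZDeg
    (f := TensorProduct.map (ezRelabel k (Equiv.sigmaPUnit I)) (lieRelabel (Equiv.sigmaPUnit I)) ∘ₗ
      MultilinearMap.evalLinear (fun _ => ezUnit k ⊗ₜ[k] lieUnit) ∘ₗ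
        lieEZComp k (K := fun _ : I => Unit) n (fun _ => 0))
    (g := LinearMap.id) ?_ hf
  intro φ hφ ψ
  simp only [LinearMap.comp_apply, MultilinearMap.evalLinear_apply, lieEZComp_tmul,
    TensorProduct.map_tmul]
  exact congrArg₂ _ (ezComp_unit n φ) (lieComp_unit ψ)

variable (k) in
theorem lieEilenbergZilber_isDGOperad : (lieEilenbergZilber k).IsDGOperad where
  d_mem {I} _ _ _ n x hx := by
    refine mem_of_mem_lieEZDeg ((ezD k I).rTensor (LieOp k I)) (lieEZDeg k I (n + 1))
      (fun φ hφ ψ => ?_) hx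
    exact tmul_mem_lieEZDeg (ezD_mem hφ) ψ
  d_d {I} _ _ _ n x hx := by
    refine eq_of_mem_lieEZDeg
      (f := (ezD k I).rTensor (LieOp k I) ∘ₗ (ezD k I).rTensor (LieOp k I)) (g := 0)
      (fun φ hφ ψ => ?_) hx
    rw [LinearMap.comp_apply, ezD_rTensor_tmul, ezD_rTensor_tmul, ezD_ezD hφ,
      TensorProduct.zero_tmul, LinearMap.zero_apply]
  unit_mem := tmul_mem_lieEZDeg ezUnit_mem _
  d_unit := by
    change ezD k Unit (ezUnit k) ⊗ₜ[k] (lieUnit : LieOp k Unit) = 0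
    rw [ezD_ezUnit, TensorProduct.zero_tmul]
  relabel_mem {I J} _ _ _ _ _ _ e n x hx := by
    refine mem_of_mem_lieEZDeg (TensorProduct.map (ezRelabel k e) (lieRelabel e))
      (lieEZDeg k J n) (fun φ hφ ψ => ?_) hx
    exact tmul_mem_lieEZDeg (ezRelabel_mem e hφ) _
  d_relabel {I J} _ _ _ _ _ _ e n x hx := by
    refine eq_of_mem_lieEZDeg
      (f := (ezD k J).rTensor (LieOp k J) ∘ₗ TensorProduct.map (ezRelabel k e) (lieRelabel e))
      (g := TensorProduct.map (ezRelabel k e) (lieRelabel e) ∘ₗ (ezD k I).rTensor (LieOp k I))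
      (fun φ hφ ψ => ?_) hx
    simp only [LinearMap.comp_apply, TensorProduct.map_tmul, ezD_rTensor_tmul, ezD_ezRelabel e hφ]
  relabel_refl {I} _ _ _ n x hx := by
    refine eq_of_mem_lieEZDeg
      (f := TensorProduct.map (ezRelabel k (Equiv.refl I)) (lieRelabel (Equiv.refl I)))
      (g := LinearMap.id) (fun φ hφ ψ => ?_) hx
    rw [TensorProduct.map_tmul, lieRelabel_refl]
    exact congrArg (· ⊗ₜ ψ) (eilenbergZilber_isDGOperad.relabel_refl n φ hφ)
  relabel_trans {I J H} _ _ _ _ _ _ _ _ _ e e' n x hx := by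
    refine eq_of_mem_lieEZDeg
      (f := TensorProduct.map (ezRelabel k (e.trans e')) (lieRelabel (e.trans e')))
      (g := TensorProduct.map (ezRelabel k e') (lieRelabel e') ∘ₗ
        TensorProduct.map (ezRelabel k e) (lieRelabel e)) (fun φ hφ ψ => ?_) hx
    simp only [LinearMap.comp_apply, TensorProduct.map_tmul, lieRelabel_trans]
    exact congrArg (· ⊗ₜ _) (eilenbergZilber_isDGOperad.relabel_trans e e' n φ hφ)
  comp_mem _ _ _ _ hf hg := lieEZComp_mem hf hg
  d_comp _ _ _ _ hf hg := lieEZ_d_comp hf hg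
  relabel_comp e _ _ _ _ hf hg := lieEZ_relabel_comp e hf hg
  comp_relabel e _ _ _ _ hf hg := lieEZ_comp_relabel e hf hg
  comp_assoc _ _ _ _ _ _ hf hg hh := lieEZ_comp_assoc hf hg hh
  unit_comp n _ hf := lieEZ_unit_comp n hf
  comp_unit n _ hf := lieEZ_comp_unit n hf

end LieEZLaws

/-! ## The augmentation -/

section Augmentation

variable {k : Type u} [Field k] {n : SimplexCategory}

@[simp] theorem zAug_single (s : Simplices n) (c : k) :
    zAug k n (Finsupp.single s c) = if s.1 = 0 then c else 0 := by
  simp [zAug]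

/-- Only edges have vertices in their boundary, and the two endpoints of an edge occur with opposite
signs. -/
theorem zAug_comp_zD : zAug k n ∘ₗ zD k n = 0 := by
  refine zChain_hom_ext ?_
  rintro ⟨m, s⟩
  rcases m with _ | _ | m
  · simp [simplexBoundary]
  · simp [simplexBoundary, Fin.sum_univ_two]
  · simp [simplexBoundary]

theorem zAug_comp_zSign (m : ℤ) : zAug k n ∘ₗ zSign k n m = zAug k n :=
  zChain_hom_ext fun s => by
    by_cases h : s.1 = 0 <;> simp [h]

theorem zAug_of_mem {p : ℤ} (hp : p ≠ 0) {z : ZChain k n} (hz : z ∈ zDeg k n p) :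
    zAug k n z = 0 := by
  rw [zDeg_eq_span] at hz
  induction hz using Submodule.span_induction with
  | mem x hx =>
    obtain ⟨s, hs, rfl⟩ := hx
    have : s.1 ≠ 0 := fun h => hp (by rw [← hs.out, h]; simp)
    simp [this]
  | zero => simp
  | add x y _ _ hx hy => simp [hx, hy]
  | smul c x _ hx => simp [hx]

/-- The augmentation `Z([n])^{⊗ I} → k`. -/
noncomputable def ztAug (k : Type u) [Field k] (I : Type) [Fintype I] (n : SimplexCategory) :
    ZTensor k I n →ₗ[k] k :=
  PiTensorProduct.lift ((MultilinearMap.mkPiAlgebra k I k).compLinearMap fun _ => zAug k n)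

variable {I J : Type} [Fintype I] [LinearOrder I] [Fintype J] [LinearOrder J]

omit [LinearOrder I] in
theorem ztAug_tprod (z : I → ZChain k n) :
    ztAug k I n (PiTensorProduct.tprod k z) = ∏ i, zAug k n (z i) := by
  simp [ztAug]

omit [LinearOrder I] in
theorem ztAug_ztBasis (s : I → Simplices n) :
    ztAug k I n (ztBasis k I n s) = ∏ i, if (s i).1 = 0 then 1 else 0 := by
  simp [ztBasis_apply, ztAug_tprod]

omit [LinearOrder I] in
theorem ztAug_of_mem {p : ℤ} (hp : p ≠ 0) {x : ZTensor k I n} (hx : x ∈ ztDeg k I n p) :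
    ztAug k I n x = 0 := by
  refine ztDeg_induction (P := fun x => ztAug k I n x = 0) (fun s hs => ?_) (by simp)
    (fun x y hx hy => by rw [map_add, hx, hy, add_zero])
    (fun c x hx => by rw [map_smul, hx, smul_zero]) hx
  obtain ⟨i, hi⟩ : ∃ i, (s i).1 ≠ 0 := by
    by_contra! h
    exact hp (by rw [← hs]; simp [h])
  rw [ztAug_ztBasis]
  exact Finset.prod_eq_zero (Finset.mem_univ i) (if_neg hi)

theorem ztAug_comp_ztD : ztAug k I n ∘ₗ ztD k I n = 0 := by
  refine (ztBasis k I n).ext fun s => ?_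
  rw [LinearMap.comp_apply, ztD_eq_sum, LinearMap.sum_apply, map_sum, LinearMap.zero_apply]
  refine Finset.sum_eq_zero fun i _ => ?_
  rw [ztBasis_apply, ztDAt, PiTensorProduct.map_tprod, ztAug_tprod]
  refine Finset.prod_eq_zero (Finset.mem_univ i) ?_
  rw [if_neg (lt_irrefl i), if_pos rfl]
  exact LinearMap.congr_fun zAug_comp_zD _

omit [LinearOrder I] in
theorem ztAug_comp_ztMap {n' : SimplexCategory} (f : n ⟶ n') :
    ztAug k I n' ∘ₗ ztMap k I f = ztAug k I n := by
  refine (ztBasis k I n).ext fun s => ?_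
  rw [LinearMap.comp_apply, ztMap_ztBasis, ztAug_ztBasis, ztAug_ztBasis]

theorem ztAug_comp_ztPerm (e : I ≃ J) : ztAug k J n ∘ₗ ztPerm k e n = ztAug k I n := by
  refine (ztBasis k I n).ext fun s => ?_
  rw [LinearMap.comp_apply, ztPerm_ztBasis, map_smul, ztAug_ztBasis, ztAug_ztBasis,
    ← e.prod_comp]
  simp only [Equiv.symm_apply_apply]
  by_cases h : ∀ i, (s i).1 = 0
  · simp [h, koszulSign]
  · obtain ⟨i, hi⟩ := not_forall.1 h
    rw [Finset.prod_eq_zero (Finset.mem_univ i) (if_neg hi), smul_zero]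

omit [LinearOrder I] in
theorem ztAug_ztFlatten {K : I → Type} [∀ i, Fintype (K i)] (w : ∀ i, ZTensor k (K i) n) :
    ztAug k (Σ i, K i) n (ztFlatten k n (PiTensorProduct.tprod k w)) =
      ∏ i, ztAug k (K i) n (w i) := by
  have h : (ztAug k (Σ i, K i) n ∘ₗ ztFlatten k n).compMultilinearMap (PiTensorProduct.tprod k) =
      (MultilinearMap.mkPiAlgebra k I k).compLinearMap fun i => ztAug k (K i) n := by
    refine multilinear_ztensor_ext fun s => ?_
    simp only [LinearMap.compMultilinearMap_apply, LinearMap.comp_apply, ztFlatten_basis,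
      ztAug_ztBasis, MultilinearMap.compLinearMap_apply, MultilinearMap.mkPiAlgebra_apply]
    exact Fintype.prod_sigma _
  simpa using congrArg (fun F => F w) h

/-- The generator of `Z([m])` given by the identity of `[m]`. -/
noncomputable abbrev zId (k : Type u) [Field k] (m : ℕ) : ZChain k (SimplexCategory.mk m) :=
  Finsupp.single (⟨m, 𝟙 _⟩ : Simplices (SimplexCategory.mk m)) (1 : k)

theorem zD_zId_zero : zD k _ (zId k 0) = 0 := by
  simp [simplexBoundary]

theorem zId_mem (m : ℕ) : zId k m ∈ zDeg k (SimplexCategory.mk m) (-(m : ℤ)) :=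
  single_mem_zDeg (⟨m, 𝟙 _⟩ : Simplices (SimplexCategory.mk m)) 1

omit [LinearOrder I] in
theorem ezAug_apply (φ : EZObj k I) : ezAug k I φ = ztAug k I _ (φ _ (zId k 0)) := rfl

omit [LinearOrder I] in
theorem ezAug_of_mem {r : ℤ} (hr : r ≠ 0) {φ : EZObj k I} (hφ : φ ∈ ezDeg k I r) :
    ezAug k I φ = 0 :=
  ztAug_of_mem (p := -((0 : ℕ) : ℤ) + r) (by simpa using hr) (hφ.2 _ _ _ (zId_mem 0))

theorem ezAug_ezD {r : ℤ} {φ : EZObj k I} (hφ : φ ∈ ezDeg k I r) :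
    ezAug k I (ezD k I φ) = 0 := by
  rw [ezAug_apply, ezD_of_mem hφ, LinearMap.sub_apply, LinearMap.smul_apply, LinearMap.comp_apply,
    LinearMap.comp_apply, zD_zId_zero, map_zero, smul_zero]
  refine (congrArg _ (sub_zero _)).trans ?_
  exact LinearMap.congr_fun ztAug_comp_ztD _

theorem ezAug_ezRelabel (e : I ≃ J) (φ : EZObj k I) :
    ezAug k J (ezRelabel k e φ) = ezAug k I φ :=
  LinearMap.congr_fun (ztAug_comp_ztPerm e) _

theorem ezAug_ezUnit : ezAug k Unit (ezUnit k) = 1 := by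
  rw [ezAug_apply, ezUnit_apply, ztAug_tprod]
  simp

-- Two maps on `Z([0])` are compared: in degree `0` there is only the vertex, where the equality
-- defines `ε(φ)`, and in the other degrees both sides vanish.
omit [LinearOrder I] in
theorem ztAug_comp_of_mem {φ : EZObj k I} (hφ : φ ∈ ezDeg k I 0) :
    ztAug k I _ ∘ₗ φ (SimplexCategory.mk 0) = ezAug k I φ • zAug k (SimplexCategory.mk 0) := by
  refine zChain_hom_ext ?_
  rintro ⟨m, s⟩
  rw [LinearMap.comp_apply, LinearMap.smul_apply, zAug_single]
  rcases m with _ | m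
  · obtain rfl : s = 𝟙 _ := Subsingleton.elim _ _
    simp [ezAug_apply]
  · have := ztAug_of_mem (p := -((m + 1 : ℕ) : ℤ) + 0) (by push_cast; omega)
      (hφ.2 _ _ _ (single_mem_zDeg (⟨m + 1, s⟩ : Simplices (SimplexCategory.mk 0)) (1 : k)))
    rw [this]
    simp

theorem ezAug_ezComp {K : I → Type} [∀ i, Fintype (K i)] (φ : EZObj k I)
    {g : ∀ i, EZObj k (K i)} (hg : ∀ i, g i ∈ ezDeg k (K i) 0) (p : ℤ) {q : I → ℤ}
    (hq : ∀ i, q i = 0) :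
    ezAug k (Σ i, K i) (ezComp k p q φ g) = (∏ i, ezAug k (K i) (g i)) * ezAug k I φ := by
  have h : ztAug k (Σ i, K i) (SimplexCategory.mk 0) ∘ₗ ztFlatten k _ ∘ₗ
      PiTensorProduct.map (fun i => g i _) = (∏ i, ezAug k (K i) (g i)) • ztAug k I _ := by
    refine (ztBasis k I _).ext fun s => ?_
    rw [ztBasis_apply, LinearMap.comp_apply, LinearMap.comp_apply, PiTensorProduct.map_tprod,
      ztAug_ztFlatten, LinearMap.smul_apply, ztAug_tprod, smul_eq_mul, ← Finset.prod_mul_distrib]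
    exact Finset.prod_congr rfl fun i _ => LinearMap.congr_fun (ztAug_comp_of_mem (hg i)) _
  rw [ezAug_apply, ezComp_apply, ezAug_apply]
  simp only [hq, Finset.sum_const_zero, mul_zero, ksign_zero, one_smul, zSign_zero,
    LinearMap.comp_id]
  exact LinearMap.congr_fun h _

/-- The augmentation `𝒴(I) → Lie(I)`. -/
noncomputable def lieEZAug (k : Type u) [Field k] (I : Type) [Fintype I] :
    EZObj k I ⊗[k] LieOp k I →ₗ[k] LieOp k I :=
  (TensorProduct.lid k (LieOp k I)).toLinearMap ∘ₗ (ezAug k I).rTensor (LieOp k I)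

omit [LinearOrder I] in
theorem lieEZAug_tmul (φ : EZObj k I) (ψ : LieOp k I) :
    lieEZAug k I (φ ⊗ₜ ψ) = ezAug k I φ • ψ := by
  simp [lieEZAug]

omit [LinearOrder I] in
theorem lieEZAug_of_mem {r : ℤ} (hr : r ≠ 0) {x : EZObj k I ⊗[k] LieOp k I}
    (hx : x ∈ lieEZDeg k I r) : lieEZAug k I x = 0 := by
  refine eq_of_mem_lieEZDeg (g := 0) (fun φ hφ ψ => ?_) hx
  rw [lieEZAug_tmul, ezAug_of_mem hr hφ, zero_smul, LinearMap.zero_apply]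

theorem lieEZAug_comp {K : I → Type} [∀ i, Fintype (K i)] {f : EZObj k I ⊗[k] LieOp k I}
    {g : ∀ i, EZObj k (K i) ⊗[k] LieOp k (K i)} (hf : f ∈ lieEZDeg k I 0)
    {q : I → ℤ} (hq : ∀ i, q i = 0) (hg : ∀ i, g i ∈ lieEZDeg k (K i) (q i)) :
    lieEZAug k (Σ i, K i) (lieEZComp k 0 q f g) =
      lieComp (lieEZAug k I f) fun i => lieEZAug k (K i) (g i) := by
  refine eq_of_forall_mem_lieEZDeg
    (f := (lieEZAug k (Σ i, K i)).compMultilinearMap (lieEZComp k 0 q f))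
    (g := (lieComp (lieEZAug k I f)).compLinearMap fun i => lieEZAug k (K i)) ?_ hg
  intro φ' ψ' hφ'
  simp only [hq] at hφ'
  simp only [LinearMap.compMultilinearMap_apply, MultilinearMap.compLinearMap_apply, lieEZAug_tmul]
  refine eq_of_mem_lieEZDeg
    (f := lieEZAug k (Σ i, K i) ∘ₗ MultilinearMap.evalLinear (fun i => φ' i ⊗ₜ[k] ψ' i) ∘ₗ
      lieEZComp k 0 q)
    (g := MultilinearMap.evalLinear (fun i => ezAug k (K i) (φ' i) • ψ' i) ∘ₗ lieComp ∘ₗ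
      lieEZAug k I) ?_ hf
  intro φ hφ ψ
  simp only [LinearMap.comp_apply, MultilinearMap.evalLinear_apply, lieEZComp_tmul, lieEZAug_tmul,
    ezAug_ezComp φ hφ' 0 hq, MultilinearMap.map_smul_univ, map_smul, smul_smul]
  rw [mul_comm]

/-- Once entries of positive degree vanish, a composition of degree `0` has all entries of degree
`0`, where `ε` is multiplicative; in every other case both sides are zero. -/
theorem lieEZAug_comp_of_nonpos {K : I → Type} [∀ i, Fintype (K i)] {p : ℤ} {q : I → ℤ}
    {f : EZObj k I ⊗[k] LieOp k I} {g : ∀ i, EZObj k (K i) ⊗[k] LieOp k (K i)}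
    (hf : f ∈ lieEZDeg k I p) (hg : ∀ i, g i ∈ lieEZDeg k (K i) (q i))
    (hp : 0 < p → f = 0) (hq : ∀ i, 0 < q i → g i = 0) :
    lieEZAug k (Σ i, K i) (lieEZComp k p q f g) =
      lieComp (lieEZAug k I f) fun i => lieEZAug k (K i) (g i) := by
  rcases lt_or_ge 0 p with h | h
  · rw [hp h, map_zero, map_zero, map_zero]
    exact map_zero (lieEZAug k (Σ i, K i))
  by_cases hq' : ∃ i, 0 < q i
  · obtain ⟨i, hi⟩ := hq'
    rw [(lieEZComp k p q f).map_coord_zero i (hq i hi),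
      (lieComp (lieEZAug k I f)).map_coord_zero i (by rw [hq i hi, map_zero]), map_zero]
  have hq' : ∀ i, q i ≤ 0 := fun i => not_lt.1 fun h => hq' ⟨i, h⟩
  have hs : ∑ i, q i ≤ 0 := Finset.sum_nonpos fun i _ => hq' i
  rcases h.lt_or_eq with h | rfl
  · rw [lieEZAug_of_mem (by omega) (lieEZComp_mem hf hg), lieEZAug_of_mem h.ne hf, map_zero]
    rfl
  by_cases hq0 : ∀ i, q i = 0
  · exact lieEZAug_comp hf hq0 hg
  obtain ⟨i, hi⟩ := not_forall.1 hq0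
  have hs : ∑ i, q i ≠ 0 := fun h => hi
    ((Finset.sum_eq_zero_iff_of_nonpos fun i _ => hq' i).1 h i (Finset.mem_univ i))
  rw [lieEZAug_of_mem (by omega) (lieEZComp_mem hf hg),
    (lieComp (lieEZAug k I f)).map_coord_zero i (lieEZAug_of_mem hi (hg i))]

variable (k) in
theorem truncLieEZAug_isOperadMap : DGOperadData.IsOperadMap (truncLieEZAug k) where
  map_mem {I} _ _ _ n x hx := by
    change lieEZAug k I x ∈ (if n = 0 then ⊤ else ⊥ : Submodule k (LieOp k I))
    split_ifs with h
    · exact Submodule.mem_top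
    · exact (Submodule.mem_bot k).2
        (lieEZAug_of_mem h (DGOperadData.truncLEZero_deg_le (L := lieEilenbergZilber k) I n hx))
  map_d {I} _ _ _ n x hx := by
    refine eq_of_mem_lieEZDeg (f := lieEZAug k I ∘ₗ (ezD k I).rTensor (LieOp k I)) (g := 0)
      (fun φ hφ ψ => ?_) (DGOperadData.truncLEZero_deg_le (L := lieEilenbergZilber k) I n hx)
    rw [LinearMap.comp_apply, ezD_rTensor_tmul, lieEZAug_tmul, ezAug_ezD hφ, zero_smul,
      LinearMap.zero_apply]
  map_unit := by
    refine (lieEZAug_tmul (ezUnit k) lieUnit).trans ?_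
    rw [ezAug_ezUnit, one_smul]
    rfl
  map_relabel {I J} _ _ _ _ _ _ e n x hx := by
    refine eq_of_mem_lieEZDeg
      (f := lieEZAug k J ∘ₗ TensorProduct.map (ezRelabel k e) (lieRelabel e))
      (g := lieRelabel e ∘ₗ lieEZAug k I) (fun φ hφ ψ => ?_)
      (DGOperadData.truncLEZero_deg_le (L := lieEilenbergZilber k) I n hx)
    rw [LinearMap.comp_apply, LinearMap.comp_apply, TensorProduct.map_tmul, lieEZAug_tmul,
      lieEZAug_tmul, ezAug_ezRelabel, map_smul]
  map_comp {I K} _ _ _ _ _ _ p q f g hf hg :=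
    lieEZAug_comp_of_nonpos
      (DGOperadData.truncLEZero_deg_le (L := lieEilenbergZilber k) I p hf)
      (fun i => DGOperadData.truncLEZero_deg_le (L := lieEilenbergZilber k) (K i) (q i) (hg i))
      (fun hp => DGOperadData.eq_zero_of_mem_truncDeg (L := lieEilenbergZilber k) hp hf)
      (fun i hi => DGOperadData.eq_zero_of_mem_truncDeg (L := lieEilenbergZilber k) hi (hg i))

end Augmentation

/-! ## The contraction of the chains on a simplex -/

section Contraction

variable {k : Type u} [Field k] {p : ℕ}

/-- The cone of a simplex of `Δ^p` with apex the vertex `0`. -/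
def coneHom {m : ℕ} (s : SimplexCategory.mk m ⟶ SimplexCategory.mk p) :
    SimplexCategory.mk (m + 1) ⟶ SimplexCategory.mk p :=
  SimplexCategory.Hom.mk ⟨Fin.cons (0 : Fin (p + 1)) (fun j => s.toOrderHom j), by
    intro i j hij
    induction i using Fin.cases with
    | zero => exact Fin.zero_le _
    | succ i =>
      induction j using Fin.cases with
      | zero => exact absurd hij (by simp)
      | succ j => exact s.toOrderHom.monotone (Fin.succ_le_succ_iff.1 hij)⟩

/-- The vertex `0` of `Δ^p`. -/
def apex (p : ℕ) : SimplexCategory.mk 0 ⟶ SimplexCategory.mk p :=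
  SimplexCategory.Hom.mk ⟨fun _ => (0 : Fin (p + 1)), fun _ _ _ => le_rfl⟩

theorem δ_zero_comp_coneHom {m : ℕ} (s : SimplexCategory.mk m ⟶ SimplexCategory.mk p) :
    SimplexCategory.δ 0 ≫ coneHom s = s := by
  ext j : 3
  rfl

theorem δ_succ_comp_coneHom {m : ℕ} (s : SimplexCategory.mk (m + 1) ⟶ SimplexCategory.mk p)
    (i : Fin (m + 2)) :
    SimplexCategory.δ i.succ ≫ coneHom s = coneHom (SimplexCategory.δ i ≫ s) := by
  ext j : 3
  induction j using Fin.cases with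
  | zero => rfl
  | succ j =>
    change (Fin.cons (0 : Fin (p + 1)) (fun j => s.toOrderHom j) : Fin (m + 3) → Fin (p + 1))
      (i.succ.succAbove j.succ) = s.toOrderHom (i.succAbove j)
    rw [Fin.succ_succAbove_succ, Fin.cons_succ]

theorem δ_one_comp_coneHom (s : SimplexCategory.mk 0 ⟶ SimplexCategory.mk p) :
    SimplexCategory.δ 1 ≫ coneHom s = apex p := by
  ext j : 3
  obtain rfl : j = (0 : Fin 1) := Subsingleton.elim (α := Fin 1) _ _
  rfl

/-- The contracting homotopy of `Z([p])`. -/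
noncomputable def zCone (k : Type u) [Field k] (p : ℕ) :
    ZChain k (SimplexCategory.mk p) →ₗ[k] ZChain k (SimplexCategory.mk p) :=
  Finsupp.lmapDomain k k fun s => ⟨s.1 + 1, coneHom s.2⟩

/-- The projection of `Z([p])` onto the vertex `0`. -/
noncomputable def zProj (k : Type u) [Field k] (p : ℕ) :
    ZChain k (SimplexCategory.mk p) →ₗ[k] ZChain k (SimplexCategory.mk p) :=
  (zAug k _).smulRight (Finsupp.single ⟨0, apex p⟩ 1)

@[simp] theorem zCone_single (s : Simplices (SimplexCategory.mk p)) (c : k) :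
    zCone k p (Finsupp.single s c) = Finsupp.single ⟨s.1 + 1, coneHom s.2⟩ c := by
  simp [zCone]

theorem zProj_apply (z : ZChain k (SimplexCategory.mk p)) :
    zProj k p z = zAug k _ z • Finsupp.single ⟨0, apex p⟩ 1 := rfl

/-- The face `0` of a cone is its base, and the other faces are the cones over the faces of the
base, with the opposite sign. Only for a vertex is the remaining face the apex instead, which gives
the projection. -/
theorem zD_comp_zCone_add :
    zD k _ ∘ₗ zCone k p + zCone k p ∘ₗ zD k _ = LinearMap.id - zProj k p := by
  refine zChain_hom_ext ?_
  rintro ⟨m, s⟩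
  simp only [LinearMap.add_apply, LinearMap.sub_apply, LinearMap.comp_apply, zCone_single, zD_single,
    LinearMap.id_apply, zProj_apply, zAug_single]
  rcases m with _ | m
  · change ∑ i : Fin 2, Finsupp.single (⟨0, SimplexCategory.δ i ≫ coneHom s⟩ :
      Simplices (SimplexCategory.mk p)) ((-1 : k) ^ (i : ℕ)) + zCone k p 0 = _
    rw [Fin.sum_univ_two, δ_zero_comp_coneHom, δ_one_comp_coneHom, map_zero]
    simp [sub_eq_add_neg]
  · change ∑ i : Fin (m + 3), Finsupp.single (⟨m + 1, SimplexCategory.δ i ≫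
      coneHom s⟩ : Simplices (SimplexCategory.mk p)) ((-1 : k) ^ (i : ℕ)) +
        zCone k p (∑ i : Fin (m + 2), Finsupp.single (⟨m, SimplexCategory.δ i ≫ s⟩ :
          Simplices (SimplexCategory.mk p)) ((-1 : k) ^ (i : ℕ))) = _
    rw [Fin.sum_univ_succ, δ_zero_comp_coneHom, map_sum, add_assoc, ← Finset.sum_add_distrib]
    have h : ∀ i : Fin (m + 2), Finsupp.single (⟨m + 1, SimplexCategory.δ i.succ ≫
        coneHom s⟩ : Simplices (SimplexCategory.mk p)) ((-1 : k) ^ (i.succ : ℕ)) +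
        zCone k p (Finsupp.single (⟨m, SimplexCategory.δ i ≫ s⟩ :
          Simplices (SimplexCategory.mk p)) ((-1 : k) ^ (i : ℕ))) = 0 := by
      intro i
      rw [δ_succ_comp_coneHom, zCone_single, Fin.val_succ, pow_succ, mul_neg_one,
        Finsupp.single_neg]
      exact neg_add_cancel _
    rw [Finset.sum_congr rfl fun i _ => h i]
    simp

theorem zD_comp_zProj : zD k _ ∘ₗ zProj k p = 0 := by
  refine LinearMap.ext fun z => ?_
  rw [LinearMap.comp_apply, zProj_apply, map_smul, zD_single]
  exact smul_zero _

theorem zProj_comp_zD : zProj k p ∘ₗ zD k _ = 0 := by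
  refine LinearMap.ext fun z => ?_
  have : zAug k _ (zD k _ z) = 0 := LinearMap.congr_fun zAug_comp_zD z
  rw [LinearMap.comp_apply, zProj_apply, this, zero_smul]
  rfl

theorem zSign_comp_zProj (m : ℤ) : zSign k _ m ∘ₗ zProj k p = zProj k p := by
  refine LinearMap.ext fun z => ?_
  rw [LinearMap.comp_apply, zProj_apply, map_smul, zSign_single_one]
  simp

theorem zProj_comp_zSign (m : ℤ) : zProj k p ∘ₗ zSign k _ m = zProj k p := by
  refine LinearMap.ext fun z => ?_
  have : zAug k _ (zSign k _ m z) = zAug k _ z := LinearMap.congr_fun (zAug_comp_zSign m) z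
  rw [LinearMap.comp_apply, zProj_apply, this, zProj_apply]

/-- The cone raises the dimension by one. -/
theorem zSign_comp_zCone : zSign k _ 1 ∘ₗ zCone k p = -(zCone k p ∘ₗ zSign k _ 1) :=
  zChain_hom_ext fun s => by
    rw [LinearMap.comp_apply, LinearMap.neg_apply, LinearMap.comp_apply, zSign_single_one,
      zCone_single, zSign_single_one, map_smul, zCone_single, ← neg_smul]
    congr 1
    change ksign k (1 * ((s.1 + 1 : ℕ) : ℤ)) = _
    rw [one_mul, one_mul, Nat.cast_succ, ksign_add, ksign_one, mul_neg_one]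

/-! ### Contraction of the tensor powers -/

section Tensor

variable {I : Type} [Fintype I] [LinearOrder I]

/-- The summand number `i` of the contracting homotopy of `Z([p])^{⊗ I}`. -/
noncomputable def ztConeAt (k : Type u) [Field k] {I : Type} [LinearOrder I] (p : ℕ) (i : I) :
    ZTensor k I (SimplexCategory.mk p) →ₗ[k] ZTensor k I (SimplexCategory.mk p) :=
  PiTensorProduct.map fun j =>
    if j < i then zProj k p else if j = i then zCone k p else LinearMap.id

/-- The contracting homotopy of `Z([p])^{⊗ I}`. -/
noncomputable def ztCone (k : Type u) [Field k] (I : Type) [Fintype I] [LinearOrder I] (p : ℕ) :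
    ZTensor k I (SimplexCategory.mk p) →ₗ[k] ZTensor k I (SimplexCategory.mk p) :=
  ∑ i : I, ztConeAt k p i

-- Slot `i` contains `d ∘ zProj`, which is zero. With its mirror image, this removes the terms in
-- which the differential precedes the cone.
omit [Fintype I] in
theorem ztDAt_comp_ztConeAt_of_lt {i j : I} (h : i < j) : ztDAt k _ i ∘ₗ ztConeAt k p j = 0 := by
  rw [ztDAt, ztConeAt, ← PiTensorProduct.map_comp]
  exact PiTensorProduct.map_eq_zero i (by simp [h, zD_comp_zProj])

omit [Fintype I] in
theorem ztConeAt_comp_ztDAt_of_lt {i j : I} (h : i < j) : ztConeAt k p j ∘ₗ ztDAt k _ i = 0 := by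
  rw [ztDAt, ztConeAt, ← PiTensorProduct.map_comp]
  exact PiTensorProduct.map_eq_zero i (by simp [h, zProj_comp_zD])

/-- Only slot `j` feels the order of the two maps: there the sign operator meets the cone. The slots
before `j` hold the projection, which lands in degree `0` and ignores signs. -/
theorem ztDAt_comp_ztConeAt_of_gt {i j : I} (h : j < i) :
    ztDAt k _ i ∘ₗ ztConeAt k p j = -(ztConeAt k p j ∘ₗ ztDAt k _ i) := by
  rw [ztDAt, ztConeAt, ← PiTensorProduct.map_comp, ← PiTensorProduct.map_comp]
  have e : (fun l => (if l < i then zSign k _ 1 else if l = i then zD k _ else LinearMap.id) ∘ₗ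
      (if l < j then zProj k p else if l = j then zCone k p else LinearMap.id)) =
      fun l => (if l = j then (-1 : k) else 1) •
        ((if l < j then zProj k p else if l = j then zCone k p else LinearMap.id) ∘ₗ
          (if l < i then zSign k _ 1 else if l = i then zD k _ else LinearMap.id)) := by
    funext l
    rcases lt_trichotomy l j with hl | rfl | hl
    · rw [if_pos (hl.trans h), if_pos hl, if_neg hl.ne, one_smul, zSign_comp_zProj,
        zProj_comp_zSign]
    · rw [if_pos h, if_neg (lt_irrefl l), if_pos rfl, if_pos rfl, zSign_comp_zCone]
      exact LinearMap.ext fun z => by simp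
    · rw [if_neg hl.not_gt, if_neg hl.ne', if_neg hl.ne', one_smul, LinearMap.comp_id,
        LinearMap.id_comp]
  rw [e, PiTensorProduct.map_smul_univ, Finset.prod_ite_eq' Finset.univ j,
    if_pos (Finset.mem_univ j)]
  exact neg_one_smul k (M := ZTensor k I _ →ₗ[k] ZTensor k I _) _

omit [Fintype I] in
theorem ztDAt_comp_ztConeAt_self (i : I) :
    ztDAt k _ i ∘ₗ ztConeAt k p i + ztConeAt k p i ∘ₗ ztDAt k _ i =
      -PiTensorProduct.map fun j => if j < i then zProj k p else if j = i then
        zProj k p - LinearMap.id else LinearMap.id := by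
  classical
  rw [ztDAt, ztConeAt, ← PiTensorProduct.map_comp, ← PiTensorProduct.map_comp]
  set F : I → ZChain k (SimplexCategory.mk p) →ₗ[k] ZChain k (SimplexCategory.mk p) := fun j =>
    if j < i then zProj k p else LinearMap.id with hF
  have h1 : ∀ f : ZChain k (SimplexCategory.mk p) →ₗ[k] ZChain k (SimplexCategory.mk p),
      (fun j => if j < i then zProj k p else if j = i then f else LinearMap.id) =
        Function.update F i f := by
    intro f
    funext j
    by_cases hj : j = i
    · subst hj; simp
    · simp [hF, hj]
  have h2 : (fun j => (if j < i then zSign k _ 1 else if j = i then zD k _ else LinearMap.id) ∘ₗ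
      (if j < i then zProj k p else if j = i then zCone k p else LinearMap.id)) =
      Function.update F i (zD k _ ∘ₗ zCone k p) := by
    rw [← h1]
    funext j
    split_ifs
    · rw [zSign_comp_zProj]
    · rfl
    · rfl
  have h3 : (fun j => (if j < i then zProj k p else if j = i then zCone k p else LinearMap.id) ∘ₗ
      (if j < i then zSign k _ 1 else if j = i then zD k _ else LinearMap.id)) =
      Function.update F i (zCone k p ∘ₗ zD k _) := by
    rw [← h1]
    funext j
    split_ifs
    · rw [zProj_comp_zSign]
    · rfl
    · rfl
  have h4 : zProj k p - LinearMap.id = -(zD k _ ∘ₗ zCone k p + zCone k p ∘ₗ zD k _) := by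
    rw [zD_comp_zCone_add]
    exact (neg_sub (LinearMap.id : ZChain k (SimplexCategory.mk p) →ₗ[k]
      ZChain k (SimplexCategory.mk p)) (zProj k p)).symm
  rw [h1, h2, h3, h4, ← PiTensorProduct.map_update_add]
  exact ((congrArg Neg.neg ((PiTensorProduct.mapMultilinear k
    (fun _ : I => ZChain k (SimplexCategory.mk p))
    (fun _ : I => ZChain k (SimplexCategory.mk p))).map_update_neg F i _)).trans (neg_neg _)).symm

/-- The cross terms vanish or cancel. The diagonal ones are `π ⊗ ⋯ ⊗ π ⊗ (1 - π) ⊗ 1 ⊗ ⋯ ⊗ 1`, with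
`π` the projection onto the vertex, and their sum telescopes to `1 - π ⊗ ⋯ ⊗ π`. -/
theorem ztD_comp_ztCone_add :
    ztD k I _ ∘ₗ ztCone k I p + ztCone k I p ∘ₗ ztD k I _ =
      LinearMap.id - PiTensorProduct.map fun _ => zProj k p := by
  have h1 : ∀ i j : I, ztDAt k _ i ∘ₗ ztConeAt k p j + ztConeAt k p j ∘ₗ ztDAt k _ i =
      if i = j then -PiTensorProduct.map fun l => if l < i then zProj k p else if l = i then
        zProj k p - LinearMap.id else LinearMap.id else 0 := by
    intro i j
    rcases lt_trichotomy i j with h | rfl | h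
    · rw [ztDAt_comp_ztConeAt_of_lt h, ztConeAt_comp_ztDAt_of_lt h, if_neg h.ne]
      exact add_zero _
    · rw [if_pos rfl, ztDAt_comp_ztConeAt_self]
    · rw [ztDAt_comp_ztConeAt_of_gt h, if_neg h.ne']
      exact neg_add_cancel _
  -- The telescoping identity, passing from `π` to the identity one slot at a time.
  have h2 := (PiTensorProduct.mapMultilinear k (fun _ : I => ZChain k (SimplexCategory.mk p))
    (fun _ : I => ZChain k (SimplexCategory.mk p))).map_piecewise_sub_map_piecewise
      (fun _ => zProj k p) (fun _ => LinearMap.id) (fun _ => LinearMap.id) Finset.univ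
  simp only [Finset.piecewise_univ, Finset.mem_univ, if_true,
    PiTensorProduct.mapMultilinear_apply, PiTensorProduct.map_id] at h2
  have h3 : ztD k I _ ∘ₗ ztCone k I p + ztCone k I p ∘ₗ ztD k I _ =
      ∑ i : I, ∑ j : I, (ztDAt k _ i ∘ₗ ztConeAt k p j + ztConeAt k p j ∘ₗ ztDAt k _ i) := by
    simp only [ztD_eq_sum, ztCone, LinearMap.comp_finset_sum, LinearMap.finset_sum_comp,
      Finset.sum_add_distrib]
    rw [Finset.sum_comm]
  rw [h3, ← neg_sub, h2]
  simp only [h1, Finset.sum_ite_eq, Finset.mem_univ, if_true]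
  exact Finset.sum_neg_distrib _

omit [LinearOrder I] in
theorem map_zProj_apply (x : ZTensor k I (SimplexCategory.mk p)) :
    PiTensorProduct.map (fun _ : I => zProj k p) x =
      ztAug k I _ x • ztBasis k I _ fun _ => ⟨0, apex p⟩ := by
  refine LinearMap.congr_fun (g := (ztAug k I (SimplexCategory.mk p)).smulRight
    (ztBasis k I _ fun _ => ⟨0, apex p⟩)) ((ztBasis k I _).ext fun s => ?_) x
  rw [LinearMap.smulRight_apply, ztBasis_apply, ztBasis_apply, PiTensorProduct.map_tprod,
    ztAug_tprod]
  simp only [zProj_apply]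
  exact MultilinearMap.map_smul_univ _ _ _

/-- `Z([p])^{⊗ I}` is contractible. -/
theorem ztD_ztCone {x : ZTensor k I (SimplexCategory.mk p)} (hx : ztD k I _ x = 0)
    (hx' : ztAug k I _ x = 0) : ztD k I _ (ztCone k I p x) = x := by
  have h := LinearMap.congr_fun (ztD_comp_ztCone_add (k := k) (I := I) (p := p)) x
  rw [LinearMap.add_apply, LinearMap.sub_apply, LinearMap.comp_apply, LinearMap.comp_apply, hx,
    map_zero, map_zProj_apply, hx', zero_smul] at h
  exact ((add_zero _).symm.trans h).trans (sub_zero x)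

theorem zCone_mem {r : ℤ} {z : ZChain k (SimplexCategory.mk p)} (hz : z ∈ zDeg k _ r) :
    zCone k p z ∈ zDeg k _ (r - 1) := by
  rw [zDeg_eq_span] at hz
  induction hz using Submodule.span_induction with
  | mem x hx =>
    obtain ⟨s, rfl, rfl⟩ := hx
    have := single_mem_zDeg (⟨s.1 + 1, coneHom s.2⟩ : Simplices (SimplexCategory.mk p)) (1 : k)
    rw [show -(((⟨s.1 + 1, coneHom s.2⟩ : Simplices (SimplexCategory.mk p)).1 : ℕ) : ℤ) =
      -(s.1 : ℤ) - 1 by push_cast; ring] at this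
    simpa using this
  | zero => simp
  | add x y _ _ hx hy => rw [map_add]; exact add_mem hx hy
  | smul c x _ hx => rw [map_smul]; exact Submodule.smul_mem _ _ hx

theorem zProj_mem {r : ℤ} {z : ZChain k (SimplexCategory.mk p)} (hz : z ∈ zDeg k _ r) :
    zProj k p z ∈ zDeg k _ r := by
  by_cases hr : r = 0
  · subst hr
    rw [zProj_apply]
    refine Submodule.smul_mem _ _ ?_
    simpa using single_mem_zDeg (⟨0, apex p⟩ : Simplices (SimplexCategory.mk p)) (1 : k)
  · rw [zProj_apply, zAug_of_mem hr hz, zero_smul]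
    exact zero_mem _

theorem ztCone_mem {r : ℤ} {x : ZTensor k I (SimplexCategory.mk p)} (hx : x ∈ ztDeg k I _ r) :
    ztCone k I p x ∈ ztDeg k I _ (r - 1) := by
  refine map_mem_ztDeg _ (fun s hs => ?_) hx
  rw [ztCone, LinearMap.sum_apply]
  refine sum_mem fun i _ => ?_
  rw [ztBasis_apply, ztConeAt, PiTensorProduct.map_tprod]
  refine tprod_mem_ztDeg (a := fun j => -((s j).1 : ℤ) + if j = i then -1 else 0) (fun j => ?_) ?_
  · have h := single_mem_zDeg (s j) (1 : k)
    by_cases h1 : j = i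
    · rw [if_neg h1.not_lt, if_pos h1, if_pos h1]
      exact zCone_mem h
    · rw [if_neg h1, if_neg h1, add_zero]
      split_ifs
      · exact zProj_mem h
      · exact h
  · rw [Finset.sum_add_distrib, hs, Finset.sum_ite_eq' Finset.univ i, if_pos (Finset.mem_univ i),
      sub_eq_add_neg]

/-! ## Cocycles are coboundaries -/

/-- The alternating sum of the faces `Z([m])^{⊗ I} → Z([m + 1])^{⊗ I}`. -/
noncomputable def ztFaces (k : Type u) [Field k] (I : Type) (m : ℕ) :
    ZTensor k I (SimplexCategory.mk m) →ₗ[k] ZTensor k I (SimplexCategory.mk (m + 1)) :=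
  ∑ i : Fin (m + 2), (-1 : k) ^ (i : ℕ) • ztMap k I (SimplexCategory.δ i)

omit [Fintype I] [LinearOrder I] in
theorem ztFaces_apply (m : ℕ) (x : ZTensor k I (SimplexCategory.mk m)) :
    ztFaces k I m x = ∑ i : Fin (m + 2), (-1 : k) ^ (i : ℕ) • ztMap k I (SimplexCategory.δ i) x := by
  rw [ztFaces, LinearMap.sum_apply]
  rfl

omit [LinearOrder I] in
theorem ztFaces_mem {m : ℕ} {r : ℤ} {x : ZTensor k I (SimplexCategory.mk m)}
    (hx : x ∈ ztDeg k I _ r) : ztFaces k I m x ∈ ztDeg k I _ r := by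
  rw [ztFaces_apply]
  exact sum_mem fun i _ => Submodule.smul_mem _ _ (ztMap_mem _ hx)

omit [LinearOrder I] in
theorem ztAug_ztFaces_zero (x : ZTensor k I (SimplexCategory.mk 0)) :
    ztAug k I _ (ztFaces k I 0 x) = 0 := by
  have h : ∀ i : Fin 2, ztAug k I _ (ztMap k I (SimplexCategory.δ i) x) = ztAug k I _ x :=
    fun i => LinearMap.congr_fun (ztAug_comp_ztMap _) x
  rw [ztFaces_apply, Fin.sum_univ_two, map_add, map_smul, map_smul, h, h]
  simp

theorem zD_zId_succ (m : ℕ) : zD k _ (zId k (m + 1)) =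
    ∑ i : Fin (m + 2), (-1 : k) ^ (i : ℕ) • zMap k (SimplexCategory.δ i) (zId k m) := by
  rw [zD_single]
  simp [simplexBoundary]

-- The boundary of `id_[m + 1]` is the alternating sum of the images of `id_[m]` under the cofaces,
-- and `φ` commutes with these.
omit [Fintype I] [LinearOrder I] in
theorem natural_zD_zId {φ : EZObj k I} (hφ : ∀ {n n' : SimplexCategory} (f : n ⟶ n')
    (z : ZChain k n), φ n' (zMap k f z) = ztMap k I f (φ n z)) (m : ℕ) :
    φ _ (zD k _ (zId k (m + 1))) = ztFaces k I m (φ _ (zId k m)) := by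
  rw [zD_zId_succ, map_sum, ztFaces_apply]
  exact Finset.sum_congr rfl fun i _ => by rw [map_smul, hφ]

/-- The natural family `Z → Z^{⊗ I}` with given values at the generators of `Z`. -/
noncomputable def ezOfSeq (y : ∀ m : ℕ, ZTensor k I (SimplexCategory.mk m)) : EZObj k I :=
  fun n => Finsupp.linearCombination k fun s : Simplices n => ztMap k I s.2 (y s.1)

omit [Fintype I] [LinearOrder I] in
theorem ezOfSeq_single (y : ∀ m : ℕ, ZTensor k I (SimplexCategory.mk m)) {n : SimplexCategory}
    (s : Simplices n) : ezOfSeq y n (Finsupp.single s 1) = ztMap k I s.2 (y s.1) := by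
  rw [ezOfSeq, Finsupp.linearCombination_single, one_smul]

omit [Fintype I] [LinearOrder I] in
theorem ezOfSeq_zId (y : ∀ m : ℕ, ZTensor k I (SimplexCategory.mk m)) (m : ℕ) :
    ezOfSeq y _ (zId k m) = y m := by
  rw [ezOfSeq_single, ztMap_id]
  rfl

omit [LinearOrder I] in
theorem ezOfSeq_mem {y : ∀ m : ℕ, ZTensor k I (SimplexCategory.mk m)} {r : ℤ}
    (hy : ∀ m : ℕ, y m ∈ ztDeg k I _ (-(m : ℤ) + r)) : ezOfSeq y ∈ ezDeg k I r := by
  refine mem_ezDeg (fun f => zChain_hom_ext fun s => ?_) fun n s => ?_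
  · rw [LinearMap.comp_apply, LinearMap.comp_apply, zMap_single, ezOfSeq_single, ezOfSeq_single,
      ztMap_comp]
    rfl
  · rw [ezOfSeq_single]
    exact ztMap_mem _ (hy s.1)

theorem ezD_zId_zero {r : ℤ} {φ : EZObj k I} (hφ : φ ∈ ezDeg k I r) :
    ezD k I φ _ (zId k 0) = ztD k I _ (φ _ (zId k 0)) := by
  rw [ezD_of_mem hφ, LinearMap.sub_apply, LinearMap.smul_apply, LinearMap.comp_apply,
    LinearMap.comp_apply, zD_zId_zero, map_zero, smul_zero]
  exact sub_zero _

theorem ezD_zId_succ {r : ℤ} {φ : EZObj k I} (hφ : φ ∈ ezDeg k I r) (m : ℕ) :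
    ezD k I φ _ (zId k (m + 1)) =
      ztD k I _ (φ _ (zId k (m + 1))) - ksign k r • ztFaces k I m (φ _ (zId k m)) := by
  rw [ezD_of_mem hφ, LinearMap.sub_apply, LinearMap.smul_apply, LinearMap.comp_apply,
    LinearMap.comp_apply, natural_zD_zId hφ.1]

/-- Cocycles of `𝒵(I)` are coboundaries of maps with a prescribed value at the vertex of `Δ^0`. -/
theorem exists_ezD_eq {r : ℤ} {φ : EZObj k I} (hφ : φ ∈ ezDeg k I (r + 1)) (hd : ezD k I φ = 0)
    (hr : r < 0 ∨ r = 0 ∧ φ = 0) {y₀ : ZTensor k I (SimplexCategory.mk 0)}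
    (hy₀ : y₀ ∈ ztDeg k I _ r) (h₀ : ztD k I _ y₀ = φ _ (zId k 0)) :
    ∃ χ ∈ ezDeg k I r, ezD k I χ = φ ∧ χ _ (zId k 0) = y₀ := by
  -- At `id_[m + 1]` the equation `dχ = φ` reads `d y_{m + 1} = c` with `c = φ(id_[m + 1]) + (-1)^r
  -- faces(y_m)`. The contraction gives a solution as soon as `c` is a cocycle of augmentation `0`.
  let y : ∀ m : ℕ, ZTensor k I (SimplexCategory.mk m) := fun m =>
    Nat.rec y₀ (fun m y => ztCone k I (m + 1) (φ _ (zId k (m + 1)) + ksign k r • ztFaces k I m y)) m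
  have hy : ∀ m, y (m + 1) =
    ztCone k I (m + 1) (φ _ (zId k (m + 1)) + ksign k r • ztFaces k I m (y m)) := fun m => rfl
  have hc : ∀ m : ℕ, y m ∈ ztDeg k I _ (-(m : ℤ) + r) →
      φ _ (zId k (m + 1)) + ksign k r • ztFaces k I m (y m) ∈ ztDeg k I _ (-(m : ℤ) + r) := by
    intro m hm
    refine add_mem ?_ (Submodule.smul_mem _ _ (ztFaces_mem hm))
    have := hφ.2 _ _ _ (zId_mem (m + 1))
    rwa [show -((m + 1 : ℕ) : ℤ) + (r + 1) = -(m : ℤ) + r by push_cast; ring] at this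
  have hmem : ∀ m : ℕ, y m ∈ ztDeg k I _ (-(m : ℤ) + r) := by
    intro m
    induction m with
    | zero =>
      rw [Nat.cast_zero, neg_zero, zero_add]
      exact hy₀
    | succ m ih =>
      rw [hy, show -((m + 1 : ℕ) : ℤ) + r = -(m : ℤ) + r - 1 by push_cast; ring]
      exact ztCone_mem (hc m ih)
  -- For degree reasons the augmentation matters only for `r = m = 0`; then `φ = 0`, and the two
  -- faces of a tensor over `Δ^0` have the same augmentation.
  have haug : ∀ m, ztAug k I _ (φ _ (zId k (m + 1)) + ksign k r • ztFaces k I m (y m)) = 0 := by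
    intro m
    by_cases h : -(m : ℤ) + r = 0
    · obtain ⟨rfl, rfl⟩ : r = 0 ∧ φ = 0 := by
        rcases hr with hr | hr
        · omega
        · exact hr
      obtain rfl : m = 0 := by omega
      rw [map_add, map_smul, ztAug_ztFaces_zero, smul_zero, add_zero]
      exact map_zero _
    · exact ztAug_of_mem h (hc m (hmem m))
  have hχ : ezOfSeq y ∈ ezDeg k I r := ezOfSeq_mem hmem
  refine ⟨ezOfSeq y, hχ, ?_, ezOfSeq_zId y 0⟩
  have hψ : ezD k I (ezOfSeq y) - φ ∈ ezDeg k I (r + 1) := sub_mem (ezD_mem hχ) hφ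
  have hψd : ezD k I (ezD k I (ezOfSeq y) - φ) = 0 := by
    rw [map_sub, ezD_ezD hχ, hd, sub_zero]
  refine ezDeg_ext (ezDeg_comp_zMap (ezD_mem hχ)) (ezDeg_comp_zMap hφ) fun m => ?_
  induction m with
  | zero =>
    refine (ezD_zId_zero hχ).trans ?_
    rw [ezOfSeq_zId]
    exact h₀
  | succ m ih =>
    set c := φ _ (zId k (m + 1)) + ksign k r • ztFaces k I m (y m) with hcdef
    have h1 : ezD k I (ezOfSeq y) _ (zId k (m + 1)) =
        ztD k I _ (y (m + 1)) - ksign k r • ztFaces k I m (y m) := by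
      rw [ezD_zId_succ hχ, ezOfSeq_zId, ezOfSeq_zId]
    -- That `c` is a cocycle needs no computation with faces: `dχ - φ` is a cocycle vanishing at
    -- `id_[m]` by induction, so its value `d y_{m + 1} - c` at `id_[m + 1]` is closed.
    have h2 := ezD_zId_succ hψ m
    have h3 : (ezD k I (ezOfSeq y) - φ) _ (zId k m) = 0 := sub_eq_zero.2 ih
    have h4 : (ezD k I (ezOfSeq y) - φ) _ (zId k (m + 1)) = ztD k I _ (y (m + 1)) - c := by
      change ezD k I (ezOfSeq y) _ (zId k (m + 1)) - φ _ (zId k (m + 1)) = _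
      rw [h1, hcdef]
      abel
    have h5 : ztD k I _ (ztD k I _ (y (m + 1))) = 0 := LinearMap.congr_fun ztD_comp_ztD _
    rw [hψd, h3, h4, map_zero, smul_zero, map_sub, h5] at h2
    have h6 : ztD k I _ c = 0 := neg_eq_zero.1 ((zero_sub _).symm.trans ((sub_zero _).symm.trans h2.symm))
    have h7 : ztD k I _ (y (m + 1)) = c := ztD_ztCone h6 (haug m)
    refine h1.trans ?_
    rw [h7, hcdef]
    exact add_sub_cancel_right _ _

/-- The value at the vertex is closed with augmentation `0`, hence a boundary of its cone, which
starts the induction. The primitive has negative degree, so no further obstruction arises. -/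
theorem exists_ezD_eq_of_cocycle {r : ℤ} (hr : r ≤ 0) {φ : EZObj k I} (hφ : φ ∈ ezDeg k I r)
    (hd : ezD k I φ = 0) (hε : ezAug k I φ = 0) : ∃ χ ∈ ezDeg k I (r - 1), ezD k I χ = φ := by
  have h0 : φ _ (zId k 0) ∈ ztDeg k I _ r := by
    simpa using hφ.2 _ _ _ (zId_mem 0)
  have h1 : ztD k I _ (φ _ (zId k 0)) = 0 := by
    rw [← ezD_zId_zero hφ, hd]
    rfl
  obtain ⟨χ, hχ, h, -⟩ := exists_ezD_eq (r := r - 1) (φ := φ) (by rwa [sub_add_cancel]) hd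
    (Or.inl (by omega)) (ztCone_mem h0) (ztD_ztCone h1 hε)
  exact ⟨χ, hχ, h⟩

-- The tensor power of the vertex of `Δ^0` extends to a cocycle of degree `0`, that is, to an
-- approximation of the diagonal.
variable (k I) in
theorem exists_cocycle_ezAug_eq_one :
    ∃ φ ∈ ezDeg k I 0, ezD k I φ = 0 ∧ ezAug k I φ = 1 := by
  have hb : ztBasis k I (SimplexCategory.mk 0) (fun _ => ⟨0, 𝟙 _⟩) =
    PiTensorProduct.tprod k fun _ => zId k 0 := ztBasis_apply _ _
  obtain ⟨χ, hχ, h, h0⟩ := exists_ezD_eq (k := k) (I := I) (r := 0) (φ := 0) (zero_mem _)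
    (map_zero _) (Or.inr ⟨rfl, rfl⟩) (y₀ := ztBasis k I _ fun _ => ⟨0, 𝟙 _⟩)
    (ztBasis_mem _ (by simp)) (by
      rw [ztD_eq_sum, LinearMap.sum_apply]
      refine Finset.sum_eq_zero fun i _ => ?_
      rw [hb, ztDAt, PiTensorProduct.map_tprod]
      refine (PiTensorProduct.tprod k).map_coord_zero i ?_
      rw [if_neg (lt_irrefl i), if_pos rfl, zD_zId_zero])
  refine ⟨χ, hχ, h, ?_⟩
  rw [ezAug_apply, h0, ztAug_ztBasis]
  simp

/-- The coordinate in `𝒵(I)` of an element of `𝒴(I)` with respect to an element of a basis of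
`Lie(I)`. -/
noncomputable def lieEZCoord {κ : Type*} [DecidableEq κ] (b : Module.Basis κ k (LieOp k I)) (j : κ) :
    EZObj k I ⊗[k] LieOp k I →ₗ[k] EZObj k I :=
  Finsupp.lapply j ∘ₗ (TensorProduct.equivFinsuppOfBasisRight b).toLinearMap

omit [Fintype I] [LinearOrder I] in
theorem lieEZCoord_tmul {κ : Type*} [DecidableEq κ] (b : Module.Basis κ k (LieOp k I)) (j : κ)
    (φ : EZObj k I) (ψ : LieOp k I) : lieEZCoord b j (φ ⊗ₜ ψ) = b.repr ψ j • φ :=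
  TensorProduct.equivFinsuppOfBasisRight_apply_tmul_apply b φ ψ j

/-- The differential acts on `𝒵(I)` only, so the coordinates with respect to a basis of `Lie(I)` are
cocycles of augmentation `0` in `𝒵(I)`, and their primitives are reassembled. -/
theorem exists_lieEZ_d_eq {n : ℤ} (hn : n ≤ 0) {x : EZObj k I ⊗[k] LieOp k I}
    (hx : x ∈ lieEZDeg k I n) (hd : (ezD k I).rTensor (LieOp k I) x = 0)
    (hε : lieEZAug k I x = 0) :
    ∃ y ∈ lieEZDeg k I (n - 1), (ezD k I).rTensor (LieOp k I) y = x := by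
  classical
  set b := Module.Basis.ofVectorSpace k (LieOp k I)
  have h1 : ∀ j, lieEZCoord b j x ∈ ezDeg k I n := fun j =>
    mem_of_mem_lieEZDeg (lieEZCoord b j) _ (fun φ hφ ψ => by
      rw [lieEZCoord_tmul]
      exact Submodule.smul_mem _ _ hφ) hx
  have h2 : ∀ j, ezD k I (lieEZCoord b j x) = 0 := fun j => by
    have : ezD k I ∘ₗ lieEZCoord b j = lieEZCoord b j ∘ₗ (ezD k I).rTensor (LieOp k I) :=
      TensorProduct.ext' fun φ ψ => by
        rw [LinearMap.comp_apply, LinearMap.comp_apply, ezD_rTensor_tmul, lieEZCoord_tmul,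
          lieEZCoord_tmul, map_smul]
    have := LinearMap.congr_fun this x
    rwa [LinearMap.comp_apply, LinearMap.comp_apply, hd, map_zero] at this
  have h3 : ∀ j, ezAug k I (lieEZCoord b j x) = 0 := fun j => by
    have : ezAug k I ∘ₗ lieEZCoord b j = (Finsupp.lapply j ∘ₗ b.repr.toLinearMap) ∘ₗ lieEZAug k I :=
      TensorProduct.ext' fun φ ψ => by
        rw [LinearMap.comp_apply, LinearMap.comp_apply, lieEZCoord_tmul, lieEZAug_tmul, map_smul,
          map_smul, smul_eq_mul, smul_eq_mul, mul_comm]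
        rfl
    have := LinearMap.congr_fun this x
    rwa [LinearMap.comp_apply, LinearMap.comp_apply, hε, map_zero] at this
  choose χ hχ hχd using fun j => exists_ezD_eq_of_cocycle hn (h1 j) (h2 j) (h3 j)
  -- Only finitely many coordinates of `x` are nonzero, and primitives are taken for these alone.
  refine ⟨∑ j ∈ (TensorProduct.equivFinsuppOfBasisRight b x).support, χ j ⊗ₜ b j,
    sum_mem fun j _ => tmul_mem_lieEZDeg (hχ j) _, ?_⟩
  rw [map_sum]
  simp only [ezD_rTensor_tmul, hχd]
  have h4 := (TensorProduct.equivFinsuppOfBasisRight b).symm_apply_apply x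
  rw [TensorProduct.equivFinsuppOfBasisRight_symm_apply] at h4
  exact h4

theorem exists_lieEZ_cocycle (ψ : LieOp k I) :
    ∃ x ∈ lieEZDeg k I 0, (ezD k I).rTensor (LieOp k I) x = 0 ∧ lieEZAug k I x - ψ = 0 := by
  obtain ⟨φ, hφ, hd, hε⟩ := exists_cocycle_ezAug_eq_one k I
  refine ⟨φ ⊗ₜ ψ, tmul_mem_lieEZDeg hφ ψ, ?_, ?_⟩
  · rw [ezD_rTensor_tmul, hd, TensorProduct.zero_tmul]
  · rw [lieEZAug_tmul, hε, one_smul, sub_self]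

end Tensor

variable (k) in
theorem truncLieEZAug_isQuasiIso (I : Type) [Fintype I] [LinearOrder I] [Nonempty I] :
    DGOperadData.IsQuasiIso (truncLieEZAug k) I where
  injective n x hx hd hy := by
    obtain ⟨y, -, hy⟩ := hy
    -- The differential of the Lie operad is zero, so being a boundary there means having
    -- augmentation `0`.
    have hε : lieEZAug k I x = 0 := hy.symm
    have hx' : x ∈ lieEZDeg k I n :=
      DGOperadData.truncLEZero_deg_le (L := lieEilenbergZilber k) I n hx
    rcases lt_or_ge 0 n with hn | hn
    · refine ⟨0, zero_mem _, ?_⟩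
      have h0 : x = 0 := DGOperadData.eq_zero_of_mem_truncDeg (L := lieEilenbergZilber k) hn hx
      rw [h0]
      exact map_zero _
    -- The primitive has degree `n - 1 < 0`, where the truncation imposes no condition.
    · obtain ⟨y, hy, h⟩ := exists_lieEZ_d_eq hn hx' hd hε
      refine ⟨y, ?_, h⟩
      exact DGOperadData.mem_truncDeg (L := lieEilenbergZilber k) (by omega) hy
        fun h => absurd h (by omega)
  surjective n z hz _ := by
    change z ∈ (if n = 0 then ⊤ else ⊥ : Submodule k (LieOp k I)) at hz
    split_ifs at hz with hn
    · subst hn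
      obtain ⟨x, hx, hd, h⟩ := exists_lieEZ_cocycle (k := k) (I := I) z
      exact ⟨x, DGOperadData.mem_truncDeg (L := lieEilenbergZilber k) le_rfl hx fun _ => hd, hd, 0,
        zero_mem _, h⟩
    · refine ⟨0, zero_mem _, map_zero _, 0, zero_mem _, ?_⟩
      rw [map_zero, map_zero, zero_sub, neg_eq_zero]
      exact (Submodule.mem_bot k).1 hz

variable (k) in
theorem truncLieEZ_isHomotopyLieOperad : IsHomotopyLieOperad (truncLieEZ k) (truncLieEZAug k) where
  isDGOperad := (lieEilenbergZilber_isDGOperad k).truncLEZero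
  isOperadMap := truncLieEZAug_isOperadMap k
  isQuasiIso I _ _ _ := truncLieEZAug_isQuasiIso k I

end Contraction

/-! ## Composition with unary operations -/

namespace PseudoTensorCategory

variable {k : Type u} [Field k] (C : PseudoTensorCategory.{u, v, w} k)

section

variable {I : Type} {K : I → Type} [Finite I] [Nonempty I] [∀ i, Finite (K i)]
  [∀ i, Nonempty (K i)]

/-- Associativity of composition with a middle layer of unary operations, once the index sets are
identified; the relabellings agree. -/
theorem comp_precomp {z : (Σ i, K i) → C.Obj} {y y' : I → C.Obj} {x : C.Obj} (f : C.P I y x)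
    (h : ∀ i, C.P Unit (fun _ => y' i) (y i)) (g : ∀ i, C.P (K i) (fun j => z ⟨i, j⟩) (y' i)) :
    C.comp (z := z) (C.precomp f h) g =
      C.comp (z := z) f fun i => C.postcomp (h i) (g i) := by
  have h1 := C.relabel_comp (K := K) (Equiv.sigmaPUnit I) (z := z) (y := y')
    (C.comp (K := fun _ : I => Unit) (z := fun p => y' p.1) f h) g
  have h2 := C.comp_relabel (K := fun i => Σ _ : Unit, K i) (K' := K)
    (fun i => Equiv.uniqueSigma (fun _ : Unit => K i)) (z := z) f
    (fun i => C.comp (K := fun _ : Unit => K i) (z := fun p => z ⟨i, p.2⟩) (h i) (fun _ => g i))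
  have h3 := C.comp_assoc (K := fun _ : I => Unit) (L := fun i _ => K i)
    (t := fun s => z ⟨s.1, s.2.2⟩) (z := fun s => y' s.1) f h (fun i _ => g i)
  refine h1.trans (Eq.trans ?_ h2.symm)
  refine Eq.trans ?_ (congrArg _ h3)
  exact C.relabel_trans (Equiv.sigmaAssoc fun i (_ : Unit) => K i)
    (Equiv.sigmaCongrRight fun i => Equiv.uniqueSigma fun _ : Unit => K i) (y := z) _

theorem precomp_comp {z z' : (Σ i, K i) → C.Obj} {y : I → C.Obj} {x : C.Obj} (f : C.P I y x)
    (g : ∀ i, C.P (K i) (fun j => z ⟨i, j⟩) (y i)) (h : ∀ s, C.P Unit (fun _ => z' s) (z s)) :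
    C.precomp (C.comp (z := z) f g) h =
      C.comp (z := z') f fun i => C.precomp (g i) fun j => h ⟨i, j⟩ := by
  have h2 := C.comp_relabel (K := fun i => Σ _ : K i, Unit) (K' := K)
    (fun i => Equiv.sigmaPUnit (K i)) (z := z') f
    (fun i => C.comp (K := fun _ : K i => Unit) (z := fun p => z' ⟨i, p.1⟩) (g i)
      (fun j => h ⟨i, j⟩))
  have h3 := C.comp_assoc (K := K) (L := fun i _ => Unit)
    (t := fun s => z' ⟨s.1, s.2.1⟩) (z := z) f g (fun i j => h ⟨i, j⟩)
  refine Eq.trans ?_ h2.symm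
  refine Eq.trans ?_ (congrArg _ h3)
  exact C.relabel_trans (Equiv.sigmaAssoc fun i (_ : K i) => Unit)
    (Equiv.sigmaCongrRight fun i => Equiv.sigmaPUnit (K i)) (y := z') _

end

section

variable {I : Type} [Finite I] [Nonempty I]

theorem precomp_precomp {y y' y'' : I → C.Obj} {x : C.Obj} (f : C.P I y x)
    (h : ∀ i, C.P Unit (fun _ => y' i) (y i)) (h' : ∀ i, C.P Unit (fun _ => y'' i) (y' i)) :
    C.precomp (C.precomp f h) h' = C.precomp f fun i => C.postcomp (h i) (h' i) :=
  congrArg _ (C.comp_precomp (K := fun _ => Unit) (z := fun p => y'' p.1) f h h')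

theorem precomp_relabel {J : Type} [Finite J] [Nonempty J] (e : I ≃ J) {y y' : J → C.Obj}
    {x : C.Obj} (f : C.P I (fun i => y (e i)) x) (h : ∀ j, C.P Unit (fun _ => y' j) (y j)) :
    C.precomp (C.relabel e (y := y) f) h =
      C.relabel e (y := y') (C.precomp (y := fun i => y (e i)) (y' := fun i => y' (e i)) f
        fun i => h (e i)) := by
  have h1 := C.relabel_comp (K := fun _ : J => Unit) e (z := fun p => y' p.1) (y := y) f h
  refine (congrArg _ h1).trans ?_
  refine (C.relabel_trans (Equiv.sigmaCongrLeft (β := fun _ => Unit) e) (Equiv.sigmaPUnit J)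
    (y := y') _).symm.trans ?_
  exact C.relabel_trans (Equiv.sigmaPUnit I) e (y := y') _

/-- Unary operations on inputs and on the output commute: this is `precomp_comp` with a single outer
input. -/
theorem postcomp_precomp {y y' : I → C.Obj} {x x' : C.Obj} (g : C.P Unit (fun _ => x) x')
    (f : C.P I y x) (h : ∀ i, C.P Unit (fun _ => y' i) (y i)) :
    C.postcomp g (C.precomp f h) = C.precomp (C.postcomp g f) h := by
  have h1 := C.precomp_relabel (Equiv.uniqueSigma (fun _ : Unit => I)) (y := y) (y' := y')
    (C.comp (K := fun _ : Unit => I) (z := fun p => y p.2) g (fun _ => f)) h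
  refine Eq.trans ?_ h1.symm
  exact congrArg _ (C.precomp_comp (K := fun _ : Unit => I) (z := fun p => y p.2)
    (z' := fun p => y' p.2) g (fun _ => f) (fun p => h p.2)).symm

theorem precomp_unit {y x : C.Obj} (h : C.P Unit (fun _ => y) x) :
    C.precomp (C.unit x) (fun _ => h) = h :=
  (C.relabel_unit_eq _ _ _).trans (C.unit_comp h)

/-- Composition with unary operations on the inputs is multilinear. -/
def precompMultilinear {y : I → C.Obj} {x : C.Obj} (y' : I → C.Obj) (f : C.P I y x) :
    MultilinearMap k (fun i => C.P Unit (fun _ => y' i) (y i)) (C.P I y' x) :=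
  (C.relabel (Equiv.sigmaPUnit I) (y := y')).compMultilinearMap
    (C.comp (K := fun _ : I => Unit) (z := fun p => y' p.1) f)

theorem precompMultilinear_apply {y : I → C.Obj} {x : C.Obj} (y' : I → C.Obj) (f : C.P I y x)
    (h : ∀ i, C.P Unit (fun _ => y' i) (y i)) :
    C.precompMultilinear y' f h = C.precomp f h := rfl

/-- Composition with unary operations on the inputs is linear in the operation. -/
def precompLinear {y y' : I → C.Obj} {x : C.Obj} (h : ∀ i, C.P Unit (fun _ => y' i) (y i)) :
    C.P I y x →ₗ[k] C.P I y' x where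
  toFun f := C.precomp f h
  map_add' f f' := C.precomp_add f f' h
  map_smul' c f := C.precomp_smul c f h

theorem precompLinear_apply {y y' : I → C.Obj} {x : C.Obj}
    (h : ∀ i, C.P Unit (fun _ => y' i) (y i)) (f : C.P I y x) :
    C.precompLinear h f = C.precomp f h := rfl

/-- Composition with a unary operation on the output, as a bilinear map. -/
def postcompLinear (y : I → C.Obj) (x x' : C.Obj) :
    C.P Unit (fun _ => x) x' →ₗ[k] C.P I y x →ₗ[k] C.P I y x' :=
  LinearMap.mk₂ k (fun g f => C.postcomp g f)
    (fun g g' f => by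
      simp only [postcomp, map_add, add_apply]
      exact map_add _ _ _)
    (fun c g f => by
      simp only [postcomp, map_smul, smul_apply]
      exact map_smul _ _ _)
    (fun g f f' => C.postcomp_add g f f')
    (fun c g f => C.postcomp_smul g c f)

theorem postcompLinear_apply {y : I → C.Obj} {x x' : C.Obj} (g : C.P Unit (fun _ => x) x')
    (f : C.P I y x) : C.postcompLinear y x x' g f = C.postcomp g f := rfl

end

end PseudoTensorCategory

/-! ## Chains acting on a cosimplicial object -/

namespace PseudoTensorCategory

variable {k : Type u} [Field k] {C : PseudoTensorCategory.{u, v, w} k}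
  (X : CosimplicialObject C.Obj)

/-- The operation `X^m → X^n` induced by a morphism `[m] → n`. -/
def mapOp {m n : SimplexCategory} (f : m ⟶ n) : C.P Unit (fun _ => X.obj m) (X.obj n) := X.map f

theorem mapOp_id (n : SimplexCategory) : mapOp X (𝟙 n) = C.unit (X.obj n) :=
  X.map_id n

theorem mapOp_comp {m n n' : SimplexCategory} (f : m ⟶ n) (g : n ⟶ n') :
    mapOp X (f ≫ g) = C.postcomp (mapOp X g) (mapOp X f) :=
  X.map_comp f g

/-- The operation `X^m → X^n` induced by a chain on `Δ^n`: the component of degree `m` of the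
chain acts through `X`. -/
noncomputable def chainOp (m : ℕ) (n : SimplexCategory) :
    ZChain k n →ₗ[k] C.P Unit (fun _ => X.obj (SimplexCategory.mk m)) (X.obj n) :=
  ∑ f : SimplexCategory.mk m ⟶ n,
    (Finsupp.lapply (⟨m, f⟩ : Simplices n) : ZChain k n →ₗ[k] k).smulRight (mapOp X f)

variable {X} {n : SimplexCategory}

theorem chainOp_single_self {m : ℕ} (f : SimplexCategory.mk m ⟶ n) :
    chainOp X m n (Finsupp.single ⟨m, f⟩ 1) = mapOp X f := by
  classical
  rw [chainOp, LinearMap.sum_apply, Finset.sum_eq_single f]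
  · simp
  · intro g _ hg
    rw [LinearMap.smulRight_apply, Finsupp.lapply_apply, Finsupp.single_apply, if_neg, zero_smul]
    simpa using fun h => hg h.symm
  · simp

theorem chainOp_single_of_ne {m : ℕ} {s : Simplices n} (h : s.1 ≠ m) :
    chainOp X m n (Finsupp.single s 1) = 0 := by
  classical
  rw [chainOp, LinearMap.sum_apply]
  refine Finset.sum_eq_zero fun g _ => ?_
  rw [LinearMap.smulRight_apply, Finsupp.lapply_apply, Finsupp.single_apply, if_neg, zero_smul]
  rintro rfl
  exact h rfl

theorem chainOp_zMap (m : ℕ) {n' : SimplexCategory} (f : n ⟶ n') (z : ZChain k n) :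
    chainOp X m n' (zMap k f z) = C.postcomp (mapOp X f) (chainOp X m n z) := by
  refine LinearMap.congr_fun (f := chainOp X m n' ∘ₗ zMap k f)
    (g := C.postcompLinear _ _ _ (mapOp X f) ∘ₗ chainOp X m n) (zChain_hom_ext fun s => ?_) z
  obtain ⟨m', s⟩ := s
  rw [LinearMap.comp_apply, LinearMap.comp_apply, zMap_single, postcompLinear_apply]
  by_cases h : m' = m
  · subst h
    rw [chainOp_single_self, chainOp_single_self, mapOp_comp]
  · rw [chainOp_single_of_ne (s := ⟨m', s ≫ f⟩) h, chainOp_single_of_ne (s := ⟨m', s⟩) h]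
    exact (map_zero (C.postcompLinear _ _ _ (mapOp X f))).symm

theorem chainOp_zSign (m : ℕ) (r : ℤ) (z : ZChain k n) :
    chainOp X m n (zSign k n r z) = ksign k (r * m) • chainOp X m n z := by
  refine LinearMap.congr_fun (f := chainOp X m n ∘ₗ zSign k n r)
    (g := ksign k (r * m) • chainOp X m n) (zChain_hom_ext fun s => ?_) z
  rw [LinearMap.comp_apply, zSign_single_one, map_smul, LinearMap.smul_apply]
  by_cases h : s.1 = m
  · rw [h]
  · rw [chainOp_single_of_ne h, smul_zero, smul_zero]

theorem chainOp_of_mem {m : ℕ} {p : ℤ} (hp : p ≠ -(m : ℤ)) {z : ZChain k n}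
    (hz : z ∈ zDeg k n p) : chainOp X m n z = 0 := by
  rw [zDeg_eq_span] at hz
  refine LinearMap.eqOn_span (f := chainOp X m n) (g := 0) ?_ hz
  rintro _ ⟨s, hs, rfl⟩
  refine chainOp_single_of_ne fun h => hp ?_
  rw [← hs.out, h]

variable (X) in
/-- The alternating sum of the cofaces. -/
noncomputable def cofaceOp (m : ℕ) :
    C.P Unit (fun _ => X.obj (SimplexCategory.mk m)) (X.obj (SimplexCategory.mk (m + 1))) :=
  ∑ i : Fin (m + 2), (-1 : k) ^ (i : ℕ) • mapOp X (SimplexCategory.δ i)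

/-- For an `(m + 1)`-simplex `s` the boundary acts by the alternating sum of the `X(s ∘ δ^i)`, which
is `X(s)` composed with the alternating sum of cofaces. So the boundary of a chain becomes the
differential of the input. -/
theorem chainOp_zD (m : ℕ) (z : ZChain k n) :
    chainOp X m n (zD k n z) = C.postcomp (chainOp X (m + 1) n z) (cofaceOp X m) := by
  refine LinearMap.congr_fun (f := chainOp X m n ∘ₗ zD k n)
    (g := (C.postcompLinear _ _ _).flip (cofaceOp X m) ∘ₗ chainOp X (m + 1) n)
    (zChain_hom_ext fun s => ?_) z
  rw [LinearMap.comp_apply, LinearMap.comp_apply, zD_single, LinearMap.flip_apply]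
  by_cases h : s.1 = m + 1
  · obtain ⟨m', s⟩ := s
    obtain rfl : m' = m + 1 := h
    rw [chainOp_single_self, cofaceOp, map_sum, simplexBoundary, map_sum]
    refine Finset.sum_congr rfl fun i _ => ?_
    rw [map_smul, postcompLinear_apply, ← mapOp_comp, ← Finsupp.smul_single_one, map_smul,
      chainOp_single_self]
  · rw [chainOp_single_of_ne h]
    refine (chainOp_of_mem ?_ (simplexBoundary_mem s)).trans ?_
    · intro h'
      exact h (by omega)
    · rw [map_zero]
      rfl

theorem chainOp_zId (m : ℕ) : chainOp X m _ (zId k m) = C.unit _ := by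
  rw [chainOp_single_self, mapOp_id]

end PseudoTensorCategory

/-! ## Tensors of chains acting on a cosimplicial Lie algebra -/

namespace CosimplicialLieAlgebra

open PseudoTensorCategory

variable {k : Type u} [Field k] {C : PseudoTensorCategory.{u, v, w} k}
  (B : CosimplicialLieAlgebra C) {I : Type}

/-- For `ψ ∈ Lie(I)`, the operation `{B^(a i)}_{i ∈ I} → B^n` induced by a tensor in
`Z([n])^{⊗ I}`. -/
noncomputable def tensorOp [Finite I] [Nonempty I] (ψ : LieOp k I) (a : I → ℕ)
    (n : SimplexCategory) : ZTensor k I n →ₗ[k]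
      C.P I (fun i => B.toCosimplicial.obj (SimplexCategory.mk (a i))) (B.toCosimplicial.obj n) :=
  PiTensorProduct.lift ((C.precompMultilinear
    (fun i => B.toCosimplicial.obj (SimplexCategory.mk (a i)))
    ((B.lie n).act I ψ)).compLinearMap fun i => chainOp B.toCosimplicial (a i) n)

variable {B} {n : SimplexCategory}

theorem tensorOp_tprod [Finite I] [Nonempty I] (ψ : LieOp k I) (a : I → ℕ) (z : I → ZChain k n) :
    B.tensorOp ψ a n (PiTensorProduct.tprod k z) =
      C.precomp ((B.lie n).act I ψ) fun i => chainOp B.toCosimplicial (a i) n (z i) := by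
  rw [tensorOp, PiTensorProduct.lift.tprod]
  rfl

theorem tensorOp_tprod_of_eq_zero [Finite I] [Nonempty I] (ψ : LieOp k I) (a : I → ℕ)
    (z : I → ZChain k n) (i : I) (h : chainOp B.toCosimplicial (a i) n (z i) = 0) :
    B.tensorOp ψ a n (PiTensorProduct.tprod k z) = 0 := by
  rw [tensorOp_tprod, ← precompMultilinear_apply]
  exact (C.precompMultilinear _ _).map_coord_zero i h

/-- Here it is used that the structure maps of `B` are morphisms of Lie algebras: `B(f)` moves from
the output of `ψ` to all its inputs. -/
theorem tensorOp_ztMap [Finite I] [Nonempty I] (ψ : LieOp k I) (a : I → ℕ) {n' : SimplexCategory}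
    (f : n ⟶ n') (x : ZTensor k I n) :
    B.tensorOp ψ a n' (ztMap k I f x) =
      C.postcomp (mapOp B.toCosimplicial f) (B.tensorOp ψ a n x) := by
  refine LinearMap.congr_fun (f := B.tensorOp ψ a n' ∘ₗ ztMap k I f)
    (g := C.postcompLinear _ _ _ (mapOp B.toCosimplicial f) ∘ₗ B.tensorOp ψ a n)
    ((ztBasis k I n).ext fun s => ?_) x
  rw [LinearMap.comp_apply, LinearMap.comp_apply, ztBasis_apply, ztMap_tprod, tensorOp_tprod,
    tensorOp_tprod, postcompLinear_apply, postcomp_precomp]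
  have h : C.postcomp (mapOp B.toCosimplicial f) ((B.lie n).act I ψ) =
      C.precomp ((B.lie n').act I ψ) fun _ => mapOp B.toCosimplicial f := B.map_act f I ψ
  rw [h, precomp_precomp]
  simp only [chainOp_zMap]

/-- Unless the total degree is that of the inputs, some simplex has the wrong dimension and acts by
zero. -/
theorem tensorOp_of_mem [Fintype I] [Nonempty I] (ψ : LieOp k I) {a : I → ℕ} {p : ℤ}
    (hp : p ≠ -∑ i, (a i : ℤ)) {x : ZTensor k I n} (hx : x ∈ ztDeg k I n p) :
    B.tensorOp ψ a n x = 0 := by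
  refine ztDeg_induction (P := fun x => B.tensorOp ψ a n x = 0) (fun s hs => ?_) (map_zero _)
    (fun x y hx hy => by rw [map_add, hx, hy, add_zero])
    (fun c x hx => by rw [map_smul, hx, smul_zero]) hx
  obtain ⟨i, hi⟩ : ∃ i, (s i).1 ≠ a i := by
    by_contra! h
    exact hp (by rw [← hs, Finset.sum_neg_distrib]; simp [h])
  rw [ztBasis_apply]
  exact tensorOp_tprod_of_eq_zero ψ a _ i (chainOp_single_of_ne hi)

/-- If the dimensions of the simplices are those of the inputs, the Koszul sign of the tensor is
that of the inputs; otherwise both sides vanish. -/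
theorem tensorOp_ztPerm {J : Type} [Fintype I] [LinearOrder I] [Nonempty I] [Fintype J]
    [LinearOrder J] [Nonempty J] (e : I ≃ J) (ψ : LieOp k I) (a : J → ℕ) (x : ZTensor k I n) :
    B.tensorOp (lieRelabel e ψ) a n (ztPerm k e n x) =
      koszulSign k e (fun i => (a (e i) : ℤ)) • C.relabel e
        (y := fun j => B.toCosimplicial.obj (SimplexCategory.mk (a j)))
        (B.tensorOp ψ (fun i => a (e i)) n x) := by
  refine LinearMap.congr_fun (f := B.tensorOp (lieRelabel e ψ) a n ∘ₗ ztPerm k e n)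
    (g := koszulSign k e (fun i => (a (e i) : ℤ)) • C.relabel e
      (y := fun j => B.toCosimplicial.obj (SimplexCategory.mk (a j))) ∘ₗ
        B.tensorOp ψ (fun i => a (e i)) n) ((ztBasis k I n).ext fun s => ?_) x
  rw [LinearMap.comp_apply, ztPerm_ztBasis, map_smul, LinearMap.smul_apply, LinearMap.comp_apply,
    ztBasis_apply, ztBasis_apply]
  by_cases h : ∀ i, (s i).1 = a (e i)
  · simp only [h]
    rw [tensorOp_tprod, tensorOp_tprod, (B.lie n).act_relabel,
      C.precomp_relabel e (y := fun _ => B.toCosimplicial.obj n)]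
    simp only [Equiv.symm_apply_apply]
  · obtain ⟨i, hi⟩ := not_forall.1 h
    rw [tensorOp_tprod_of_eq_zero ψ _ _ i (chainOp_single_of_ne hi),
      tensorOp_tprod_of_eq_zero (lieRelabel e ψ) _ _ (e i)
        (chainOp_single_of_ne (by simpa using hi)), map_zero, smul_zero, smul_zero]

theorem tensorOp_ztFlatten {K : I → Type} [Finite I] [Nonempty I] [∀ i, Finite (K i)]
    [∀ i, Nonempty (K i)] (ψ : LieOp k I) (χ : ∀ i, LieOp k (K i)) (a : (Σ i, K i) → ℕ)
    (x : ∀ i, ZTensor k (K i) n) :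
    B.tensorOp (lieComp ψ χ) a n (ztFlatten k n (PiTensorProduct.tprod k x)) =
      C.comp (z := fun s => B.toCosimplicial.obj (SimplexCategory.mk (a s)))
        (y := fun _ => B.toCosimplicial.obj n) ((B.lie n).act I ψ) fun i =>
          B.tensorOp (χ i) (fun j => a ⟨i, j⟩) n (x i) := by
  have h : (B.tensorOp (lieComp ψ χ) a n ∘ₗ ztFlatten k n).compMultilinearMap
      (PiTensorProduct.tprod k) =
      (C.comp (z := fun s => B.toCosimplicial.obj (SimplexCategory.mk (a s)))
        (y := fun _ => B.toCosimplicial.obj n) ((B.lie n).act I ψ)).compLinearMap fun i =>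
          B.tensorOp (χ i) (fun j => a ⟨i, j⟩) n := by
    refine multilinear_ztensor_ext fun s => ?_
    rw [LinearMap.compMultilinearMap_apply, LinearMap.comp_apply, ztFlatten_basis, ztBasis_apply,
      tensorOp_tprod, MultilinearMap.compLinearMap_apply]
    simp only [ztBasis_apply, tensorOp_tprod]
    refine (congrArg (fun f => C.precomp f _) ((B.lie n).act_comp ψ χ)).trans ?_
    exact C.precomp_comp (z := fun _ => B.toCosimplicial.obj n) _ _ _
  exact congrArg (fun F => F x) h

/-- The differential of an input. -/
theorem tensorOp_map_update_zD [Fintype I] [LinearOrder I] [Nonempty I] (ψ : LieOp k I)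
    (a : I → ℕ) (i : I) (x : ZTensor k I n)
    (h : ∀ j, C.P Unit (fun _ => B.toCosimplicial.obj (SimplexCategory.mk (a j)))
      (B.toCosimplicial.obj (SimplexCategory.mk (Function.update a i (a i + 1) j))))
    (hi : ∀ z : ZChain k n, C.postcomp (chainOp B.toCosimplicial _ n z) (h i) =
      chainOp B.toCosimplicial (a i) n (zD k n z))
    (hj : ∀ j ≠ i, ∀ z : ZChain k n, C.postcomp (chainOp B.toCosimplicial _ n z) (h j) =
      chainOp B.toCosimplicial (a j) n z) :
    ksign k (∑ i' with i' < i, (a i' : ℤ)) •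
      C.precomp (B.tensorOp ψ (Function.update a i (a i + 1)) n x) h =
      B.tensorOp ψ a n (ztDAt k n i x) := by
  refine LinearMap.congr_fun (f := ksign k (∑ i' with i' < i, (a i' : ℤ)) •
    ((C.precompLinear h) ∘ₗ B.tensorOp ψ (Function.update a i (a i + 1)) n))
    (g := B.tensorOp ψ a n ∘ₗ ztDAt k n i) ((ztBasis k I n).ext fun s => ?_) x
  rw [LinearMap.smul_apply, LinearMap.comp_apply, LinearMap.comp_apply, ztBasis_apply, ztDAt,
    PiTensorProduct.map_tprod, tensorOp_tprod, tensorOp_tprod, precompLinear_apply,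
    precomp_precomp]
  -- The sign operators in the slots before `i` act through the input degrees there; their product
  -- is the Koszul sign of `f ∘_i d`.
  have h1 : ∀ j, chainOp B.toCosimplicial (a j) n
      ((if j < i then zSign k n 1 else if j = i then zD k n else LinearMap.id)
        (Finsupp.single (s j) 1)) = (if j < i then ksign k (a j) else 1) •
      C.postcomp (chainOp B.toCosimplicial _ n (Finsupp.single (s j) 1)) (h j) := by
    intro j
    rcases lt_trichotomy j i with hji | rfl | hji
    · rw [if_pos hji, if_pos hji, chainOp_zSign, one_mul, hj j hji.ne]
    · rw [if_neg (lt_irrefl _), if_neg (lt_irrefl _), if_pos rfl, one_smul, hi]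
    · rw [if_neg hji.not_gt, if_neg hji.not_gt, if_neg hji.ne', one_smul, hj j hji.ne',
        LinearMap.id_apply]
  rw [funext h1, ← precompMultilinear_apply, ← precompMultilinear_apply,
    MultilinearMap.map_smul_univ, ksign_sum, Finset.prod_filter]

end CosimplicialLieAlgebra

/-! ## Signs of degree shifts -/

section ShiftSign

/-- The sign `(-1)^(r (r + 1) / 2)`. -/
def shiftSign (k : Type u) [Field k] (r : ℤ) : k := ksign k (r * (r + 1) / 2)

variable {k : Type u} [Field k]

@[simp] theorem shiftSign_zero : shiftSign k 0 = 1 := by simp [shiftSign]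

/-- The function `r (r + 1) / 2` fails to be additive exactly by `r s`. -/
theorem shiftSign_add (r s : ℤ) :
    shiftSign k (r + s) = shiftSign k r * shiftSign k s * ksign k (r * s) := by
  rw [shiftSign, shiftSign, shiftSign, ← ksign_add, ← ksign_add]
  congr 1
  obtain ⟨m, hm⟩ := Int.even_mul_succ_self r
  obtain ⟨n, hn⟩ := Int.even_mul_succ_self s
  have h : (r + s) * (r + s + 1) = 2 * (m + n + r * s) := by linear_combination hm + hn
  rw [hm, hn, h, ← two_mul, ← two_mul]
  simp

theorem shiftSign_succ (r : ℤ) : shiftSign k (r + 1) = -(ksign k r * shiftSign k r) := by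
  rw [shiftSign_add, mul_one, show shiftSign k 1 = -1 by simp [shiftSign]]
  ring

theorem shiftSign_sum {I : Type*} [LinearOrder I] (s : Finset I) (q : I → ℤ) :
    shiftSign k (∑ i ∈ s, q i) =
      (∏ i ∈ s, shiftSign k (q i)) * ksign k (∑ i ∈ s, ∑ j ∈ s with j < i, q i * q j) := by
  induction s using Finset.induction_on_max with
  | empty => simp
  | insert a s ha ih =>
    have has : a ∉ s := fun h => lt_irrefl a (ha a h)
    have h1 : ∀ i ∈ s, {j ∈ insert a s | j < i} = {j ∈ s | j < i} := fun i hi => by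
      rw [Finset.filter_insert, if_neg (ha i hi).not_gt]
    have h2 : {j ∈ insert a s | j < a} = s := by
      rw [Finset.filter_insert, if_neg (lt_irrefl a), Finset.filter_true_of_mem ha]
    have h3 : ∑ i ∈ s, ∑ j ∈ insert a s with j < i, q i * q j =
        ∑ i ∈ s, ∑ j ∈ s with j < i, q i * q j :=
      Finset.sum_congr rfl fun i hi => by rw [h1 i hi]
    rw [Finset.sum_insert has, Finset.prod_insert has, Finset.sum_insert has, shiftSign_add, ih,
      h2, h3, ← Finset.mul_sum, ksign_add]
    ring

/-- The signs in the composition of the operations `Z^{⊗ I}`, and in the composition of operations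
on a complex, differ by the signs of the degree shifts. -/
theorem shiftSign_comp {I : Type*} [Fintype I] [LinearOrder I] (p : ℤ) (q α : I → ℤ) :
    shiftSign k (p + ∑ i, q i) * ksign k (p * ∑ i, q i) *
        ∏ i, ksign k ((∑ i' with i < i', q i') * (α i + q i)) =
      ksign k (∑ i, ∑ i' with i' < i, q i * α i') * shiftSign k p * ∏ i, shiftSign k (q i) := by
  -- The pairs are read in the other order: the sign from moving the `g i` past chains becomes the
  -- sign from moving them past inputs, times the signs of interchanging the `g i`, which
  -- `shiftSign_sum` absorbs.
  have h1 : ∏ i, ksign k ((∑ i' with i < i', q i') * (α i + q i)) =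
      ksign k (∑ i, ∑ i' with i' < i, q i * α i') * ksign k (∑ i, ∑ j with j < i, q i * q j) := by
    rw [← ksign_sum, ← ksign_add]
    congr 1
    simp only [Finset.sum_mul, mul_add, Finset.sum_filter, ← Finset.sum_add_distrib]
    rw [Finset.sum_comm]
    refine Finset.sum_congr rfl fun i _ => Finset.sum_congr rfl fun j _ => ?_
    split_ifs <;> simp
  rw [h1, shiftSign_add, shiftSign_sum]
  have h2 := ksign_mul_ksign_self (k := k) (p * ∑ i, q i)
  have h3 := ksign_mul_ksign_self (k := k) (∑ i, ∑ j with j < i, q i * q j)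
  linear_combination (shiftSign k p * (∏ i, shiftSign k (q i)) *
    ksign k (∑ i, ∑ i' with i' < i, q i * α i')) *
      (ksign k (p * ∑ i, q i) * ksign k (p * ∑ i, q i) * h3 + h2)

end ShiftSign

/-! ## The action on the complex of a cosimplicial Lie algebra -/

namespace CosimplicialLieAlgebra

open PseudoTensorCategory

variable {k : Type u} [Field k] {C : PseudoTensorCategory.{u, v, w} k}
  {B : CosimplicialLieAlgebra C} {I : Type}

section

variable {n : SimplexCategory} [Fintype I] [Nonempty I]

/-- A tensor of simplices acts through `B` of these simplices when their dimensions are those of the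
inputs and by zero otherwise; this identifies the coordinate-free operation with the explicit sum.
-/
theorem tensorOp_eq_sum [DecidableEq I] (ψ : LieOp k I) (a : I → ℕ) (x : ZTensor k I n) :
    B.tensorOp ψ a n x = ∑ s : ∀ i, SimplexCategory.mk (a i) ⟶ n,
      (ztBasis k I n).repr x (fun i => ⟨a i, s i⟩) •
        C.precomp ((B.lie n).act I ψ) fun i => mapOp B.toCosimplicial (s i) := by
  classical
  refine (LinearMap.congr_fun (f := B.tensorOp ψ a n)
    (g := ∑ s : ∀ i, SimplexCategory.mk (a i) ⟶ n,
      (Finsupp.lapply (fun i => (⟨a i, s i⟩ : Simplices n)) ∘ₗ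
        (ztBasis k I n).repr.toLinearMap).smulRight
          (C.precomp ((B.lie n).act I ψ) fun i => mapOp B.toCosimplicial (s i)))
    ((ztBasis k I n).ext fun t => ?_) x).trans ?_
  · rw [LinearMap.sum_apply]
    simp only [LinearMap.smulRight_apply, LinearMap.comp_apply, LinearEquiv.coe_coe,
      Module.Basis.repr_self, Finsupp.lapply_apply, Finsupp.single_apply]
    by_cases h : ∀ i, (t i).1 = a i
    · obtain ⟨s, rfl⟩ : ∃ s : ∀ i, SimplexCategory.mk (a i) ⟶ n, t = fun i => ⟨a i, s i⟩ := by
        obtain rfl : (fun i => (t i).1) = a := funext h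
        exact ⟨fun i => (t i).2, rfl⟩
      rw [Finset.sum_eq_single s]
      · rw [if_pos rfl, one_smul, ztBasis_apply, tensorOp_tprod]
        simp only [chainOp_single_self]
      · intro s' _ hs'
        rw [if_neg, zero_smul]
        exact fun h' => hs' (funext fun i => eq_of_heq (Sigma.mk.inj (congrFun h' i)).2.symm)
      · simp
    · obtain ⟨i, hi⟩ := not_forall.1 h
      rw [ztBasis_apply, tensorOp_tprod_of_eq_zero ψ _ _ i (chainOp_single_of_ne hi)]
      refine (Finset.sum_eq_zero fun s _ => ?_).symm
      rw [if_neg, zero_smul]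
      rintro rfl
      exact hi rfl
  · rw [LinearMap.sum_apply]
    rfl

/-- By naturality `g` at a simplex `s` is the image of `g` at a fundamental simplex, so the action
of `g(z)` factors through the object in degree `c`, the only one possible for degree reasons. -/
theorem tensorOp_ezDeg {χ : LieOp k I} {q : ℤ} {g : EZObj k I} (hg : g ∈ ezDeg k I q) {a : I → ℕ}
    {c : ℕ} (hc : (c : ℤ) = ∑ i, (a i : ℤ) + q) (z : ZChain k n) :
    B.tensorOp χ a n (g n z) = C.postcomp (chainOp B.toCosimplicial c n z)
      (B.tensorOp χ a _ (g _ (zId k c))) := by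
  refine LinearMap.congr_fun (f := B.tensorOp χ a n ∘ₗ g n)
    (g := (C.postcompLinear _ _ _).flip (B.tensorOp χ a _ (g _ (zId k c))) ∘ₗ
      chainOp B.toCosimplicial c n) (zChain_hom_ext ?_) z
  rintro ⟨m, s⟩
  have h : Finsupp.single (⟨m, s⟩ : Simplices n) (1 : k) = zMap k s (zId k m) := by
    rw [zMap_single, Category.id_comp]
  rw [LinearMap.comp_apply, LinearMap.comp_apply, LinearMap.flip_apply, postcompLinear_apply]
  by_cases hm : m = c
  · subst hm
    rw [chainOp_single_self, h, hg.1, tensorOp_ztMap]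
  · rw [chainOp_single_of_ne (s := ⟨m, s⟩) hm, tensorOp_of_mem χ (p := -(m : ℤ) + q) (by omega)
      (hg.2 _ _ _ (single_mem_zDeg (⟨m, s⟩ : Simplices n) 1)), ← postcompLinear_apply, map_zero]
    rfl

theorem tensorOp_ezDeg_of_neg {χ : LieOp k I} {q : ℤ} {g : EZObj k I} (hg : g ∈ ezDeg k I q)
    {a : I → ℕ} (hc : ∑ i, (a i : ℤ) + q < 0) (z : ZChain k n) :
    B.tensorOp χ a n (g n z) = 0 := by
  refine LinearMap.congr_fun (f := B.tensorOp χ a n ∘ₗ g n) (g := 0) (zChain_hom_ext fun s => ?_) z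
  exact tensorOp_of_mem χ (p := -(s.1 : ℤ) + q) (by omega) (hg.2 _ _ _ (single_mem_zDeg s 1))

theorem tensorOp_ezDeg_zId_of_ne {χ : LieOp k I} {q : ℤ} {g : EZObj k I} (hg : g ∈ ezDeg k I q)
    {a : I → ℕ} {b : ℕ} (hb : (b : ℤ) ≠ ∑ i, (a i : ℤ) + q) :
    B.tensorOp χ a _ (g _ (zId k b)) = 0 :=
  tensorOp_of_mem χ (p := -(b : ℤ) + q) (by omega) (hg.2 _ _ _ (zId_mem b))

/-- Each factor acts through the output degree `c i` of `g i` by `tensorOp_ezDeg`; sliding the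
resulting unary operations into the inputs of `ψ` turns the tensor into a composition. The sign
operators become the signs of the `c i`. -/
theorem tensorOp_ztFlatten_map {K : I → Type} [LinearOrder I] [∀ i, Fintype (K i)]
    [∀ i, Nonempty (K i)] (ψ : LieOp k I) (χ : ∀ i, LieOp k (K i)) {q : I → ℤ}
    {g : ∀ i, EZObj k (K i)} (hg : ∀ i, g i ∈ ezDeg k (K i) (q i)) (Q : I → ℤ)
    {a : (Σ i, K i) → ℕ} {c : I → ℕ} (hc : ∀ i, (c i : ℤ) = ∑ j, (a ⟨i, j⟩ : ℤ) + q i)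
    (x : ZTensor k I n) :
    B.tensorOp (lieComp ψ χ) a n
        (ztFlatten k n (PiTensorProduct.map (fun i => g i n ∘ₗ zSign k n (Q i)) x)) =
      (∏ i, ksign k (Q i * c i)) •
        C.comp (z := fun s => B.toCosimplicial.obj (SimplexCategory.mk (a s)))
          (y := fun i => B.toCosimplicial.obj (SimplexCategory.mk (c i))) (B.tensorOp ψ c n x)
            fun i => B.tensorOp (χ i) (fun j => a ⟨i, j⟩) _ (g i _ (zId k (c i))) := by
  refine LinearMap.congr_fun (f := B.tensorOp (lieComp ψ χ) a n ∘ₗ ztFlatten k n ∘ₗ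
      PiTensorProduct.map (fun i => g i n ∘ₗ zSign k n (Q i)))
    (g := (∏ i, ksign k (Q i * c i)) • (MultilinearMap.evalLinear (fun i =>
        B.tensorOp (χ i) (fun j => a ⟨i, j⟩) _ (g i _ (zId k (c i)))) ∘ₗ
      C.comp (z := fun s => B.toCosimplicial.obj (SimplexCategory.mk (a s)))
          (y := fun i => B.toCosimplicial.obj (SimplexCategory.mk (c i))) ∘ₗ B.tensorOp ψ c n))
    ((ztBasis k I n).ext fun s => ?_) x
  rw [LinearMap.comp_apply, LinearMap.comp_apply, ztBasis_apply, PiTensorProduct.map_tprod,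
    tensorOp_ztFlatten, LinearMap.smul_apply, LinearMap.comp_apply, LinearMap.comp_apply,
    MultilinearMap.evalLinear_apply, tensorOp_tprod, comp_precomp]
  have h : ∀ i, B.tensorOp (χ i) (fun j => a ⟨i, j⟩) n
      ((g i n ∘ₗ zSign k n (Q i)) (Finsupp.single (s i) 1)) = ksign k (Q i * c i) •
        C.postcomp (chainOp B.toCosimplicial (c i) n (Finsupp.single (s i) 1))
          (B.tensorOp (χ i) (fun j => a ⟨i, j⟩) _ (g i _ (zId k (c i)))) := fun i => by
    rw [LinearMap.comp_apply, tensorOp_ezDeg (hg i) (hc i), chainOp_zSign, ← postcompLinear_apply,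
      map_smul, LinearMap.smul_apply, postcompLinear_apply]
  rw [funext h, MultilinearMap.map_smul_univ]

theorem tensorOp_ztFlatten_map_of_neg {K : I → Type} [LinearOrder I] [∀ i, Fintype (K i)]
    [∀ i, Nonempty (K i)] (ψ : LieOp k I) (χ : ∀ i, LieOp k (K i)) {q : I → ℤ}
    {g : ∀ i, EZObj k (K i)} (hg : ∀ i, g i ∈ ezDeg k (K i) (q i)) (Q : I → ℤ)
    {a : (Σ i, K i) → ℕ} {i : I} (hi : ∑ j, (a ⟨i, j⟩ : ℤ) + q i < 0) (x : ZTensor k I n) :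
    B.tensorOp (lieComp ψ χ) a n
      (ztFlatten k n (PiTensorProduct.map (fun i => g i n ∘ₗ zSign k n (Q i)) x)) = 0 := by
  refine LinearMap.congr_fun (f := B.tensorOp (lieComp ψ χ) a n ∘ₗ ztFlatten k n ∘ₗ
      PiTensorProduct.map (fun i => g i n ∘ₗ zSign k n (Q i))) (g := 0)
    ((ztBasis k I n).ext fun s => ?_) x
  rw [LinearMap.comp_apply, LinearMap.comp_apply, ztBasis_apply, PiTensorProduct.map_tprod,
    tensorOp_ztFlatten]
  exact MultilinearMap.map_coord_zero _ i (tensorOp_ezDeg_of_neg (hg i) hi _)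

end

/-- The operation on `MB` defined by `φ ⊗ ψ`. -/
noncomputable def ezOp (B : CosimplicialLieAlgebra C) [Fintype I] [Nonempty I] (φ : EZObj k I)
    (ψ : LieOp k I) (a : I → ℕ) (b : ℕ) :
    C.P I (fun i => B.toCosimplicial.obj (SimplexCategory.mk (a i)))
      (B.toCosimplicial.obj (SimplexCategory.mk b)) :=
  shiftSign k ((b : ℤ) - ∑ i, (a i : ℤ)) • B.tensorOp ψ a _ (φ _ (zId k b))

theorem action_tmul [Fintype I] [LinearOrder I] [Nonempty I] (φ : EZObj k I) (ψ : LieOp k I) :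
    B.action I (φ ⊗ₜ[k] ψ) = B.ezOp φ ψ := by
  refine (TensorProduct.lift.tmul _ _).trans ?_
  funext a b
  exact congrArg _ (tensorOp_eq_sum ψ a _).symm

theorem ezOp_of_ne [Fintype I] [Nonempty I] {φ : EZObj k I} {r : ℤ} (hφ : φ ∈ ezDeg k I r)
    (ψ : LieOp k I) {a : I → ℕ} {b : ℕ} (h : (b : ℤ) ≠ ∑ i, (a i : ℤ) + r) :
    B.ezOp φ ψ a b = 0 := by
  rw [ezOp, tensorOp_ezDeg_zId_of_ne hφ h, smul_zero]

/-- The coface complex is written with integer signs, which are replaced by scalars of `k`. -/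
theorem dOp_complex (m : ℕ) : dOp B.complex m (m + 1) = cofaceOp B.toCosimplicial m := by
  refine (CochainComplex.of_d (fun n => B.toCosimplicial.obj (SimplexCategory.mk n))
    (AlgebraicTopology.AlternatingCofaceMapComplex.objD B.toCosimplicial) m).trans ?_
  refine Finset.sum_congr rfl fun i _ => ?_
  refine (Int.cast_smul_eq_zsmul k ((-1 : ℤ) ^ (i : ℕ))
    (mapOp B.toCosimplicial (SimplexCategory.δ i))).symm.trans ?_
  rw [Int.cast_pow, Int.cast_neg, Int.cast_one]

theorem postcomp_chainOp_dOp {n : SimplexCategory} {m m' : ℕ} (h : m' = m + 1) (z : ZChain k n) :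
    C.postcomp (x := B.toCosimplicial.obj (SimplexCategory.mk m'))
      (chainOp B.toCosimplicial m' n z) (dOp B.complex m m') =
      chainOp B.toCosimplicial m n (zD k n z) := by
  subst h
  rw [dOp_complex]
  exact (chainOp_zD m z).symm

theorem postcomp_chainOp_idOp {n : SimplexCategory} {m m' : ℕ} (h : m' = m) (z : ZChain k n) :
    C.postcomp (x := B.toCosimplicial.obj (SimplexCategory.mk m'))
      (chainOp B.toCosimplicial m' n z) (idOp B.complex m m') =
      chainOp B.toCosimplicial m n z := by
  subst h
  rw [idOp, dif_pos rfl]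
  exact Category.id_comp (X := B.toCosimplicial.obj (SimplexCategory.mk m')) (Y := B.toCosimplicial.obj n) _

end CosimplicialLieAlgebra

namespace PseudoTensorCategory

variable {k : Type u} [Field k] {C : PseudoTensorCategory.{u, v, w} k}
  {X : CochainComplex C.Obj ℕ} {I : Type} {K : I → Type} [Fintype I] [LinearOrder I] [Nonempty I]
  [∀ i, Fintype (K i)] [∀ i, Nonempty (K i)] (q : I → ℤ) (f : ComplexOps X I)
  (g : ∀ i, ComplexOps X (K i)) {a : (Σ i, K i) → ℕ} (b : ℕ)

/-- Natural numbers `c i` with the required values replace `toNat`, so that the types of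
intermediate objects can be matched. -/
theorem complexOpsComp_apply (c : I → ℕ) (hc : ∀ i, (c i : ℤ) = ∑ j, (a ⟨i, j⟩ : ℤ) + q i) :
    complexOpsComp X q f g a b = ksign k (∑ i, ∑ i' with i' < i, q i * ∑ j, (a ⟨i', j⟩ : ℤ)) •
      C.comp (z := fun s => X.X (a s)) (y := fun i => X.X (c i)) (f c b)
        fun i => g i (fun j => a ⟨i, j⟩) (c i) := by
  have h : ∀ i, 0 ≤ ∑ j, (a ⟨i, j⟩ : ℤ) + q i := fun i => by rw [← hc]; positivity
  obtain rfl : (fun i => (∑ j, (a ⟨i, j⟩ : ℤ) + q i).toNat) = c :=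
    funext fun i => by rw [← hc, Int.toNat_natCast]
  simp only [complexOpsComp, LinearMap.coe_mk, AddHom.coe_mk, MultilinearMap.pi_apply]
  rw [if_pos h]
  rfl

theorem complexOpsComp_apply_of_neg {i : I} (hi : ∑ j, (a ⟨i, j⟩ : ℤ) + q i < 0) :
    complexOpsComp X q f g a b = 0 := by
  simp only [complexOpsComp, LinearMap.coe_mk, AddHom.coe_mk, MultilinearMap.pi_apply]
  rw [if_neg fun h => (h i).not_gt hi]
  rfl

end PseudoTensorCategory

namespace CosimplicialLieAlgebra

open PseudoTensorCategory

variable {k : Type u} [Field k] {C : PseudoTensorCategory.{u, v, w} k}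
  {B : CosimplicialLieAlgebra C} {I : Type}

theorem postcomp_cofaceOp_tensorOp [Fintype I] [Nonempty I] (ψ : LieOp k I) (a : I → ℕ) (m : ℕ)
    (x : ZTensor k I (SimplexCategory.mk m)) :
    C.postcomp (cofaceOp B.toCosimplicial m) (B.tensorOp ψ a _ x) =
      B.tensorOp ψ a _ (ztFaces k I m x) := by
  rw [cofaceOp, ← postcompLinear_apply, map_sum, LinearMap.sum_apply, ztFaces_apply, map_sum]
  refine Finset.sum_congr rfl fun i _ => ?_
  rw [map_smul, LinearMap.smul_apply, postcompLinear_apply, map_smul, tensorOp_ztMap]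

/-- Differentiating input `i` is differentiating tensor factor `i`. The operation is evaluated at a
multidegree larger by one in total, which shifts the argument of the sign by `-1`. -/
theorem sum_complexOpsDIn_ezOp [Fintype I] [LinearOrder I] [Nonempty I] (φ : EZObj k I)
    (ψ : LieOp k I) (a : I → ℕ) (b : ℕ) :
    ∑ i, ksign k (∑ i' with i' < i, (a i' : ℤ)) •
      complexOpsDIn B.complex (B.ezOp φ ψ) i a b =
      shiftSign k ((b : ℤ) - ∑ i, (a i : ℤ) - 1) • B.tensorOp ψ a _ (ztD k I _ (φ _ (zId k b))) := by
  rw [ztD_eq_sum, LinearMap.sum_apply, map_sum, Finset.smul_sum]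
  refine Finset.sum_congr rfl fun i _ => ?_
  have hs : (b : ℤ) - ∑ j, (Function.update a i (a i + 1) j : ℤ) =
      (b : ℤ) - ∑ i, (a i : ℤ) - 1 := by
    have h : ∀ j, (Function.update a i (a i + 1) j : ℤ) = a j + if j = i then 1 else 0 := by
      intro j
      by_cases h : j = i
      · subst h; simp
      · simp [h]
    simp only [h, Finset.sum_add_distrib]
    simp
    ring
  rw [← tensorOp_map_update_zD ψ a i (φ _ (zId k b))
    (fun j => if j = i then dOp B.complex (a j) (Function.update a i (a i + 1) j)
      else idOp B.complex (a j) (Function.update a i (a i + 1) j))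
    (fun z => by
      refine (congrArg (C.postcomp _) (if_pos rfl)).trans ?_
      exact postcomp_chainOp_dOp (Function.update_self i (a i + 1) a) z)
    (fun j hj z => by
      refine (congrArg (C.postcomp _) (if_neg hj)).trans ?_
      exact postcomp_chainOp_idOp (Function.update_of_ne hj _ _) z), smul_comm, ← hs]
  exact congrArg _ (C.precomp_smul _ _ _)

/-- In `dφ` the differential of the target of `φ` becomes that of the inputs, and the differential
of its source becomes that of the output. The roles are interchanged, and `shiftSign_succ` corrects
both signs. -/
theorem ezOp_ezD [Fintype I] [LinearOrder I] [Nonempty I] {φ : EZObj k I} {r : ℤ}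
    (hφ : φ ∈ ezDeg k I r) (ψ : LieOp k I) :
    B.ezOp (ezD k I φ) ψ = complexOpsD B.complex I (B.ezOp φ ψ) := by
  funext a b
  change _ = complexOpsDOut B.complex (B.ezOp φ ψ) a b - ksign k ((b : ℤ) - ∑ i, (a i : ℤ) - 1) •
      ∑ i, ksign k (∑ i' with i' < i, (a i' : ℤ)) • complexOpsDIn B.complex (B.ezOp φ ψ) i a b
  rw [sum_complexOpsDIn_ezOp]
  have hs := shiftSign_succ (k := k) ((b : ℤ) - ∑ i, (a i : ℤ) - 1)
  rw [sub_add_cancel] at hs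
  have hin : ∀ y : C.P I (fun i => B.toCosimplicial.obj (SimplexCategory.mk (a i)))
      (B.toCosimplicial.obj (SimplexCategory.mk b)),
      ksign k ((b : ℤ) - ∑ i, (a i : ℤ) - 1) •
        shiftSign k ((b : ℤ) - ∑ i, (a i : ℤ) - 1) • y =
        -(shiftSign k ((b : ℤ) - ∑ i, (a i : ℤ)) • y) := fun y => by
    rw [hs, smul_smul, neg_smul, neg_neg]
  refine Eq.trans ?_ (congrArg (complexOpsDOut B.complex (B.ezOp φ ψ) a b - ·) (hin _)).symm
  rw [ezOp]
  rcases b with _ | b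
  -- For `b = 0` there is no output differential, and correspondingly the fundamental vertex has no
  -- boundary.
  · rw [ezD_zId_zero hφ]
    refine Eq.trans ?_ (zero_sub _).symm
    exact (neg_neg _).symm
  · rw [ezD_zId_succ hφ, map_sub, map_smul, smul_sub]
    have hout : complexOpsDOut B.complex (B.ezOp φ ψ) a (b + 1) =
        shiftSign k ((b : ℤ) - ∑ i, (a i : ℤ)) •
          B.tensorOp ψ a _ (ztFaces k I b (φ _ (zId k b))) := by
      change C.postcomp (dOp B.complex b (b + 1)) (B.ezOp φ ψ a b) = _
      rw [dOp_complex, ← postcomp_cofaceOp_tensorOp]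
      exact C.postcomp_smul _ _ _
    rw [hout]
    have hsub : ∀ x y z : C.P I (fun i => B.toCosimplicial.obj (SimplexCategory.mk (a i)))
        (B.toCosimplicial.obj (SimplexCategory.mk (b + 1))), z = -y → x - z = y - -x := by
      rintro x y _ rfl
      rw [sub_neg_eq_add, sub_neg_eq_add]
      exact add_comm _ _
    refine hsub _ _ _ ?_
    -- Outside the degree `r` of `φ` both contributions of the output differential are zero; in
    -- degree `r` the signs match.
    by_cases hr : (b : ℤ) = ∑ i, (a i : ℤ) + r
    · obtain rfl : r = (b : ℤ) - ∑ i, (a i : ℤ) := by omega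
      have h : shiftSign k (((b + 1 : ℕ) : ℤ) - ∑ i, (a i : ℤ)) *
          ksign k ((b : ℤ) - ∑ i, (a i : ℤ)) = -shiftSign k ((b : ℤ) - ∑ i, (a i : ℤ)) := by
        rw [show ((b + 1 : ℕ) : ℤ) - ∑ i, (a i : ℤ) = (b : ℤ) - ∑ i, (a i : ℤ) + 1 by
          push_cast; ring, shiftSign_succ, neg_mul, mul_right_comm, ksign_mul_ksign_self, one_mul]
      rw [smul_smul, h, neg_smul]
    · rw [tensorOp_of_mem ψ (p := -(b : ℤ) + r) (by omega)
        (ztFaces_mem (hφ.2 _ _ _ (zId_mem b))), smul_zero, smul_zero, smul_zero, neg_zero]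

theorem ezOp_ezUnit : B.ezOp (ezUnit k) lieUnit = (complexOperad B.complex).unit := by
  funext a b
  rw [ezOp, ezUnit_apply, tensorOp_tprod, (B.lie _).act_unit]
  refine (congrArg _ (C.precomp_unit (chainOp B.toCosimplicial (a ()) _ (zId k b)))).trans ?_
  change _ = idOp B.complex (a ()) b
  by_cases h : b = a ()
  · subst h
    rw [chainOp_zId, idOp, dif_pos rfl]
    simp only [Finset.univ_unique, PUnit.default_eq_unit, Finset.sum_singleton, sub_self,
      shiftSign_zero, one_smul]
    rfl
  · rw [chainOp_single_of_ne h, smul_zero, idOp, dif_neg (Ne.symm h)]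
    rfl

theorem ezOp_ezRelabel {J : Type} [Fintype I] [LinearOrder I] [Nonempty I] [Fintype J]
    [LinearOrder J] [Nonempty J] (e : I ≃ J) (φ : EZObj k I) (ψ : LieOp k I) :
    B.ezOp (ezRelabel k e φ) (lieRelabel e ψ) =
      complexOpsRelabel B.complex e (B.ezOp φ ψ) := by
  funext a b
  change _ = koszulSign k e (fun i => (a (e i) : ℤ)) •
    C.relabel e (y := fun j => B.toCosimplicial.obj (SimplexCategory.mk (a j)))
      (B.ezOp φ ψ (fun i => a (e i)) b)
  rw [ezOp, ezRelabel_apply, LinearMap.comp_apply, tensorOp_ztPerm, ezOp, map_smul,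
    Equiv.sum_comp e fun j => (a j : ℤ), smul_comm]

/-- After `tensorOp_ztFlatten_map` the operations agree, and the scalars are those of
`shiftSign_comp` with `α i = c i - q i`, the total degree of the inputs of `g i`. -/
theorem ezOp_ezComp_apply {K : I → Type} [Fintype I] [LinearOrder I] [Nonempty I]
    [∀ i, Fintype (K i)] [∀ i, Nonempty (K i)] {p : ℤ} {q : I → ℤ} {φ : EZObj k I}
    {g : ∀ i, EZObj k (K i)} (hφ : φ ∈ ezDeg k I p) (hg : ∀ i, g i ∈ ezDeg k (K i) (q i))
    (ψ : LieOp k I) (χ : ∀ i, LieOp k (K i)) (a : (Σ i, K i) → ℕ) (b : ℕ) (c : I → ℕ)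
    (hc : ∀ i, (c i : ℤ) = ∑ j, (a ⟨i, j⟩ : ℤ) + q i) :
    B.ezOp (ezComp k p q φ g) (lieComp ψ χ) a b =
      ksign k (∑ i, ∑ i' with i' < i, q i * ∑ j, (a ⟨i', j⟩ : ℤ)) •
        C.comp (z := fun s => B.toCosimplicial.obj (SimplexCategory.mk (a s)))
          (y := fun i => B.toCosimplicial.obj (SimplexCategory.mk (c i))) (B.ezOp φ ψ c b)
            fun i => B.ezOp (g i) (χ i) (fun j => a ⟨i, j⟩) (c i) := by
  have hα : ∀ i, ∑ j, (a ⟨i, j⟩ : ℤ) = c i - q i := fun i => by rw [hc]; ring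
  have hg' : (fun i => B.ezOp (g i) (χ i) (fun j => a ⟨i, j⟩) (c i)) =
      fun i => shiftSign k (q i) •
        B.tensorOp (χ i) (fun j => a ⟨i, j⟩) _ (g i _ (zId k (c i))) := funext fun i => by
    rw [ezOp, hα, sub_sub_cancel]
  rw [ezOp, ezComp_apply, LinearMap.smul_apply, LinearMap.comp_apply, LinearMap.comp_apply,
    map_smul, tensorOp_ztFlatten_map ψ χ hg _ hc, smul_smul, smul_smul, hg',
    MultilinearMap.map_smul_univ, ezOp, map_smul, smul_apply, smul_smul, smul_smul]
  by_cases hb : (b : ℤ) = ∑ i, (c i : ℤ) + p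
  · congr 1
    rw [Fintype.sum_sigma]
    simp only [hα]
    rw [show (b : ℤ) - ∑ i, ((c i : ℤ) - q i) = p + ∑ i, q i by
      rw [hb, Finset.sum_sub_distrib]; ring, hb, add_sub_cancel_left]
    have h := shiftSign_comp (k := k) p q fun i => (c i : ℤ) - q i
    simp only [sub_add_cancel] at h
    rw [h, mul_right_comm]
  -- In other output degrees the component of `φ` is zero, hence both sides are.
  · rw [tensorOp_ezDeg_zId_of_ne hφ hb, map_zero, zero_apply, smul_zero, smul_zero]

theorem ezOp_ezComp {K : I → Type} [Fintype I] [LinearOrder I] [Nonempty I] [∀ i, Fintype (K i)]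
    [∀ i, Nonempty (K i)] {p : ℤ} {q : I → ℤ} {φ : EZObj k I}
    {g : ∀ i, EZObj k (K i)} (hφ : φ ∈ ezDeg k I p) (hg : ∀ i, g i ∈ ezDeg k (K i) (q i))
    (ψ : LieOp k I) (χ : ∀ i, LieOp k (K i)) :
    B.ezOp (ezComp k p q φ g) (lieComp ψ χ) =
      complexOpsComp B.complex q (B.ezOp φ ψ) fun i => B.ezOp (g i) (χ i) := by
  funext a b
  by_cases h : ∀ i, 0 ≤ ∑ j, (a ⟨i, j⟩ : ℤ) + q i
  · obtain ⟨c, hc⟩ : ∃ c : I → ℕ, ∀ i, (c i : ℤ) = ∑ j, (a ⟨i, j⟩ : ℤ) + q i :=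
      ⟨fun i => (∑ j, (a ⟨i, j⟩ : ℤ) + q i).toNat, fun i => Int.toNat_of_nonneg (h i)⟩
    exact (ezOp_ezComp_apply hφ hg ψ χ a b c hc).trans
      (complexOpsComp_apply (X := B.complex) q _ _ b c hc).symm
  -- Some `g i` would have an output of negative degree: the composition in `MB` is zero by
  -- definition, and no chain has the degree required on the other side.
  · obtain ⟨i, hi⟩ := not_forall.1 h
    rw [not_le] at hi
    refine Eq.trans ?_ (complexOpsComp_apply_of_neg (X := B.complex) q _ _ b hi).symm
    rw [ezOp, ezComp_apply, LinearMap.smul_apply,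
      LinearMap.comp_apply, LinearMap.comp_apply, map_smul,
      tensorOp_ztFlatten_map_of_neg ψ χ hg _ hi, smul_zero, smul_zero]
    rfl

variable (B) in
theorem action_isOperadMap : DGOperadData.IsOperadMap B.action where
  map_mem {I} _ _ _ n x hx :=
    mem_of_mem_lieEZDeg (M := (complexOperad B.complex).obj I) (B.action I)
      ((complexOperad B.complex).deg I n) (fun φ hφ ψ a b h =>
        (congrFun₂ (action_tmul φ ψ) a b).trans (ezOp_of_ne hφ ψ h))
      (DGOperadData.truncLEZero_deg_le (L := lieEilenbergZilber k) I n hx)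
  map_d {I} _ _ _ n x hx := by
    refine eq_of_mem_lieEZDeg (M := (complexOperad B.complex).obj I)
      (f := B.action I ∘ₗ (ezD k I).rTensor (LieOp k I))
      (g := (complexOperad B.complex).d I ∘ₗ B.action I) (fun φ hφ ψ => ?_)
      (DGOperadData.truncLEZero_deg_le (L := lieEilenbergZilber k) I n hx)
    refine (action_tmul (ezD k I φ) ψ).trans ((ezOp_ezD hφ ψ).trans ?_)
    exact congrArg ((complexOperad B.complex).d I) (action_tmul φ ψ).symm
  map_unit := (action_tmul (ezUnit k) lieUnit).trans ezOp_ezUnit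
  map_relabel {I J} _ _ _ _ _ _ e n x hx := by
    refine eq_of_mem_lieEZDeg (M := (complexOperad B.complex).obj J)
      (f := B.action J ∘ₗ TensorProduct.map (ezRelabel k e) (lieRelabel e))
      (g := (complexOperad B.complex).relabel e ∘ₗ B.action I) (fun φ hφ ψ => ?_)
      (DGOperadData.truncLEZero_deg_le (L := lieEilenbergZilber k) I n hx)
    refine (action_tmul (ezRelabel k e φ) (lieRelabel e ψ)).trans
      ((ezOp_ezRelabel e φ ψ).trans ?_)
    exact congrArg ((complexOperad B.complex).relabel e) (action_tmul φ ψ).symm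
  map_comp {I K} _ _ _ _ _ _ p q f g hf hg := by
    refine eq_of_forall_mem_lieEZDeg (M := (complexOperad B.complex).obj (Σ i, K i))
      (f := (B.action (Σ i, K i)).compMultilinearMap (lieEZComp k p q f))
      (g := ((complexOperad B.complex).comp p q (B.action I f)).compLinearMap fun i => B.action (K i))
      (fun φ' ψ' hφ' => ?_)
      fun i => DGOperadData.truncLEZero_deg_le (L := lieEilenbergZilber k) (K i) (q i) (hg i)
    refine eq_of_mem_lieEZDeg (M := (complexOperad B.complex).obj (Σ i, K i))
      (f := B.action (Σ i, K i) ∘ₗ MultilinearMap.evalLinear (fun i => φ' i ⊗ₜ[k] ψ' i) ∘ₗ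
        lieEZComp k p q)
      (g := MultilinearMap.evalLinear (fun i => B.action (K i) (φ' i ⊗ₜ[k] ψ' i)) ∘ₗ
        (complexOperad B.complex).comp p q ∘ₗ B.action I) (fun φ hφ ψ => ?_)
      (DGOperadData.truncLEZero_deg_le (L := lieEilenbergZilber k) I p hf)
    refine (congrArg (B.action (Σ i, K i)) (lieEZComp_tmul p q φ ψ φ' ψ')).trans
      ((action_tmul (ezComp k p q φ φ') (lieComp ψ ψ')).trans
        ((ezOp_ezComp hφ hφ' ψ ψ').trans ?_))
    exact congrArg₂ (fun F G => (complexOperad B.complex).comp p q F G) (action_tmul φ ψ).symm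
      (funext fun i => (action_tmul (φ' i) (ψ' i)).symm)

end CosimplicialLieAlgebra

theorem theorem3p1 {k : Type u} [Field k] [CharZero k] (C : PseudoTensorCategory.{u, v, w} k)
    (B : CosimplicialLieAlgebra C) :
    IsHomotopyLieAlgebra (truncLieEZ k) (truncLieEZAug k) B.complex B.action := by
  exact ⟨truncLieEZ_isHomotopyLieOperad k, B.action_isOperadMap⟩
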